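/- There is an absolute constant $C>0$ with the following property. Let $(\Omega,\mathcal P)$ be a probability space, let $\xi_k\colon\Omega\to\{\pm1\}$ ($k\in\mathbb Z$) be independent Rademacher random variables (each value $\pm1$ taken with probability $\tfrac12$), let $\mathbb T=\mathbb R/\mathbb Z$ with normalized Lebesgue measure $m$, and let $Q=\Omega\times\mathbb T$ with the product measure $\mu=\mathcal P\times m$. Let $f$ be a Rademacher Fourier series, that is, an element of the closed linear span in $L^2(Q,\mu)$ of the functions $(\omega,\theta)\mapsto\xi_k(\omega)e^{2\pi i k\theta}$, $k\in\mathbb Z$, and let $\|f\|_2$ be its $L^2(Q,\mu)$-norm. Then for every complex-valued random constant $b=b(\omega)\in L^\infty(\Omega)$ with $\|b\|_\infty<\tfrac1{20}\|f\|_2$ and every measurable set $E\subset Q$ of positive measure, \[ \int_Q |f|^2\,d\mu \le \exp\Bigl(C\log^6\Bigl(\frac{2}{\mu(E)}\Bigr)\Bigr)\int_E |f-b|^2\,d\mu . \] In particular, for every Rademacher Fourier series $f$ and every measurable set $E\subset Q$ of positive measure, \[ \int_Q |f|^2\,d\mu \le \exp\Bigl(C\log^6\Bigl(\frac{2}{\mu(E)}\Bigr)\Bigr)\int_E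 |f|^2\,d\mu . \] -/

import Mathlib

open MeasureTheory ProbabilityTheory

universe u

noncomputable section

namespace RademacherFourier

/-- `ξ` is a sequence, indexed by `ℤ`, of independent Rademacher random variables on `(Ω, P)`:
each `ξ k` is `1` or `-1` with probability one half each. -/
structure IsRademacherSeq {Ω : Type*} [MeasurableSpace Ω] (P : Measure Ω) (ξ : ℤ → Ω → ℝ) :
    Prop where
  measurable : ∀ k, Measurable (ξ k)
  indep : iIndepFun ξ P
  prob_one : ∀ k, P {ω | ξ k ω = 1} = 1 / 2
  prob_neg_one : ∀ k, P {ω | ξ k ω = -1} = 1 / 2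

/-- The product measure `μ = P × m` on `Q = Ω × 𝕋`, where `𝕋 = ℝ / ℤ` and `m` is the Lebesgue
measure on `𝕋` with total mass one. -/
def prodCircle {Ω : Type*} [MeasurableSpace Ω] (P : Measure Ω) :
    Measure (Ω × AddCircle (1 : ℝ)) :=
  P.prod (AddCircle.haarAddCircle (T := (1 : ℝ)))

instance {Ω : Type*} [MeasurableSpace Ω] (P : Measure Ω) [IsProbabilityMeasure P] :
    IsProbabilityMeasure (prodCircle P) := by
  unfold prodCircle
  infer_instance

/-- The functions `φ_k (ω, θ) = ξ_k(ω) e^{2πikθ}` on `Q`. -/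
def phi {Ω : Type*} (ξ : ℤ → Ω → ℝ) (k : ℤ) (q : Ω × AddCircle (1 : ℝ)) : ℂ :=
  (ξ k q.1 : ℂ) * fourier k q.2

/-- The space of Rademacher Fourier series: the closed linear span of the functions `φ_k`,
`k ∈ ℤ`, in the complex Hilbert space `L²(Q)`. -/
def rademacherFourier {Ω : Type*} [MeasurableSpace Ω] (P : Measure Ω) (ξ : ℤ → Ω → ℝ) :
    Submodule ℂ (Lp ℂ 2 (prodCircle P)) :=
  (Submodule.span ℂ
    {g : Lp ℂ 2 (prodCircle P) | ∃ k : ℤ, g =ᵐ[prodCircle P] phi ξ k}).topologicalClosure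

end RademacherFourier

end

open RademacherFourier

/-!
Write `h = f - b`. The inequality is proved for finite sums `f = ∑ v_k φ_k` first. By
Chebyshev's inequality it is enough to show that `‖h‖ ≤ A` on `E` forces `‖f‖₂ ≤ K A` with a
constant `K` depending on `μ E` only. The idea, going back to Nazarov, is to spread the
smallness of `h` from `E` to slightly larger sets, again and again, at the price of a constant
factor in the bound, until the measure would have to exceed one.

*Chaos estimate.* For an orthonormal system `u_1, …, u_N` of coefficient vectors, the function
`∑ ‖f_{u_j}‖² - N` is a quadratic chaos in the signs with exponential moments of Gaussian type
(`sum_exp_quadForm_le`, obtained by integrating out the signs one at a time). Consequently at most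
`32 log (1 / μ E)` orthonormal vectors can have less than half of their share of mass on `E`
(`card_le_of_orthonormal`), and any `d + 2` vectors, with `d ≥ 32 log (1 / μ E)`, have a
normalised combination with coefficient sum zero whose norm is controlled by its integral over `E`
(`exists_relation`).

*Local approximation.* Rotating `θ` by multiples of `1 / M` multiplies `φ_k` by powers of a root
of unity and leaves `b` alone, so that `b` drops out of combinations with coefficient sum zero.
Applied to translates of `f` this shows that the matrix of the translates nearly has rank at most
`d + 1`; volume sampling (`exists_columns`) then selects at most `d + 1` of the frequencies of `f`
itself such that along orbit segments `h` is an exponential sum with at most `d + 2` unimodular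
bases, up to an error that is small in mean square (`exists_local_approx`).

*Spreading.* A short exponential sum with unimodular bases is bounded at a point by its values
along an arithmetic progression (`norm_expSum_le`), and progressions inside `E` exist ahead of
each point from which `E` has density close to one (`exists_progression`). If `T` is the first
time at which the rotated set departs noticeably from `E`, then by a rising sun inequality there
are many such points outside `E` (`measure_diff_preimage_le`). Hence `h` is bounded on a set whose
measure is larger by the factor `1 + 1 / (4096 (d + 2)³)` (`exists_spread`,
`norm_sq_le_or_exists_larger`).

*Termination.* If the rotated sets never depart from `E`, then `E` is nearly invariant under the
rotation by `1 / M`. On sets which are exactly invariant the mean square of `f` is `‖f‖₂²`, by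
Parseval's identity on the orbits, and `‖f‖²` is uniformly integrable by the chaos estimate; so
`‖f‖₂² ≤ 4 A²` (`norm_sq_le_of_almost_invariant`).

With `d` of order `L = log (2 / μ E)` there are of order `L⁴` steps, each losing a factor
`exp (O (L))`, which gives the exponent `O (L⁵)`, and `L⁵ ≤ 2 L⁶`. General `f` are limits of finite sums,
both sides of the inequality are continuous in `f`, and the condition on `b` is open.
-/

noncomputable section

namespace RademacherFourier

/-! ### Exponential moments of quadratic forms in random signs -/

/-- The sign attached to a Boolean. -/
def sgn (b : Bool) : ℝ := if b then 1 else -1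

@[simp] lemma sgn_mul_self (b : Bool) : sgn b * sgn b = 1 := by cases b <;> simp [sgn]

/-- The quadratic form `∑ i, ∑ j, x i * A i j * x j` of a square matrix. -/
def quadForm {ι : Type*} [Fintype ι] (A : Matrix ι ι ℝ) (x : ι → ℝ) : ℝ :=
  ∑ i, ∑ j, x i * A i j * x j

lemma quadForm_cons {n : ℕ} (A : Matrix (Fin (n + 1)) (Fin (n + 1)) ℝ) (hA : A.IsSymm) (t : ℝ)
    (x : Fin n → ℝ) :
    quadForm A (Fin.cons t x) = A 0 0 * t ^ 2 + 2 * t * ∑ j, A 0 j.succ * x j +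
      quadForm (A.submatrix Fin.succ Fin.succ) x := by
  have h : ∀ i : Fin n, A i.succ 0 = A 0 i.succ := fun i => hA.apply _ _
  simp only [quadForm, Fin.sum_univ_succ, Fin.cons_zero, Fin.cons_succ, h, Matrix.submatrix_apply,
    Finset.sum_add_distrib]
  have h1 : ∑ j, t * A 0 (Fin.succ j) * x j = t * ∑ j, A 0 j.succ * x j := by
    rw [Finset.mul_sum]; exact Finset.sum_congr rfl fun _ _ => by ring
  have h2 : ∑ j, x j * A 0 (Fin.succ j) * t = t * ∑ j, A 0 j.succ * x j := by
    rw [Finset.mul_sum]; exact Finset.sum_congr rfl fun _ _ => by ring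
  rw [h1, h2]; ring

/-- The Schur complement of the upper left entry. -/
def schurCompl {n : ℕ} (A : Matrix (Fin (n + 1)) (Fin (n + 1)) ℝ) : Matrix (Fin n) (Fin n) ℝ :=
  fun i j => A i.succ j.succ - A i.succ 0 * A 0 j.succ / A 0 0

lemma quadForm_schurCompl {n : ℕ} (A : Matrix (Fin (n + 1)) (Fin (n + 1)) ℝ) (hA : A.IsSymm)
    (x : Fin n → ℝ) :
    quadForm (schurCompl A) x = quadForm (A.submatrix Fin.succ Fin.succ) x -
      (∑ j, A 0 j.succ * x j) ^ 2 / A 0 0 := by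
  have h : ∀ i : Fin n, A i.succ 0 = A 0 i.succ := fun i => hA.apply _ _
  rw [sq, Finset.sum_mul_sum, Finset.sum_div]
  simp only [quadForm, schurCompl, Matrix.submatrix_apply, h]
  rw [← Finset.sum_sub_distrib]
  refine Finset.sum_congr rfl fun i _ => ?_
  rw [Finset.sum_div, ← Finset.sum_sub_distrib]
  exact Finset.sum_congr rfl fun j _ => by ring

lemma det_eq_mul_det_schurCompl {n : ℕ} (A : Matrix (Fin (n + 1)) (Fin (n + 1)) ℝ)
    (h0 : A 0 0 ≠ 0) : A.det = A 0 0 * (schurCompl A).det := by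
  let B : Matrix (Fin (n + 1)) (Fin (n + 1)) ℝ :=
    fun i j => Fin.cases (A 0 j) (fun k => A k.succ j - A k.succ 0 / A 0 0 * A 0 j) i
  have hB : A.det = B.det := by
    refine Matrix.det_eq_of_forall_row_eq_smul_add_const
      (fun i => Fin.cases 0 (fun k => A k.succ 0 / A 0 0) i) 0 rfl fun i j => ?_
    refine Fin.cases ?_ (fun k => ?_) i
    · simp [B]
    · simp [B]
  rw [hB, Matrix.det_succ_column_zero, Fin.sum_univ_succ, Finset.sum_eq_zero]
  · simp only [B, Fin.val_zero, pow_zero, one_mul, Fin.cases_zero, add_zero]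
    congr 2
    ext i j
    change A i.succ j.succ - A i.succ 0 / A 0 0 * A 0 j.succ = schurCompl A i j
    rw [schurCompl]
    ring
  · intro i _
    simp [B, h0]

/-- Gaussian domination: integrating out one sign at a time replaces the matrix by its Schur
complement, exactly as for a Gaussian integral, up to a factor that is at most one because the
diagonal entries are at most one. -/
lemma sum_exp_quadForm_mul_sqrt_det_le : ∀ (n : ℕ) (A : Matrix (Fin n) (Fin n) ℝ), A.IsSymm →
    (∀ x, x ≠ 0 → 0 < quadForm A x) → (∀ i, A i i ≤ 1) →
    0 < A.det ∧ (∑ σ : Fin n → Bool, Real.exp (-(1 / 2) * quadForm A fun i => sgn (σ i))) *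
      √A.det ≤ 2 ^ n * Real.exp (-(n / 2)) := by
  intro n
  induction n with
  | zero => intro A _ _ _; simp [quadForm]
  | succ n ih =>
    intro A hs hp hd
    have ha : 0 < A 0 0 := by
      have := hp (Fin.cons 1 0) (fun h => by simpa using congrFun h 0)
      rw [quadForm_cons A hs] at this
      simpa [quadForm] using this
    have hs' : (schurCompl A).IsSymm := by
      ext i j
      simp only [schurCompl, Matrix.transpose_apply]
      rw [hs.apply i.succ j.succ, ← hs.apply j.succ 0, ← hs.apply i.succ 0]
      ring
    have hp' : ∀ x, x ≠ 0 → 0 < quadForm (schurCompl A) x := by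
      intro x hx
      have := hp (Fin.cons (-(∑ j, A 0 j.succ * x j) / A 0 0) x) (fun h => hx (by
        ext i; simpa using congrFun h i.succ))
      rw [quadForm_cons A hs] at this
      rw [quadForm_schurCompl A hs]
      convert this using 1
      field_simp
      ring
    have hd' : ∀ i, schurCompl A i i ≤ 1 := by
      intro i
      have : 0 ≤ A i.succ 0 * A 0 i.succ / A 0 0 := by
        rw [hs.apply 0 i.succ]; exact div_nonneg (mul_self_nonneg _) ha.le
      simp only [schurCompl]
      linarith [hd i.succ]
    obtain ⟨hdet, hsum⟩ := ih _ hs' hp' hd'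
    rw [det_eq_mul_det_schurCompl A ha.ne']
    refine ⟨mul_pos ha hdet, ?_⟩
    have hstep : (∑ σ : Fin (n + 1) → Bool,
        Real.exp (-(1 / 2) * quadForm A fun i => sgn (σ i))) ≤
        2 * Real.exp (-(A 0 0 / 2)) * ∑ σ : Fin n → Bool,
          Real.exp (-(1 / 2) * quadForm (schurCompl A) fun i => sgn (σ i)) := by
      rw [← (Fin.consEquiv fun _ => Bool).sum_comp, Fintype.sum_prod_type_right, Finset.mul_sum]
      refine Finset.sum_le_sum fun σ _ => ?_
      have hc : ∀ b : Bool, (fun i => sgn ((Fin.consEquiv fun _ => Bool) (b, σ) i)) =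
          (Fin.cons (sgn b) fun i => sgn (σ i) : Fin (n + 1) → ℝ) := by
        intro b
        ext i
        refine Fin.cases ?_ (fun k => ?_) i <;> simp [Fin.consEquiv]
      simp only [Fintype.sum_bool, hc, quadForm_cons A hs, quadForm_schurCompl A hs]
      set ρ := ∑ j, A 0 j.succ * sgn (σ j)
      set q := quadForm (A.submatrix Fin.succ Fin.succ) fun i => sgn (σ i)
      have h1 : ρ ^ 2 / 2 ≤ ρ ^ 2 / A 0 0 / 2 := by
        have : ρ ^ 2 ≤ ρ ^ 2 / A 0 0 := le_div_self (sq_nonneg _) ha (hd 0)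
        linarith
      calc _ = 2 * (Real.exp (-(A 0 0 / 2) - q / 2) * Real.cosh ρ) := by
            have e1 : -(1 / 2) * (A 0 0 * sgn true ^ 2 + 2 * sgn true * ρ + q) =
                -(A 0 0 / 2) - q / 2 + -ρ := by simp [sgn]; ring
            have e2 : -(1 / 2) * (A 0 0 * sgn false ^ 2 + 2 * sgn false * ρ + q) =
                -(A 0 0 / 2) - q / 2 + ρ := by simp [sgn]; ring
            rw [e1, e2, Real.exp_add, Real.exp_add, Real.cosh_eq]
            ring
        _ ≤ 2 * (Real.exp (-(A 0 0 / 2) - q / 2) * Real.exp (ρ ^ 2 / A 0 0 / 2)) := by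
            gcongr
            exact (Real.cosh_le_exp_half_sq ρ).trans (Real.exp_le_exp.2 h1)
        _ = _ := by
            rw [mul_assoc, ← Real.exp_add, ← Real.exp_add]
            congr 2
            ring
    have hfac : Real.exp (-(A 0 0 / 2)) * √(A 0 0) ≤ Real.exp (-(1 / 2)) := by
      have : √(A 0 0) ≤ Real.exp ((A 0 0 - 1) / 2) := by
        rw [Real.sqrt_le_left (Real.exp_pos _).le, ← Real.exp_nat_mul]
        have := Real.add_one_le_exp (A 0 0 - 1)
        refine le_trans (by linarith) (this.trans (Real.exp_le_exp.2 ?_))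
        push_cast; linarith
      calc _ ≤ Real.exp (-(A 0 0 / 2)) * Real.exp ((A 0 0 - 1) / 2) := by gcongr
        _ = _ := by rw [← Real.exp_add]; congr 1; ring
    rw [Real.sqrt_mul ha.le]
    calc _ ≤ (2 * Real.exp (-(A 0 0 / 2)) * ∑ σ : Fin n → Bool,
          Real.exp (-(1 / 2) * quadForm (schurCompl A) fun i => sgn (σ i))) *
          (√(A 0 0) * √(schurCompl A).det) := by gcongr
      _ = 2 * (Real.exp (-(A 0 0 / 2)) * √(A 0 0)) * ((∑ σ : Fin n → Bool,
          Real.exp (-(1 / 2) * quadForm (schurCompl A) fun i => sgn (σ i))) *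
            √(schurCompl A).det) := by ring
      _ ≤ 2 * Real.exp (-(1 / 2)) * (2 ^ n * Real.exp (-(n / 2))) := by gcongr
      _ = 2 ^ (n + 1) * (Real.exp (-(1 / 2)) * Real.exp (-(n / 2))) := by ring
      _ = _ := by
        rw [← Real.exp_add]
        congr 2
        push_cast
        ring

lemma exp_sub_sq_le_one_add {y : ℝ} (h : |y| ≤ 1 / 2) : Real.exp (y - y ^ 2) ≤ 1 + y := by
  rw [abs_le] at h
  rcases le_total 0 y with hy | hy
  · have := (abs_le.1 (Real.abs_exp_sub_one_sub_id_le (x := y - y ^ 2)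
      (by rw [abs_le]; constructor <;> nlinarith))).2
    nlinarith [mul_nonneg hy hy, mul_nonneg (mul_nonneg hy hy) hy]
  · have h1 := Real.quadratic_le_exp_of_nonneg (x := -(y - y ^ 2)) (by nlinarith)
    have h2 : 1 ≤ (1 + y) * Real.exp (-(y - y ^ 2)) := by
      refine le_trans ?_ (mul_le_mul_of_nonneg_left h1 (by linarith))
      have h3 : 0 ≤ (1 + y) * (1 - y) ^ 2 / 2 + y := by
        nlinarith [mul_nonneg (neg_nonneg.2 hy) (by linarith : 0 ≤ 1 + 2 * y)]
      nlinarith [mul_nonneg h3 (sq_nonneg y)]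
    rw [Real.exp_neg] at h2
    rwa [le_mul_inv_iff₀ (Real.exp_pos _), one_mul] at h2

lemma sum_eigenvalues_sq {n : ℕ} {A : Matrix (Fin n) (Fin n) ℝ} (hA : A.IsHermitian) :
    ∑ i, hA.eigenvalues i ^ 2 = (A * A).trace := by
  conv_rhs => rw [hA.spectral_theorem]
  rw [← map_mul, Unitary.conjStarAlgAut_apply, Matrix.trace_mul_cycle]
  simp [Matrix.diagonal_mul_diagonal, Matrix.trace_diagonal, sq]

/-- A lower bound for `det A` when `A` is a perturbation of the identity with trace `n`. -/
lemma exp_neg_sum_sq_le_det {n : ℕ} (A : Matrix (Fin n) (Fin n) ℝ) (hs : A.IsSymm)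
    (hl : ∀ x, 1 / 2 * ∑ i, x i ^ 2 ≤ quadForm A x)
    (hu : ∀ x, quadForm A x ≤ 3 / 2 * ∑ i, x i ^ 2) (hd : ∀ i, A i i = 1) :
    Real.exp (-(∑ i, ∑ j, A i j ^ 2 - n)) ≤ A.det := by
  have hA : A.IsHermitian := by
    rw [Matrix.IsHermitian, Matrix.conjTranspose_eq_transpose_of_trivial]; exact hs
  have hq : ∀ x : Fin n → ℝ, quadForm A x = x ⬝ᵥ A.mulVec x := by
    intro x
    simp only [quadForm, dotProduct, Matrix.mulVec, Finset.mul_sum, mul_assoc]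
  have hev : ∀ i, |hA.eigenvalues i - 1| ≤ 1 / 2 := by
    intro i
    set v : Fin n → ℝ := (hA.eigenvectorBasis i).ofLp
    have hv : ∑ j, v j ^ 2 = 1 := by
      have := hA.eigenvectorBasis.orthonormal.1 i
      rw [EuclideanSpace.norm_eq, Real.sqrt_eq_one] at this
      simpa [v] using this
    have h1 : quadForm A v = hA.eigenvalues i := by
      have hv' : v ⬝ᵥ v = 1 := by simpa [dotProduct, sq] using hv
      rw [hq, hA.mulVec_eigenvectorBasis, dotProduct_smul, hv', smul_eq_mul, mul_one]
    have := hl v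
    have := hu v
    rw [hv, h1] at *
    rw [abs_le]; constructor <;> linarith
  have htr : ∑ i, hA.eigenvalues i = n := by
    have := hA.trace_eq_sum_eigenvalues
    simp only [Matrix.trace, Matrix.diag, hd] at this
    simpa using this.symm
  have hsq : ∑ i, hA.eigenvalues i ^ 2 = ∑ i, ∑ j, A i j ^ 2 := by
    rw [sum_eigenvalues_sq hA, Matrix.trace]
    refine Finset.sum_congr rfl fun i _ => ?_
    rw [Matrix.diag, Matrix.mul_apply]
    refine Finset.sum_congr rfl fun j _ => ?_
    rw [hs.apply i j, sq]
  rw [hA.det_eq_prod_eigenvalues]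
  have : -(∑ i, ∑ j, A i j ^ 2 - n) =
      ∑ i, ((hA.eigenvalues i - 1) - (hA.eigenvalues i - 1) ^ 2) := by
    have : ∀ i, (hA.eigenvalues i - 1) - (hA.eigenvalues i - 1) ^ 2 =
        3 * hA.eigenvalues i - hA.eigenvalues i ^ 2 - 2 := fun i => by ring
    simp only [this, Finset.sum_sub_distrib, ← Finset.mul_sum, htr, hsq]
    simp; ring
  rw [this, Real.exp_sum]
  refine Finset.prod_le_prod (fun _ _ => (Real.exp_pos _).le) fun i _ => ?_
  have := exp_sub_sq_le_one_add (hev i)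
  simpa using this

/-- A Hanson-Wright type bound: the exponential moments of a quadratic chaos in independent signs
are controlled by the Hilbert-Schmidt norm. -/
lemma sum_exp_quadForm_le {n : ℕ} (M : Matrix (Fin n) (Fin n) ℝ) (hs : M.IsSymm)
    (hM : ∀ x, |quadForm M x| ≤ ∑ i, x i ^ 2) (hd : ∀ i, M i i = 0) {c : ℝ} (hc : |c| ≤ 1 / 2) :
    ∑ σ : Fin n → Bool, Real.exp (1 / 2 * c * quadForm M fun i => sgn (σ i)) ≤
      2 ^ n * Real.exp (1 / 2 * c ^ 2 * ∑ i, ∑ j, M i j ^ 2) := by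
  set A : Matrix (Fin n) (Fin n) ℝ := 1 - c • M with hAdef
  have hsA : A.IsSymm := by
    rw [hAdef]
    exact Matrix.IsSymm.sub Matrix.isSymm_one (hs.smul c)
  have hq : ∀ x, quadForm A x = ∑ i, x i ^ 2 - c * quadForm M x := by
    intro x
    simp only [quadForm, hAdef, Matrix.sub_apply, Matrix.smul_apply, mul_sub, sub_mul,
      Finset.sum_sub_distrib, Finset.mul_sum]
    congr 1
    · refine Finset.sum_congr rfl fun i _ => ?_
      simp [Matrix.one_apply, sq]
    · refine Finset.sum_congr rfl fun i _ => Finset.sum_congr rfl fun j _ => ?_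
      simp; ring
  have hcM : ∀ x, |c * quadForm M x| ≤ 1 / 2 * ∑ i, x i ^ 2 := by
    intro x
    rw [abs_mul]
    exact mul_le_mul hc (hM x) (abs_nonneg _) (by norm_num)
  have hdA : ∀ i, A i i = 1 := fun i => by simp [hAdef, hd]
  have hl : ∀ x, 1 / 2 * ∑ i, x i ^ 2 ≤ quadForm A x := fun x => by
    rw [hq]; linarith [(abs_le.1 (hcM x)).2]
  have hu : ∀ x, quadForm A x ≤ 3 / 2 * ∑ i, x i ^ 2 := fun x => by
    rw [hq]; linarith [(abs_le.1 (hcM x)).1]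
  have hpos : ∀ x, x ≠ 0 → 0 < quadForm A x := by
    intro x hx
    refine lt_of_lt_of_le ?_ (hl x)
    obtain ⟨i, hi⟩ := Function.ne_iff.1 hx
    have : 0 < ∑ i, x i ^ 2 := Finset.sum_pos' (fun _ _ => sq_nonneg _)
      ⟨i, Finset.mem_univ _, by have : x i ≠ 0 := hi; positivity⟩
    linarith
  obtain ⟨hdet, h⟩ := sum_exp_quadForm_mul_sqrt_det_le n A hsA hpos (fun i => (hdA i).le)
  have hlow := exp_neg_sum_sq_le_det A hsA hl hu hdA
  have hHS : ∑ i, ∑ j, A i j ^ 2 - n = c ^ 2 * ∑ i, ∑ j, M i j ^ 2 := by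
    have : ∀ i, ∑ j, A i j ^ 2 = 1 + c ^ 2 * ∑ j, M i j ^ 2 := by
      intro i
      have h1 : ∀ j, A i j ^ 2 = (1 : Matrix (Fin n) (Fin n) ℝ) i j + c ^ 2 * M i j ^ 2 := by
        intro j
        by_cases hij : i = j
        · subst hij; simp [hdA, hd]
        · simp [hAdef, hij]; ring
      simp only [h1, Finset.sum_add_distrib, Finset.mul_sum]
      simp [Matrix.one_apply]
    simp only [this, Finset.sum_add_distrib, ← Finset.mul_sum]
    simp
  rw [hHS] at hlow
  have hsqrt : Real.exp (-(1 / 2 * c ^ 2 * ∑ i, ∑ j, M i j ^ 2)) ≤ √A.det := by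
    refine Real.le_sqrt_of_sq_le (le_trans (le_of_eq ?_) hlow)
    rw [← Real.exp_nat_mul]; congr 1; push_cast; ring
  have hexp : ∀ σ : Fin n → Bool, Real.exp (-(1 / 2) * quadForm A fun i => sgn (σ i)) =
      Real.exp (-(n / 2)) * Real.exp (1 / 2 * c * quadForm M fun i => sgn (σ i)) := by
    intro σ
    rw [hq, ← Real.exp_add]
    congr 1
    simp only [sq, sgn_mul_self]
    simp
    ring
  simp only [hexp, ← Finset.mul_sum] at h
  set X := ∑ σ : Fin n → Bool, Real.exp (1 / 2 * c * quadForm M fun i => sgn (σ i))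
  have hX : 0 ≤ X := Finset.sum_nonneg fun _ _ => (Real.exp_pos _).le
  have h2 : X * √A.det ≤ 2 ^ n := by
    have he := Real.exp_pos (-((n : ℝ) / 2))
    have : Real.exp (-((n : ℝ) / 2)) * (X * √A.det) ≤ Real.exp (-((n : ℝ) / 2)) * 2 ^ n := by
      linarith [h]
    exact le_of_mul_le_mul_left this he
  have h3 : X * Real.exp (-(1 / 2 * c ^ 2 * ∑ i, ∑ j, M i j ^ 2)) ≤ 2 ^ n :=
    (mul_le_mul_of_nonneg_left hsqrt hX).trans h2
  rw [Real.exp_neg] at h3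
  rwa [mul_inv_le_iff₀ (Real.exp_pos _)] at h3

/-! ### Moments of finite Rademacher sums -/

lemma norm_sum_mul_ofReal_sq {ι : Type*} [Fintype ι] (c : ι → ℂ) (x : ι → ℝ) :
    ‖∑ k, c k * (x k : ℂ)‖ ^ 2 = ∑ k, ∑ l, x k * (starRingEnd ℂ (c k) * c l).re * x l := by
  have h1 : ((‖∑ k, c k * (x k : ℂ)‖ ^ 2 : ℝ) : ℂ) =
      ∑ k, ∑ l, (x k * (starRingEnd ℂ (c k) * c l) * x l : ℂ) := by
    push_cast
    rw [← Complex.conj_mul', map_sum, Finset.sum_mul_sum]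
    refine Finset.sum_congr rfl fun k _ => Finset.sum_congr rfl fun l _ => ?_
    simp; ring
  have h2 := congrArg Complex.re h1
  rw [Complex.ofReal_re] at h2
  rw [h2, Complex.re_sum]
  refine Finset.sum_congr rfl fun k _ => ?_
  rw [Complex.re_sum]
  refine Finset.sum_congr rfl fun l _ => ?_
  simp

/-- The chaos `∑ j, ‖∑ k, u j k * σ k‖² - N` attached to an orthonormal system `u` of `N` vectors
has exponential moments controlled by `N`. -/
lemma sum_exp_orthonormal_le {n N : ℕ} {u : Fin N → EuclideanSpace ℂ (Fin n)}
    (hu : Orthonormal ℂ u) {c : ℝ} (hc : |c| ≤ 1 / 2) :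
    ∑ σ : Fin n → Bool,
      Real.exp (1 / 2 * c * (N - ∑ j, ‖∑ k, u j k * (sgn (σ k) : ℂ)‖ ^ 2)) ≤
      2 ^ n * Real.exp (1 / 2 * c ^ 2 * N) := by
  set S : Matrix (Fin n) (Fin n) ℝ := fun k l => ∑ j, (starRingEnd ℂ (u j k) * u j l).re with hS
  set M : Matrix (Fin n) (Fin n) ℝ := fun k l => if k = l then 0 else -S k l with hM
  have hSs : ∀ k l, S k l = S l k := by
    intro k l
    simp only [hS]
    refine Finset.sum_congr rfl fun j _ => ?_
    simp [Complex.mul_re]; ring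
  have hY : ∀ x : Fin n → ℝ, ∑ j, ‖∑ k, u j k * (x k : ℂ)‖ ^ 2 = quadForm S x := by
    intro x
    simp only [norm_sum_mul_ofReal_sq, quadForm, hS]
    rw [Finset.sum_comm]
    refine Finset.sum_congr rfl fun k _ => ?_
    rw [Finset.sum_comm]
    refine Finset.sum_congr rfl fun l _ => ?_
    rw [Finset.mul_sum, Finset.sum_mul]
  have hdiag : ∀ k, S k k = ∑ j, ‖u j k‖ ^ 2 := by
    intro k
    simp only [hS]
    refine Finset.sum_congr rfl fun j _ => ?_
    rw [Complex.conj_mul', ← Complex.ofReal_pow, Complex.ofReal_re]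
  have htr : ∑ k, S k k = N := by
    simp only [hdiag]
    rw [Finset.sum_comm]
    have : ∀ j, ∑ k, ‖u j k‖ ^ 2 = 1 := fun j => by
      rw [← EuclideanSpace.norm_sq_eq, hu.1 j, one_pow]
    simp [this]
  have hbessel : ∀ x : Fin n → ℝ, quadForm S x ≤ ∑ k, x k ^ 2 := by
    intro x
    rw [← hY]
    set X : EuclideanSpace ℂ (Fin n) := WithLp.toLp 2 fun k => (x k : ℂ) with hX
    have h1 := hu.sum_inner_products_le X (s := Finset.univ)
    have h2 : ‖X‖ ^ 2 = ∑ k, x k ^ 2 := by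
      rw [EuclideanSpace.norm_sq_eq]
      simp [hX]
    rw [← h2]
    refine le_trans (Finset.sum_le_sum fun j _ => le_of_eq ?_) h1
    congr 1
    rw [PiLp.inner_apply, ← RCLike.norm_conj, map_sum]
    congr 1
    refine Finset.sum_congr rfl fun k _ => ?_
    simp [hX, mul_comm]
  have hnn : ∀ x : Fin n → ℝ, 0 ≤ quadForm S x := fun x => by
    rw [← hY]; positivity
  have hd1 : ∀ k, S k k ≤ 1 := by
    intro k
    have := hbessel (Pi.single k 1)
    have h2 : quadForm S (Pi.single k 1) = S k k := by
      simp [quadForm, Pi.single_apply]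
    have h3 : ∑ i, (Pi.single k 1 : Fin n → ℝ) i ^ 2 = 1 := by
      simp [Pi.single_apply, ite_pow]
    rwa [h2, h3] at this
  have hd0 : ∀ k, 0 ≤ S k k := fun k => by rw [hdiag]; positivity
  have hMq : ∀ x : Fin n → ℝ, quadForm M x = ∑ k, S k k * x k ^ 2 - quadForm S x := by
    intro x
    simp only [quadForm]
    rw [← Finset.sum_sub_distrib]
    refine Finset.sum_congr rfl fun k _ => ?_
    have : ∀ l, x k * M k l * x l = (if k = l then S k k * x k ^ 2 else 0) - x k * S k l * x l := by
      intro l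
      by_cases h : k = l
      · subst h; simp [hM]; ring
      · simp [hM, h]
    simp [this, Finset.sum_sub_distrib]
  have hMs : M.IsSymm := by
    ext k l
    change M l k = M k l
    by_cases h : k = l
    · simp [h]
    · simp [hM, h, Ne.symm h, hSs k l]
  have hMb : ∀ x, |quadForm M x| ≤ ∑ i, x i ^ 2 := by
    intro x
    have h1 : ∑ k, S k k * x k ^ 2 ≤ ∑ k, x k ^ 2 := Finset.sum_le_sum fun k _ =>
      mul_le_of_le_one_left (sq_nonneg _) (hd1 k)
    have h2 : 0 ≤ ∑ k, S k k * x k ^ 2 := Finset.sum_nonneg fun k _ =>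
      mul_nonneg (hd0 k) (sq_nonneg _)
    rw [hMq, abs_le]
    constructor <;> linarith [hbessel x, hnn x]
  have hHS : ∑ k, ∑ l, M k l ^ 2 ≤ N := by
    rw [← htr]
    refine Finset.sum_le_sum fun k _ => ?_
    -- the `k`-th row of the orthogonal projection onto the span of `u`
    set w : EuclideanSpace ℂ (Fin n) := ∑ j, starRingEnd ℂ (u j k) • u j with hw
    have h1 : ‖w‖ ^ 2 = S k k := by
      have : ((‖w‖ ^ 2 : ℝ) : ℂ) = ((S k k : ℝ) : ℂ) := by
        have h := inner_self_eq_norm_sq_to_K (𝕜 := ℂ) w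
        rw [hw, hu.inner_sum, ← hw] at h
        push_cast
        refine Eq.trans h.symm ?_
        rw [hdiag]
        push_cast
        refine Finset.sum_congr rfl fun j _ => ?_
        rw [Complex.conj_mul', RCLike.norm_conj]
      exact_mod_cast this
    rw [← h1, EuclideanSpace.norm_sq_eq]
    refine Finset.sum_le_sum fun l _ => ?_
    have h3 : S k l = (w l).re := by
      simp [hw, hS, Complex.re_sum]
    have h4 : M k l ^ 2 ≤ S k l ^ 2 := by
      by_cases h : k = l
      · simp [hM, h]; positivity
      · simp [hM, h]
    rw [h3] at h4
    refine h4.trans ?_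
    rw [← sq_abs]
    gcongr
    exact Complex.abs_re_le_norm _
  have hmain := sum_exp_quadForm_le M hMs hMb (fun i => by simp [hM]) hc
  refine le_trans (le_of_eq ?_) (hmain.trans ?_)
  · refine Finset.sum_congr rfl fun σ _ => ?_
    rw [hY, hMq]
    simp only [sq, sgn_mul_self, mul_one]
    rw [htr]
  · gcongr

/-- The law of finitely many coordinates of a Rademacher sequence is uniform. -/
lemma integral_comp_eq_sum {Ω : Type*} [MeasurableSpace Ω] {P : Measure Ω} [IsProbabilityMeasure P]
    {ξ : ℤ → Ω → ℝ} (hξ : IsRademacherSeq P ξ) (hval : ∀ k ω, ξ k ω = 1 ∨ ξ k ω = -1) {n : ℕ}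
    {e : Fin n → ℤ} (he : Function.Injective e) (G : (Fin n → ℝ) → ℝ) :
    ∫ ω, G (fun k => ξ (e k) ω) ∂P = (1 / 2) ^ n * ∑ σ : Fin n → Bool, G fun k => sgn (σ k) := by
  set A : (Fin n → Bool) → Set Ω := fun σ => ⋂ k ∈ (Finset.univ : Finset (Fin n)),
    ξ (e k) ⁻¹' {sgn (σ k)} with hA
  have hAm : ∀ σ, MeasurableSet (A σ) := fun σ =>
    Finset.measurableSet_biInter _ fun k _ => hξ.measurable _ (measurableSet_singleton _)
  have hmem : ∀ σ ω, ω ∈ A σ ↔ ∀ k, ξ (e k) ω = sgn (σ k) := by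
    intro σ ω; simp [hA]
  have hone : ∀ k b, P (ξ k ⁻¹' {sgn b}) = 1 / 2 := by
    intro k b
    cases b
    · exact hξ.prob_neg_one k
    · exact hξ.prob_one k
  have hP : ∀ σ, P.real (A σ) = (1 / 2) ^ n := by
    intro σ
    have h := (hξ.indep.precomp he).measure_inter_preimage_eq_mul Finset.univ
      (sets := fun k => {sgn (σ k)}) fun k _ => measurableSet_singleton _
    rw [measureReal_def, hA]
    simp only []
    rw [h]
    simp only [hone, Finset.prod_const]
    simp
  have hpt : ∀ ω, G (fun k => ξ (e k) ω) =
      ∑ σ, (A σ).indicator (fun _ => G fun k => sgn (σ k)) ω := by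
    intro ω
    rw [Finset.sum_eq_single fun k => decide (ξ (e k) ω = 1)]
    · have hω : ∀ k, ξ (e k) ω = sgn (decide (ξ (e k) ω = 1)) := by
        intro k
        rcases hval (e k) ω with h | h
        · simp [h, sgn]
        · rw [h]; norm_num [sgn]
      rw [Set.indicator_of_mem ((hmem _ _).2 hω)]
      congr 1
      ext k
      exact hω k
    · intro σ _ hσ
      refine Set.indicator_of_notMem (fun h => hσ ?_) _
      rw [hmem] at h
      ext k
      rw [h k]
      cases σ k <;> norm_num [sgn]
    · simp
  simp only [hpt]
  rw [integral_finsetSum _ fun σ _ => (integrable_const _).indicator (hAm σ), Finset.mul_sum]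
  refine Finset.sum_congr rfl fun σ _ => ?_
  rw [integral_indicator (hAm σ), setIntegral_const, hP, smul_eq_mul]

/-- The function `∑ k, v k * ψ k` with coefficient vector `v` in the system `ψ`. -/
def synth {Q : Type*} {n : ℕ} (ψ : Fin n → Q → ℂ) (v : EuclideanSpace ℂ (Fin n)) (q : Q) : ℂ :=
  ∑ k, v k * ψ k q

lemma measurable_synth {Q : Type*} [MeasurableSpace Q] {n : ℕ} {ψ : Fin n → Q → ℂ}
    (hψ : ∀ k, Measurable (ψ k)) (v : EuclideanSpace ℂ (Fin n)) : Measurable (synth ψ v) := by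
  unfold synth
  fun_prop

lemma norm_synth_le {Q : Type*} {n : ℕ} {ψ : Fin n → Q → ℂ} (hψ : ∀ k q, ‖ψ k q‖ = 1)
    (v : EuclideanSpace ℂ (Fin n)) (q : Q) : ‖synth ψ v q‖ ≤ ∑ k, ‖v k‖ :=
  (norm_sum_le _ _).trans (le_of_eq (Finset.sum_congr rfl fun k _ => by rw [norm_mul, hψ, mul_one]))

lemma integrable_norm_synth_sq {Q : Type*} [MeasurableSpace Q] {μ : Measure Q} [IsFiniteMeasure μ]
    {n : ℕ} {ψ : Fin n → Q → ℂ} (hm : ∀ k, Measurable (ψ k)) (hψ : ∀ k q, ‖ψ k q‖ = 1)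
    (v : EuclideanSpace ℂ (Fin n)) : Integrable (fun q => ‖synth ψ v q‖ ^ 2) μ := by
  refine Integrable.of_bound ((measurable_synth hm v).norm.pow_const 2).aestronglyMeasurable
    ((∑ k, ‖v k‖) ^ 2) (Filter.Eventually.of_forall fun q => ?_)
  rw [Real.norm_eq_abs, abs_of_nonneg (by positivity)]
  have := norm_synth_le hψ v q
  gcongr

lemma norm_fourier_apply (k : ℤ) (θ : AddCircle (1 : ℝ)) : ‖fourier k θ‖ = 1 := by
  rw [fourier_apply]
  exact Circle.norm_coe _

lemma measurable_phi {Ω : Type*} [MeasurableSpace Ω] {P : Measure Ω} {ξ : ℤ → Ω → ℝ}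
    (hξ : IsRademacherSeq P ξ) (k : ℤ) : Measurable (phi ξ k) := by
  unfold phi
  have := hξ.measurable k
  have h2 : Measurable (fun θ : AddCircle (1 : ℝ) => fourier k θ) :=
    (map_continuous (fourier k)).measurable
  fun_prop

lemma norm_phi {Ω : Type*} {ξ : ℤ → Ω → ℝ} (hval : ∀ k ω, ξ k ω = 1 ∨ ξ k ω = -1) (k : ℤ)
    (q : Ω × AddCircle (1 : ℝ)) : ‖phi ξ k q‖ = 1 := by
  rw [phi, norm_mul, norm_fourier_apply, mul_one]
  rcases hval k q.1 with h | h <;> simp [h]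

lemma synth_phi_eq {Ω : Type*} {ξ : ℤ → Ω → ℝ} {n : ℕ} (e : Fin n → ℤ)
    (v : EuclideanSpace ℂ (Fin n)) (ω : Ω) (θ : AddCircle (1 : ℝ)) :
    synth (fun k => phi ξ (e k)) v (ω, θ) = ∑ k, (v k * fourier (e k) θ) * (ξ (e k) ω : ℂ) := by
  simp only [synth, phi]
  exact Finset.sum_congr rfl fun k _ => by ring

section Concrete

variable {Ω : Type*} [MeasurableSpace Ω] {P : Measure Ω} [IsProbabilityMeasure P] {ξ : ℤ → Ω → ℝ}

lemma orthonormal_twist {n N : ℕ} {u : Fin N → EuclideanSpace ℂ (Fin n)} (hu : Orthonormal ℂ u)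
    (e : Fin n → ℤ) (θ : AddCircle (1 : ℝ)) :
    Orthonormal ℂ fun j => (WithLp.toLp 2 fun k => u j k * fourier (e k) θ :
      EuclideanSpace ℂ (Fin n)) := by
  rw [orthonormal_iff_ite] at hu ⊢
  intro i j
  rw [← hu i j, PiLp.inner_apply, PiLp.inner_apply]
  refine Finset.sum_congr rfl fun k _ => ?_
  have h : starRingEnd ℂ (fourier (e k) θ) * fourier (e k) θ = 1 := by
    rw [Complex.conj_mul', norm_fourier_apply]
    simp
  simp only [RCLike.inner_apply, map_mul]
  linear_combination (u j k * starRingEnd ℂ (u i k)) * h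

lemma integral_exp_synth_le (hξ : IsRademacherSeq P ξ) (hval : ∀ k ω, ξ k ω = 1 ∨ ξ k ω = -1)
    {n N : ℕ} {e : Fin n → ℤ} (he : Function.Injective e) {u : Fin N → EuclideanSpace ℂ (Fin n)}
    (hu : Orthonormal ℂ u) {c : ℝ} (hc : |c| ≤ 1 / 2) :
    Integrable (fun q => Real.exp
      (1 / 2 * c * (N - ∑ j, ‖synth (fun k => phi ξ (e k)) (u j) q‖ ^ 2))) (prodCircle P) ∧
    ∫ q, Real.exp (1 / 2 * c * (N - ∑ j, ‖synth (fun k => phi ξ (e k)) (u j) q‖ ^ 2))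
      ∂(prodCircle P) ≤ Real.exp (1 / 2 * c ^ 2 * N) := by
  have hm : ∀ j, Measurable (synth (fun k => phi ξ (e k)) (u j)) := fun j =>
    measurable_synth (fun k => measurable_phi hξ _) _
  have hint : Integrable (fun q => Real.exp
      (1 / 2 * c * (N - ∑ j, ‖synth (fun k => phi ξ (e k)) (u j) q‖ ^ 2))) (prodCircle P) := by
    refine Integrable.of_bound (Measurable.aestronglyMeasurable (by fun_prop))
      (Real.exp (|1 / 2 * c| * (N + ∑ j, (∑ k, ‖u j k‖) ^ 2)))
      (Filter.Eventually.of_forall fun q => ?_)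
    rw [Real.norm_eq_abs, Real.abs_exp, Real.exp_le_exp]
    refine (le_abs_self _).trans ?_
    rw [abs_mul]
    gcongr
    refine (abs_sub _ _).trans ?_
    rw [abs_of_nonneg (Nat.cast_nonneg N), abs_of_nonneg (by positivity)]
    gcongr with j
    exact norm_synth_le (fun k q => norm_phi hval _ _) _ _
  refine ⟨hint, ?_⟩
  unfold prodCircle at hint ⊢
  rw [integral_prod_symm _ hint]
  have hpt : ∀ θ : AddCircle (1 : ℝ), ∫ ω, Real.exp
      (1 / 2 * c * (N - ∑ j, ‖synth (fun k => phi ξ (e k)) (u j) (ω, θ)‖ ^ 2)) ∂P ≤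
      Real.exp (1 / 2 * c ^ 2 * N) := by
    intro θ
    simp only [synth_phi_eq]
    rw [integral_comp_eq_sum hξ hval he (fun x => Real.exp
      (1 / 2 * c * (N - ∑ j, ‖∑ k, (u j k * fourier (e k) θ) * (x k : ℂ)‖ ^ 2)))]
    have := sum_exp_orthonormal_le (orthonormal_twist hu e θ) hc
    calc _ ≤ (1 / 2 : ℝ) ^ n * (2 ^ n * Real.exp (1 / 2 * c ^ 2 * N)) := by
          gcongr
      _ = _ := by rw [← mul_assoc, ← mul_pow]; norm_num
  calc _ ≤ ∫ _ : AddCircle (1 : ℝ), Real.exp (1 / 2 * c ^ 2 * N)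
        ∂(AddCircle.haarAddCircle (T := (1 : ℝ))) := by
        refine integral_mono_of_nonneg (Filter.Eventually.of_forall fun θ => ?_)
          (integrable_const _) (Filter.Eventually.of_forall hpt)
        exact integral_nonneg fun _ => (Real.exp_pos _).le
    _ = _ := by simp

lemma integral_mul_rademacher (hξ : IsRademacherSeq P ξ) (hval : ∀ k ω, ξ k ω = 1 ∨ ξ k ω = -1)
    (k l : ℤ) : ∫ ω, ξ k ω * ξ l ω ∂P = if k = l then 1 else 0 := by
  by_cases h : k = l
  · subst h
    have : ∀ ω, ξ k ω * ξ k ω = 1 := fun ω => by rcases hval k ω with h | h <;> simp [h]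
    simp [this]
  · rw [if_neg h, (hξ.indep.indepFun h).integral_fun_mul_eq_mul_integral
      (hξ.measurable k).aestronglyMeasurable (hξ.measurable l).aestronglyMeasurable]
    have h0 : ∫ ω, ξ k ω ∂P = 0 := by
      have := integral_comp_eq_sum hξ hval (n := 1) (e := fun _ => k)
        (Function.injective_of_subsingleton _) (fun x => x 0)
      rw [this, ← (Equiv.funUnique (Fin 1) Bool).symm.sum_comp]
      simp [sgn]
    rw [h0, zero_mul]

lemma integral_norm_synth_sq (hξ : IsRademacherSeq P ξ) (hval : ∀ k ω, ξ k ω = 1 ∨ ξ k ω = -1)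
    {n : ℕ} {e : Fin n → ℤ} (he : Function.Injective e) (v : EuclideanSpace ℂ (Fin n)) :
    ∫ q, ‖synth (fun k => phi ξ (e k)) v q‖ ^ 2 ∂(prodCircle P) = ‖v‖ ^ 2 := by
  have hint := integrable_norm_synth_sq (μ := prodCircle P) (fun k => measurable_phi hξ (e k))
    (fun k q => norm_phi hval (e k) q) v
  unfold prodCircle at hint ⊢
  rw [integral_prod_symm _ hint]
  have hpt : ∀ θ : AddCircle (1 : ℝ),
      ∫ ω, ‖synth (fun k => phi ξ (e k)) v (ω, θ)‖ ^ 2 ∂P = ‖v‖ ^ 2 := by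
    intro θ
    simp only [synth_phi_eq, norm_sum_mul_ofReal_sq]
    have hi : ∀ k l, Integrable (fun ω => ξ (e k) ω * (starRingEnd ℂ (v k * fourier (e k) θ) *
        (v l * fourier (e l) θ)).re * ξ (e l) ω) P := by
      intro k l
      have h1 := hξ.measurable (e k)
      have h2 := hξ.measurable (e l)
      refine Integrable.of_bound (Measurable.aestronglyMeasurable (by fun_prop))
        |(starRingEnd ℂ (v k * fourier (e k) θ) * (v l * fourier (e l) θ)).re|
        (Filter.Eventually.of_forall fun ω => ?_)
      rw [Real.norm_eq_abs, abs_mul, abs_mul]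
      rcases hval (e k) ω with h | h <;> rcases hval (e l) ω with h' | h' <;> simp [h, h']
    rw [integral_finsetSum _ fun k _ => integrable_finsetSum _ fun l _ => hi k l,
      EuclideanSpace.norm_sq_eq]
    refine Finset.sum_congr rfl fun k _ => ?_
    rw [integral_finsetSum _ fun l _ => hi k l, Finset.sum_eq_single k]
    · have h1 : ∀ ω, ξ (e k) ω * (starRingEnd ℂ (v k * fourier (e k) θ) *
          (v k * fourier (e k) θ)).re * ξ (e k) ω = ‖v k‖ ^ 2 := by
        intro ω
        rw [Complex.conj_mul', ← Complex.ofReal_pow, Complex.ofReal_re, norm_mul,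
          norm_fourier_apply, mul_one]
        rcases hval (e k) ω with h | h <;> simp [h]
      simp only [h1]
      simp
    · intro l _ hl
      have h1 : ∀ ω, ξ (e k) ω * (starRingEnd ℂ (v k * fourier (e k) θ) *
          (v l * fourier (e l) θ)).re * ξ (e l) ω = (starRingEnd ℂ (v k * fourier (e k) θ) *
          (v l * fourier (e l) θ)).re * (ξ (e k) ω * ξ (e l) ω) := fun ω => by ring
      simp only [h1]
      rw [integral_const_mul, integral_mul_rademacher hξ hval, if_neg fun h => hl (he h).symm,
        mul_zero]
    · simp
  simp [hpt]

end Concrete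

/-! ### Large subspaces on which a set sees its share of the norm -/

/-- The properties of the functions `φ_k` used by the spreading argument: they are unimodular and
orthonormal, and the chaos attached to an orthonormal system of coefficient vectors has Gaussian
exponential moments. -/
structure IsChaosSystem {Q : Type*} [MeasurableSpace Q] (μ : Measure Q) {n : ℕ}
    (ψ : Fin n → Q → ℂ) : Prop where
  measurable : ∀ k, Measurable (ψ k)
  norm_eq_one : ∀ k q, ‖ψ k q‖ = 1
  integral_sq : ∀ v, ∫ q, ‖synth ψ v q‖ ^ 2 ∂μ = ‖v‖ ^ 2
  exp_le : ∀ (N : ℕ) (u : Fin N → EuclideanSpace ℂ (Fin n)), Orthonormal ℂ u →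
    ∀ c : ℝ, |c| ≤ 1 / 2 →
      Integrable (fun q => Real.exp (1 / 2 * c * (N - ∑ j, ‖synth ψ (u j) q‖ ^ 2))) μ ∧
      ∫ q, Real.exp (1 / 2 * c * (N - ∑ j, ‖synth ψ (u j) q‖ ^ 2)) ∂μ ≤
        Real.exp (1 / 2 * c ^ 2 * N)

lemma isChaosSystem_phi {Ω : Type*} [MeasurableSpace Ω] {P : Measure Ω} [IsProbabilityMeasure P]
    {ξ : ℤ → Ω → ℝ} (hξ : IsRademacherSeq P ξ) (hval : ∀ k ω, ξ k ω = 1 ∨ ξ k ω = -1) {n : ℕ}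
    {e : Fin n → ℤ} (he : Function.Injective e) :
    IsChaosSystem (prodCircle P) fun k => phi ξ (e k) where
  measurable _ := measurable_phi hξ _
  norm_eq_one _ := norm_phi hval _
  integral_sq := integral_norm_synth_sq hξ hval he
  exp_le _ _ hu _ hc := integral_exp_synth_le hξ hval he hu hc

lemma synth_smul {Q : Type*} {n : ℕ} {ψ : Fin n → Q → ℂ} (c : ℂ)
    (v : EuclideanSpace ℂ (Fin n)) (q : Q) :
    synth ψ (c • v) q = c * synth ψ v q := by
  simp [synth, Finset.mul_sum, mul_assoc]

lemma synth_add {Q : Type*} {n : ℕ} {ψ : Fin n → Q → ℂ} (v w : EuclideanSpace ℂ (Fin n)) (q : Q) :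
    synth ψ (v + w) q = synth ψ v q + synth ψ w q := by
  simp [synth, Finset.sum_add_distrib, add_mul]

lemma synth_sum {Q : Type*} {n : ℕ} {ψ : Fin n → Q → ℂ} {ι : Type*} (s : Finset ι)
    (v : ι → EuclideanSpace ℂ (Fin n)) (q : Q) :
    synth ψ (∑ i ∈ s, v i) q = ∑ i ∈ s, synth ψ (v i) q := by
  classical
  induction s using Finset.induction_on with
  | empty => simp [synth]
  | insert a s ha ih => rw [Finset.sum_insert ha, Finset.sum_insert ha, synth_add, ih]

section Abstract

variable {Q : Type*} [MeasurableSpace Q] {μ : Measure Q} [IsProbabilityMeasure μ] {n : ℕ}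
  {ψ : Fin n → Q → ℂ}

/-- An orthonormal system all of whose members have less than half of their proportional share of
the norm on `E` has at most `32 log (1 / μ E)` members. -/
lemma card_le_of_orthonormal (hψ : IsChaosSystem μ ψ) {E : Set Q}
    (hE0 : 0 < μ.real E) {N : ℕ} {u : Fin N → EuclideanSpace ℂ (Fin n)} (hu : Orthonormal ℂ u)
    (hsmall : ∀ j, ∫ q in E, ‖synth ψ (u j) q‖ ^ 2 ∂μ ≤ μ.real E / 2) :
    (N : ℝ) ≤ 32 * Real.log (1 / μ.real E) := by
  obtain ⟨hint, hle⟩ := hψ.exp_le N u hu (1 / 4) (by norm_num [abs_of_pos])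
  set g : Q → ℝ := fun q => Real.exp (1 / 2 * (1 / 4) * (N - ∑ j, ‖synth ψ (u j) q‖ ^ 2)) with hg
  have hi : ∀ j, Integrable (fun q => ‖synth ψ (u j) q‖ ^ 2) (μ.restrict E) := fun j =>
    (integrable_norm_synth_sq hψ.measurable hψ.norm_eq_one (u j)).restrict
  have hi' := integrable_finsetSum Finset.univ fun j _ => hi j
  have hpt : ∀ q, Real.exp (N / 16) * (1 + N / 16 - 1 / 8 * ∑ j, ‖synth ψ (u j) q‖ ^ 2) ≤ g q := by
    intro q
    have h1 := Real.add_one_le_exp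
      (1 / 2 * (1 / 4) * (N - ∑ j, ‖synth ψ (u j) q‖ ^ 2) - (N : ℝ) / 16)
    have h2 : g q = Real.exp (N / 16) * Real.exp
        (1 / 2 * (1 / 4) * (N - ∑ j, ‖synth ψ (u j) q‖ ^ 2) - (N : ℝ) / 16) := by
      simp only [hg]
      rw [← Real.exp_add]
      congr 1
      ring
    rw [h2]
    gcongr
    linarith
  have h1 : Real.exp (N / 16) * μ.real E ≤ ∫ q in E, g q ∂μ := by
    calc Real.exp (N / 16) * μ.real E
        ≤ Real.exp (N / 16) * (μ.real E * (1 + N / 16) -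
          1 / 8 * ∑ j, ∫ q in E, ‖synth ψ (u j) q‖ ^ 2 ∂μ) := by
          gcongr
          have : ∑ j, ∫ q in E, ‖synth ψ (u j) q‖ ^ 2 ∂μ ≤ N * (μ.real E / 2) := by
            refine (Finset.sum_le_sum fun j _ => hsmall j).trans ?_
            simp
          nlinarith
      _ = ∫ q in E, Real.exp (N / 16) *
          (1 + N / 16 - 1 / 8 * ∑ j, ‖synth ψ (u j) q‖ ^ 2) ∂μ := by
          rw [integral_const_mul, integral_sub (integrable_const _) (hi'.const_mul _),
            integral_const_mul, integral_finsetSum _ fun j _ => hi j, setIntegral_const,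
            smul_eq_mul]
      _ ≤ _ := by
          refine integral_mono ?_ hint.restrict hpt
          exact ((integrable_const _).sub (hi'.const_mul _)).const_mul _
  have h2 : ∫ q in E, g q ∂μ ≤ ∫ q, g q ∂μ :=
    setIntegral_le_integral hint (Filter.Eventually.of_forall fun q => (Real.exp_pos _).le)
  have h3 : Real.exp (N / 16) * μ.real E ≤ Real.exp (N / 32) := by
    refine (h1.trans (h2.trans hle)).trans (le_of_eq ?_)
    congr 1
    ring
  have h4 : Real.exp (N / 32) ≤ 1 / μ.real E := by
    rw [le_div_iff₀ hE0]
    have : Real.exp ((N : ℝ) / 16) = Real.exp (N / 32) * Real.exp (N / 32) := by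
      rw [← Real.exp_add]; congr 1; ring
    rw [this, mul_assoc] at h3
    exact le_of_mul_le_mul_left (by linarith) (Real.exp_pos (N / 32))
  have h5 := (Real.le_log_iff_exp_le (by positivity)).2 h4
  linarith

/-- There are at most `d` linear conditions which force a vector to have at least half of its
proportional share of the norm on `E`. -/
lemma exists_orthonormal_forall_le (hψ : IsChaosSystem μ ψ) {E : Set Q}
    (hE0 : 0 < μ.real E) {d : ℕ} (hd : 32 * Real.log (1 / μ.real E) ≤ d) :
    ∃ N ≤ d, ∃ u : Fin N → EuclideanSpace ℂ (Fin n), ∀ g, (∀ j, inner ℂ (u j) g = 0) →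
      μ.real E / 2 * ‖g‖ ^ 2 ≤ ∫ q in E, ‖synth ψ g q‖ ^ 2 ∂μ := by
  classical
  let p : ℕ → Prop := fun N => ∃ u : Fin N → EuclideanSpace ℂ (Fin n), Orthonormal ℂ u ∧
    ∀ j, ∫ q in E, ‖synth ψ (u j) q‖ ^ 2 ∂μ ≤ μ.real E / 2
  have hp : ∀ N, p N → N ≤ d := by
    rintro N ⟨u, hu, h⟩
    exact_mod_cast (card_le_of_orthonormal hψ hE0 hu h).trans hd
  have hp0 : p 0 := ⟨Fin.elim0, ⟨fun i => i.elim0, fun i => i.elim0⟩, fun i => i.elim0⟩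
  have hN := Nat.findGreatest_spec (P := p) (Nat.zero_le d) hp0
  set N := Nat.findGreatest p d
  obtain ⟨u, hu, hsm⟩ := hN
  refine ⟨N, Nat.findGreatest_le d, u, fun g hg => ?_⟩
  by_cases hg0 : g = 0
  · subst hg0
    simp [synth]
  have hgn : 0 < ‖g‖ := norm_pos_iff.2 hg0
  set w := ((‖g‖⁻¹ : ℝ) : ℂ) • g with hw
  have hwn : ‖w‖ = 1 := by
    rw [hw, norm_smul]; simp [hgn.ne']
  have hwsq : ∫ q in E, ‖synth ψ w q‖ ^ 2 ∂μ =
      (‖g‖ ^ 2)⁻¹ * ∫ q in E, ‖synth ψ g q‖ ^ 2 ∂μ := by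
    rw [← integral_const_mul]
    congr 1
    ext q
    rw [hw, synth_smul, norm_mul, mul_pow]
    simp
  by_contra hlt
  push Not at hlt
  have hsmall : ∫ q in E, ‖synth ψ w q‖ ^ 2 ∂μ ≤ μ.real E / 2 := by
    rw [hwsq, inv_mul_le_iff₀ (by positivity)]
    linarith
  have hp1 : p (N + 1) := by
    refine ⟨Fin.cons w u, ?_, fun j => ?_⟩
    · rw [orthonormal_iff_ite] at hu ⊢
      have hin : ∀ j, inner ℂ (u j) w = 0 := fun j => by rw [hw, inner_smul_right, hg j, mul_zero]
      intro i j
      refine Fin.cases ?_ (fun i => ?_) i <;> refine Fin.cases ?_ (fun j => ?_) j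
      · simp [inner_self_eq_norm_sq_to_K, hwn]
      · simp only [Fin.cons_zero, Fin.cons_succ]
        rw [inner_eq_zero_symm.1 (hin j), if_neg (Fin.succ_ne_zero j).symm]
      · simp only [Fin.cons_zero, Fin.cons_succ]
        rw [hin i, if_neg (Fin.succ_ne_zero i)]
      · simp only [Fin.cons_succ, hu i j, Fin.succ_inj]
    · refine Fin.cases ?_ (fun j => ?_) j
      · simpa using hsmall
      · simpa using hsm j
  have := Nat.le_findGreatest (P := p) (hp _ hp1) hp1
  exact absurd this (by change ¬ (N + 1 ≤ N); omega)

/-- Among the combinations, with coefficients summing to zero, of `d + 2` vectors there is a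
nontrivial one that has at least half of its proportional share of the norm on `E`. -/
lemma exists_relation (hψ : IsChaosSystem μ ψ) {E : Set Q}
    (hE0 : 0 < μ.real E) {d : ℕ} (hd : 32 * Real.log (1 / μ.real E) ≤ d)
    (v : Fin (d + 2) → EuclideanSpace ℂ (Fin n)) :
    ∃ α : Fin (d + 2) → ℂ, (∃ j, α j = 1) ∧ (∀ j, ‖α j‖ ≤ 1) ∧ ∑ j, α j = 0 ∧
      μ.real E / 2 * ‖∑ j, α j • v j‖ ^ 2 ≤ ∫ q in E, ‖synth ψ (∑ j, α j • v j) q‖ ^ 2 ∂μ := by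
  obtain ⟨N, hN, u, hu⟩ := exists_orthonormal_forall_le hψ hE0 hd
  let T : (Fin (d + 2) → ℂ) →ₗ[ℂ] (Fin N → ℂ) × ℂ :=
    { toFun := fun α => (fun i => ∑ j, α j * inner ℂ (u i) (v j), ∑ j, α j)
      map_add' := fun α β => by
        ext <;> simp [add_mul, Finset.sum_add_distrib]
      map_smul' := fun c α => by
        ext <;> simp [Finset.mul_sum, mul_assoc] }
  have hker : T.ker ≠ ⊥ := by
    refine LinearMap.ker_ne_bot_of_finrank_lt ?_
    simp
    omega
  obtain ⟨β, hβ, hβ0⟩ := (Submodule.ne_bot_iff _).1 hker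
  obtain ⟨j₀, -, hj₀⟩ := Finset.exists_max_image Finset.univ (fun j => ‖β j‖)
    ⟨0, Finset.mem_univ _⟩
  have hb : β j₀ ≠ 0 := by
    intro h
    refine hβ0 (funext fun j => ?_)
    have := hj₀ j (Finset.mem_univ _)
    rw [h, norm_zero] at this
    simpa using this
  have hTβ := LinearMap.mem_ker.1 hβ
  have h1 : ∀ i, ∑ j, β j * inner ℂ (u i) (v j) = 0 := fun i =>
    congrFun (congrArg Prod.fst hTβ) i
  have h2 : ∑ j, β j = 0 := congrArg Prod.snd hTβ
  refine ⟨fun j => β j / β j₀, ⟨j₀, div_self hb⟩, fun j => ?_, ?_, hu _ fun i => ?_⟩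
  · rw [norm_div]
    exact div_le_one_of_le₀ (hj₀ j (Finset.mem_univ _)) (norm_nonneg _)
  · rw [← Finset.sum_div, h2, zero_div]
  · rw [inner_sum]
    simp only [inner_smul_right]
    have : ∀ j, β j / β j₀ * inner ℂ (u i) (v j) = (β j₀)⁻¹ * (β j * inner ℂ (u i) (v j)) :=
      fun j => by ring
    simp only [this, ← Finset.mul_sum, h1, mul_zero]

end Abstract

/-! ### Choosing few frequencies by volume sampling -/

section Volume

variable {ι κ : Type*}

/-- The total squared volume of the `k × k` minors (with repetitions) of a matrix. -/
def minorSum [Fintype ι] [Fintype κ] (Φ : Matrix κ ι ℂ) (k : ℕ) : ℝ :=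
  ∑ s : Fin k → κ, ∑ l : Fin k → ι, ‖(Φ.submatrix s l).det‖ ^ 2

lemma minorSum_zero [Fintype ι] [Fintype κ] (Φ : Matrix κ ι ℂ) : minorSum Φ 0 = 1 := by
  simp [minorSum]

lemma minorSum_nonneg [Fintype ι] [Fintype κ] (Φ : Matrix κ ι ℂ) (k : ℕ) : 0 ≤ minorSum Φ k := by
  unfold minorSum; positivity

/-- If the rows indexed by `s` satisfy a linear relation with small defect `g`, the minors on these
rows are controlled by smaller minors. -/
lemma sum_norm_det_sq_le [Fintype ι] {k : ℕ} (Φ : Matrix κ ι ℂ) (s : Fin (k + 1) → κ)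
    (α : Fin (k + 1) → ℂ)
    (j₀ : Fin (k + 1)) (hα : α j₀ = 1) {x : ℝ} (hx : ∑ l, ‖∑ j, α j * Φ (s j) l‖ ^ 2 ≤ x) :
    ∑ l : Fin (k + 1) → ι, ‖(Φ.submatrix s l).det‖ ^ 2 ≤
      (k + 1) ^ 2 * x * ∑ l : Fin k → ι, ‖(Φ.submatrix (s ∘ j₀.succAbove) l).det‖ ^ 2 := by
  classical
  set g : ι → ℂ := fun l => ∑ j, α j * Φ (s j) l with hg
  have hdet : ∀ l : Fin (k + 1) → ι, (Φ.submatrix s l).det =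
      ∑ i : Fin (k + 1), (-1) ^ ((j₀ : ℕ) + (i : ℕ)) * g (l i) *
        (Φ.submatrix (s ∘ j₀.succAbove) (l ∘ i.succAbove)).det := by
    intro l
    have h1 : (Φ.submatrix s l).det =
        ((Φ.submatrix s l).updateRow j₀ fun i => g (l i)).det := by
      have h2 := Matrix.det_updateRow_sum (Φ.submatrix s l) j₀ α
      rw [hα, one_smul] at h2
      rw [← h2]
      congr 2
      ext i
      simp [hg]
    rw [h1, Matrix.det_succ_row _ j₀]
    refine Finset.sum_congr rfl fun i _ => ?_
    rw [Matrix.updateRow_self]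
    congr 2
    ext a b
    simp
  have hbound : ∀ l : Fin (k + 1) → ι, ‖(Φ.submatrix s l).det‖ ^ 2 ≤
      (k + 1) * ∑ i : Fin (k + 1), ‖g (l i)‖ ^ 2 *
        ‖(Φ.submatrix (s ∘ j₀.succAbove) (l ∘ i.succAbove)).det‖ ^ 2 := by
    intro l
    rw [hdet]
    calc _ ≤ (∑ i : Fin (k + 1), ‖g (l i)‖ *
          ‖(Φ.submatrix (s ∘ j₀.succAbove) (l ∘ i.succAbove)).det‖) ^ 2 := by
          gcongr
          refine (norm_sum_le _ _).trans (le_of_eq (Finset.sum_congr rfl fun i _ => ?_))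
          simp
      _ ≤ _ := by
          have := sq_sum_le_card_mul_sum_sq (s := (Finset.univ : Finset (Fin (k + 1))))
            (f := fun i => ‖g (l i)‖ *
              ‖(Φ.submatrix (s ∘ j₀.succAbove) (l ∘ i.succAbove)).det‖)
          simpa [mul_pow] using this
  have hsplit : ∀ i : Fin (k + 1), ∑ l : Fin (k + 1) → ι, ‖g (l i)‖ ^ 2 *
      ‖(Φ.submatrix (s ∘ j₀.succAbove) (l ∘ i.succAbove)).det‖ ^ 2 =
      (∑ l, ‖g l‖ ^ 2) * ∑ l : Fin k → ι, ‖(Φ.submatrix (s ∘ j₀.succAbove) l).det‖ ^ 2 := by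
    intro i
    rw [← (Fin.insertNthEquiv (fun _ => ι) i).sum_comp, Fintype.sum_prod_type, Finset.sum_mul_sum]
    refine Finset.sum_congr rfl fun a _ => Finset.sum_congr rfl fun l _ => ?_
    have h1 : (Fin.insertNthEquiv (fun _ => ι) i) (a, l) i = a := by simp [Fin.insertNthEquiv]
    have h2 : (Fin.insertNthEquiv (fun _ => ι) i) (a, l) ∘ i.succAbove = l := by
      ext b; simp [Fin.insertNthEquiv]
    rw [h1, h2]
  calc _ ≤ ∑ l : Fin (k + 1) → ι, ((k : ℝ) + 1) * ∑ i : Fin (k + 1), ‖g (l i)‖ ^ 2 *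
        ‖(Φ.submatrix (s ∘ j₀.succAbove) (l ∘ i.succAbove)).det‖ ^ 2 :=
        Finset.sum_le_sum fun l _ => hbound l
    _ = (k + 1) ^ 2 * (∑ l, ‖g l‖ ^ 2) *
        ∑ l : Fin k → ι, ‖(Φ.submatrix (s ∘ j₀.succAbove) l).det‖ ^ 2 := by
        rw [← Finset.mul_sum, Finset.sum_comm]
        simp only [hsplit]
        simp
        ring
    _ ≤ _ := by gcongr

lemma minorSum_succ_le [Fintype ι] [Fintype κ] {k : ℕ} (Φ : Matrix κ ι ℂ) {x : ℝ} (hx0 : 0 ≤ x)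
    (h : ∀ s : Fin (k + 1) → κ, ∃ α : Fin (k + 1) → ℂ, (∃ j, α j = 1) ∧
      ∑ l, ‖∑ j, α j * Φ (s j) l‖ ^ 2 ≤ x) :
    minorSum Φ (k + 1) ≤ (k + 1) ^ 3 * x * Fintype.card κ * minorSum Φ k := by
  classical
  have h1 : ∀ s : Fin (k + 1) → κ, ∑ l : Fin (k + 1) → ι, ‖(Φ.submatrix s l).det‖ ^ 2 ≤
      (k + 1) ^ 2 * x * ∑ j : Fin (k + 1),
        ∑ l : Fin k → ι, ‖(Φ.submatrix (s ∘ j.succAbove) l).det‖ ^ 2 := by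
    intro s
    obtain ⟨α, ⟨j₀, hj₀⟩, hα⟩ := h s
    refine (sum_norm_det_sq_le Φ s α j₀ hj₀ hα).trans ?_
    gcongr
    exact Finset.single_le_sum (f := fun j : Fin (k + 1) =>
      ∑ l : Fin k → ι, ‖(Φ.submatrix (s ∘ j.succAbove) l).det‖ ^ 2)
      (fun j _ => by positivity) (Finset.mem_univ j₀)
  have h2 : ∀ j : Fin (k + 1), ∑ s : Fin (k + 1) → κ,
      ∑ l : Fin k → ι, ‖(Φ.submatrix (s ∘ j.succAbove) l).det‖ ^ 2 =
      Fintype.card κ * minorSum Φ k := by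
    intro j
    rw [← (Fin.insertNthEquiv (fun _ => κ) j).sum_comp, Fintype.sum_prod_type]
    have : ∀ (a : κ) (s : Fin k → κ),
        (Fin.insertNthEquiv (fun _ => κ) j) (a, s) ∘ j.succAbove = s := by
      intro a s; ext b; simp [Fin.insertNthEquiv]
    simp [this, minorSum]
  calc minorSum Φ (k + 1) ≤ ∑ s : Fin (k + 1) → κ, (k + 1) ^ 2 * x * ∑ j : Fin (k + 1),
        ∑ l : Fin k → ι, ‖(Φ.submatrix (s ∘ j.succAbove) l).det‖ ^ 2 :=
        Finset.sum_le_sum fun s _ => h1 s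
    _ = _ := by
        rw [← Finset.mul_sum, Finset.sum_comm]
        simp only [h2]
        simp
        ring

/-- The determinant of a bordered matrix is the pivot minor times the residual of the corner entry
after interpolation. -/
lemma det_submatrix_cons {k : ℕ} (Φ : Matrix κ ι ℂ) (s : Fin k → κ) (l : Fin k → ι)
    (h : (Φ.submatrix s l).det ≠ 0) (a : κ) (b : ι) :
    (Φ.submatrix (Fin.cons a s : Fin (k + 1) → κ) (Fin.cons b l : Fin (k + 1) → ι)).det =
      (Φ.submatrix s l).det *
        (Φ a b - ∑ i, Φ a (l i) * ∑ j, (Φ.submatrix s l)⁻¹ i j * Φ (s j) b) := by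
  set D := Φ.submatrix s l with hD
  let w : Fin k → ℂ := fun i => ∑ j, D⁻¹ i j * Φ (s j) b
  let N : Matrix (Fin (k + 1)) (Fin (k + 1)) ℂ :=
    Φ.submatrix (Fin.cons a s : Fin (k + 1) → κ) (Fin.cons b l : Fin (k + 1) → ι)
  have hDw : D.mulVec w = fun j => Φ (s j) b := by
    have : w = D⁻¹.mulVec fun j => Φ (s j) b := rfl
    rw [this, Matrix.mulVec_mulVec, Matrix.mul_nonsing_inv _ (isUnit_iff_ne_zero.2 h),
      Matrix.one_mulVec]
  -- subtract from the first column the combination of the others that kills all but its top entry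
  have h1 : N.det = (N.updateCol 0 fun r => ∑ i, (Fin.cons 1 (fun i => -w i) : Fin (k + 1) → ℂ) i •
      N r i).det := by
    rw [Matrix.det_updateCol_sum]
    simp
  have hcol : (fun r => ∑ i, (Fin.cons 1 (fun i => -w i) : Fin (k + 1) → ℂ) i • N r i) =
      Fin.cons (Φ a b - ∑ i, Φ a (l i) * w i) 0 := by
    ext r
    rw [Fin.sum_univ_succ]
    refine Fin.cases ?_ (fun r => ?_) r
    · simp [N, Finset.sum_neg_distrib, sub_eq_add_neg, mul_comm]
    · have := congrFun hDw r
      simp only [Matrix.mulVec, dotProduct, hD, Matrix.submatrix_apply] at this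
      simp [N, ← this, mul_comm]
  change N.det = D.det * (Φ a b - ∑ i, Φ a (l i) * w i)
  rw [h1, hcol]
  generalize Φ a b - ∑ i, Φ a (l i) * w i = z
  rw [Matrix.det_succ_column_zero, Fin.sum_univ_succ, Finset.sum_eq_zero]
  · simp only [Matrix.updateCol_self, Fin.cons_zero, Fin.val_zero, pow_zero, one_mul, add_zero]
    rw [mul_comm]
    congr 2
  · intro i _
    simp

/-- If every `m + 1` rows of `Φ` satisfy a normalised linear relation with small defect, then there
are at most `m` columns through which all columns are approximated in mean square. -/
lemma exists_columns [Fintype ι] [Fintype κ] (Φ : Matrix κ ι ℂ) {m : ℕ} {x : ℝ} (hx0 : 0 ≤ x)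
    (h : ∀ s : Fin (m + 1) → κ, ∃ α : Fin (m + 1) → ℂ, (∃ j, α j = 1) ∧
      ∑ l, ‖∑ j, α j * Φ (s j) l‖ ^ 2 ≤ x) :
    ∃ k ≤ m, ∃ (l : Fin k → ι) (c : Fin k → ι → ℂ),
      ∑ a, ∑ b, ‖Φ a b - ∑ i, Φ a (l i) * c i b‖ ^ 2 ≤ (m + 1) ^ 3 * x * Fintype.card κ := by
  classical
  set y : ℝ := (m + 1) ^ 3 * x * Fintype.card κ with hy
  have hy0 : 0 ≤ y := by positivity
  obtain ⟨k, hkm, hk0, hk⟩ : ∃ k ≤ m, minorSum Φ k ≠ 0 ∧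
      minorSum Φ (k + 1) ≤ y * minorSum Φ k := by
    by_cases hm : minorSum Φ m = 0
    · -- the rank is smaller than `m`: stop at the last nonvanishing volume
      have hex : ∃ k, minorSum Φ k = 0 := ⟨m, hm⟩
      have hf := Nat.find_spec hex
      have hpos : Nat.find hex ≠ 0 := by
        intro h0
        rw [h0, minorSum_zero] at hf
        exact one_ne_zero hf
      obtain ⟨k, hk⟩ := Nat.exists_eq_succ_of_ne_zero hpos
      refine ⟨k, ?_, Nat.find_min hex (by omega), ?_⟩
      · have := Nat.find_min' hex hm; omega
      · rw [← Nat.succ_eq_add_one, ← hk, hf]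
        exact mul_nonneg hy0 (minorSum_nonneg _ _)
    · exact ⟨m, le_rfl, hm, minorSum_succ_le Φ hx0 h⟩
  have hexp : minorSum Φ (k + 1) = ∑ s : Fin k → κ, ∑ l : Fin k → ι, ∑ a, ∑ b,
      ‖(Φ.submatrix (Fin.cons a s : Fin (k + 1) → κ)
        (Fin.cons b l : Fin (k + 1) → ι)).det‖ ^ 2 := by
    unfold minorSum
    rw [← (Fin.consEquiv fun _ => κ).sum_comp, Fintype.sum_prod_type_right]
    refine Finset.sum_congr rfl fun s _ => ?_
    refine Eq.trans (Finset.sum_congr rfl fun a _ => ?_) Finset.sum_comm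
    rw [← (Fin.consEquiv fun _ => ι).sum_comp, Fintype.sum_prod_type_right]
    rfl
  have hex : ∃ (s : Fin k → κ) (l : Fin k → ι), (Φ.submatrix s l).det ≠ 0 ∧
      ∑ a, ∑ b, ‖(Φ.submatrix (Fin.cons a s : Fin (k + 1) → κ)
        (Fin.cons b l : Fin (k + 1) → ι)).det‖ ^ 2 ≤ y * ‖(Φ.submatrix s l).det‖ ^ 2 := by
    by_contra hcon
    push Not at hcon
    have hle : ∀ (s : Fin k → κ) (l : Fin k → ι), y * ‖(Φ.submatrix s l).det‖ ^ 2 ≤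
        ∑ a, ∑ b, ‖(Φ.submatrix (Fin.cons a s : Fin (k + 1) → κ)
          (Fin.cons b l : Fin (k + 1) → ι)).det‖ ^ 2 := by
      intro s l
      by_cases h0 : (Φ.submatrix s l).det = 0
      · rw [h0]; simp; positivity
      · exact (hcon s l h0).le
    obtain ⟨s₀, l₀, h0⟩ : ∃ (s : Fin k → κ) (l : Fin k → ι), (Φ.submatrix s l).det ≠ 0 := by
      by_contra hall
      push Not at hall
      exact hk0 (by simp [minorSum, hall])
    have hlt : y * minorSum Φ k < minorSum Φ (k + 1) := by
      rw [hexp, minorSum, Finset.mul_sum]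
      refine Finset.sum_lt_sum (fun s _ => ?_) ⟨s₀, Finset.mem_univ _, ?_⟩
      · rw [Finset.mul_sum]
        exact Finset.sum_le_sum fun l _ => hle s l
      · rw [Finset.mul_sum]
        exact Finset.sum_lt_sum (fun l _ => hle s₀ l) ⟨l₀, Finset.mem_univ _, hcon s₀ l₀ h0⟩
    exact absurd hk hlt.not_ge
  obtain ⟨s, l, hdet, hle⟩ := hex
  refine ⟨k, hkm, l, fun i b => ∑ j, (Φ.submatrix s l)⁻¹ i j * Φ (s j) b, ?_⟩
  simp only [det_submatrix_cons Φ s l hdet, norm_mul, mul_pow, ← Finset.mul_sum] at hle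
  have hpos : 0 < ‖(Φ.submatrix s l).det‖ ^ 2 := by positivity
  rw [mul_comm y] at hle
  exact le_of_mul_le_mul_left hle hpos

end Volume

/-! ### A maximal inequality for measure-preserving flows -/

/-- A measure-preserving action `R` of `ℤ`. -/
structure IsFlow {Q : Type*} [MeasurableSpace Q] (μ : Measure Q) (R : ℤ → Q → Q) : Prop where
  zero : ∀ q, R 0 q = q
  add : ∀ i j q, R (i + j) q = R i (R j q)
  mp : ∀ i, MeasurePreserving (R i) μ μ

section Flow

variable {Q : Type*} {R : ℤ → Q → Q} {E : Set Q} {κ : ℝ}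

/-- The excess of the number of visits of the orbit of `q` to `E` in the times `1, …, s` over
`(1 - κ) * s`. -/
def excess (R : ℤ → Q → Q) (E : Set Q) (κ : ℝ) (s : ℕ) (q : Q) : ℝ :=
  ∑ i ∈ Finset.range s, (E.indicator 1 (R (i + 1) q) - (1 - κ))

/-- The points whose orbit spends, up to some time at most `T`, all but a proportion `κ` of the time
in `E`. -/
def denseAhead (R : ℤ → Q → Q) (E : Set Q) (κ : ℝ) (T : ℕ) : Set Q :=
  {q | ∃ s, 1 ≤ s ∧ s ≤ T ∧ 0 ≤ excess R E κ s q}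

lemma excess_zero (q : Q) : excess R E κ 0 q = 0 := by simp [excess]

lemma excess_one (q : Q) : excess R E κ 1 q = E.indicator 1 (R 1 q) - (1 - κ) := by simp [excess]

lemma excess_succ (s : ℕ) (q : Q) :
    excess R E κ (s + 1) q = excess R E κ s q + (E.indicator 1 (R (s + 1) q) - (1 - κ)) := by
  rw [excess, Finset.sum_range_succ]
  rfl

/-- The largest excess up to time `T`. -/
def maxExcess (R : ℤ → Q → Q) (E : Set Q) (κ : ℝ) (T : ℕ) (q : Q) : ℝ :=
  (Finset.range (T + 1)).sup' Finset.nonempty_range_add_one fun s => excess R E κ s q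

lemma excess_le_maxExcess {s T : ℕ} (h : s ≤ T) (q : Q) :
    excess R E κ s q ≤ maxExcess R E κ T q :=
  Finset.le_sup' (fun s => excess R E κ s q) (Finset.mem_range.2 (by omega))

lemma exists_eq_maxExcess (T : ℕ) (q : Q) :
    ∃ s ≤ T, maxExcess R E κ T q = excess R E κ s q := by
  obtain ⟨s, hs, h⟩ := Finset.exists_mem_eq_sup' (s := Finset.range (T + 1)) ⟨0, by simp⟩
    fun s => excess R E κ s q
  exact ⟨s, by simpa [Nat.lt_succ_iff] using hs, h⟩

variable [MeasurableSpace Q] {μ : Measure Q}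

lemma excess_add_one (hR : IsFlow μ R) (s : ℕ) (q : Q) :
    excess R E κ (s + 1) q = excess R E κ 1 q + excess R E κ s (R 1 q) := by
  simp only [excess, Finset.sum_range_succ']
  rw [add_comm]
  simp only [Finset.range_zero, Finset.sum_empty, zero_add]
  congr 1
  · refine Finset.sum_congr rfl fun i _ => ?_
    rw [← hR.add]
    push_cast
    rfl

lemma measurable_excess (hR : IsFlow μ R) (hE : MeasurableSet E) (s : ℕ) :
    Measurable (excess R E κ s) := by
  unfold excess
  refine Finset.measurable_fun_sum _ fun i _ => Measurable.sub_const ?_ _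
  exact (measurable_one.indicator hE).comp (hR.mp _).measurable

lemma measurable_maxExcess (hR : IsFlow μ R) (hE : MeasurableSet E) (T : ℕ) :
    Measurable (maxExcess R E κ T) := by
  unfold maxExcess
  exact Finset.measurable_range_sup'' fun s _ => measurable_excess hR hE s

lemma measurableSet_denseAhead (hR : IsFlow μ R) (hE : MeasurableSet E) (T : ℕ) :
    MeasurableSet (denseAhead R E κ T) := by
  have : denseAhead R E κ T = ⋃ s ∈ Finset.Icc 1 T, {q | 0 ≤ excess R E κ s q} := by
    ext q
    simp [denseAhead, and_assoc]
  rw [this]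
  exact Finset.measurableSet_biUnion _ fun s _ =>
    measurableSet_le measurable_const (measurable_excess hR hE s)

lemma abs_excess_le {Q : Type*} {R : ℤ → Q → Q} {E : Set Q} {κ : ℝ}
    (hκ : 0 < κ) (hκ1 : κ < 1) (s : ℕ) (q : Q) : |excess R E κ s q| ≤ s := by
  unfold excess
  refine (Finset.abs_sum_le_sum_abs _ _).trans ?_
  calc _ ≤ ∑ i ∈ Finset.range s, (1 : ℝ) := Finset.sum_le_sum fun i _ => ?_
    _ = s := by simp
  by_cases h : R (i + 1) q ∈ E
  · rw [Set.indicator_of_mem h, abs_le]; constructor <;> simp <;> linarith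
  · rw [Set.indicator_of_notMem h, abs_le]; constructor <;> linarith

lemma integral_comp_flow (hR : IsFlow μ R) (i : ℤ) {f : Q → ℝ} (hf : Measurable f) :
    ∫ q, f (R i q) ∂μ = ∫ q, f q ∂μ := by
  rw [← integral_map (hR.mp i).measurable.aemeasurable hf.aestronglyMeasurable, (hR.mp i).map_eq]

/-- A discrete rising sun inequality: the set of points of `E` which leave `E` after time `T` is
controlled by the points outside `E` from which `E` is dense at some scale up to `T`. The average of
the increment of the running maximum is computed exactly, and bounded pointwise. -/
lemma measure_diff_preimage_le [IsProbabilityMeasure μ] (hR : IsFlow μ R) (hE : MeasurableSet E)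
    (hκ : 0 < κ) (hκ1 : κ < 1) {T : ℕ} (hT : 1 ≤ T) :
    μ.real (E \ R T ⁻¹' E) ≤ 2 / κ * μ.real (denseAhead R E κ T \ E) := by
  set U := denseAhead R E κ T with hU
  have hUm : MeasurableSet U := measurableSet_denseAhead hR hE T
  set G : Q → ℝ := fun q => excess R E κ 1 q + maxExcess R E κ T (R 1 q) - maxExcess R E κ T q
    with hG
  have hmm := measurable_maxExcess (κ := κ) hR hE T
  have hm1 := measurable_excess (κ := κ) hR hE 1
  have hR1 := (hR.mp 1).measurable
  have hGm : Measurable G := (hm1.add (hmm.comp hR1)).sub hmm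
  set X : Set Q := {q | 0 < G q} with hX
  have hXm : MeasurableSet X := measurableSet_lt measurable_const hGm
  have hmax : ∀ q, |maxExcess R E κ T q| ≤ T := by
    intro q
    obtain ⟨s, hs, h⟩ := exists_eq_maxExcess (R := R) (E := E) (κ := κ) T q
    rw [h]
    exact (abs_excess_le hκ hκ1 s q).trans (by exact_mod_cast hs)
  have himax : Integrable (maxExcess R E κ T) μ :=
    Integrable.of_bound hmm.aestronglyMeasurable T (Filter.Eventually.of_forall fun q => hmax q)
  have himax1 : Integrable (fun q => maxExcess R E κ T (R 1 q)) μ :=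
    Integrable.of_bound (hmm.comp hR1).aestronglyMeasurable T
      (Filter.Eventually.of_forall fun q => hmax _)
  have hi1 : Integrable (excess R E κ 1) μ :=
    Integrable.of_bound hm1.aestronglyMeasurable 1
      (Filter.Eventually.of_forall fun q => by simpa using abs_excess_le hκ hκ1 1 q)
  have hGint : ∫ q, G q ∂μ = μ.real E - (1 - κ) := by
    have h1 : ∫ q, excess R E κ 1 q ∂μ = μ.real E - (1 - κ) := by
      simp only [excess_one]
      rw [integral_comp_flow hR 1 (f := fun q => E.indicator 1 q - (1 - κ))
        ((measurable_one.indicator hE).sub_const _), integral_sub _ (integrable_const _),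
        integral_indicator_one hE]
      · simp
      · exact (integrable_const (1 : ℝ)).indicator hE
    have hadd : Integrable (fun q => excess R E κ 1 q + maxExcess R E κ T (R 1 q)) μ :=
      hi1.add himax1
    simp only [hG]
    rw [integral_sub hadd himax, integral_add hi1 himax1,
      integral_comp_flow hR 1 hmm, h1]
    ring
  -- the window maximum at the next point
  have hnext : ∀ q, ∃ s ≤ T, excess R E κ 1 q + maxExcess R E κ T (R 1 q) =
      excess R E κ (s + 1) q := by
    intro q
    obtain ⟨s, hs, h⟩ := exists_eq_maxExcess (R := R) (E := E) (κ := κ) T (R 1 q)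
    exact ⟨s, hs, by rw [h, excess_add_one hR s q]⟩
  have hstep : ∀ q s, excess R E κ (s + 1) q ≤ excess R E κ s q + κ := by
    intro q s
    rw [excess_succ]
    have : E.indicator (1 : Q → ℝ) (R (s + 1) q) ≤ 1 :=
      Set.indicator_le_self' (f := (1 : Q → ℝ)) (fun _ _ => zero_le_one) _
    linarith
  have hGκ : ∀ q, G q ≤ κ := by
    intro q
    obtain ⟨s, hs, h⟩ := hnext q
    simp only [hG, h]
    linarith [hstep q s, excess_le_maxExcess (R := R) (E := E) (κ := κ) hs q]
  have hXlast : ∀ q ∈ X, maxExcess R E κ T q < excess R E κ (T + 1) q := by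
    intro q hq
    obtain ⟨s, hs, h⟩ := hnext q
    have hq' : 0 < G q := hq
    simp only [hG, h] at hq'
    rcases hs.lt_or_eq with hlt | rfl
    · linarith [excess_le_maxExcess (R := R) (E := E) (κ := κ) (show s + 1 ≤ T from hlt) q]
    · linarith
  have hXE : ∀ q ∈ X, R (T + 1) q ∈ E := by
    intro q hq
    by_contra hn
    have h1 := hXlast q hq
    rw [excess_succ, Set.indicator_of_notMem hn] at h1
    linarith [excess_le_maxExcess (R := R) (E := E) (κ := κ) (le_refl T) q]
  have hXU : ∀ q ∈ X, R 1 q ∈ U := by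
    intro q hq
    refine ⟨T, hT, le_rfl, ?_⟩
    have h1 := hXlast q hq
    rw [excess_add_one hR] at h1
    linarith [excess_le_maxExcess (R := R) (E := E) (κ := κ) hT q]
  have hmax0 : ∀ q, q ∉ U → maxExcess R E κ T q = 0 := by
    intro q hq
    obtain ⟨s, hs, h⟩ := exists_eq_maxExcess (R := R) (E := E) (κ := κ) T q
    refine le_antisymm ?_ ?_
    · rw [h]
      rcases Nat.eq_zero_or_pos s with rfl | hs0
      · rw [excess_zero]
      · by_contra hc
        exact hq ⟨s, hs0, hs, by linarith⟩
    · rw [← excess_zero (R := R) (E := E) (κ := κ) q]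
      exact excess_le_maxExcess (Nat.zero_le T) q
  have hGle : ∀ q, G q ≤ -(1 - κ) + (1 - κ) * U.indicator 1 q +
      (1 - κ) * (U \ E).indicator 1 (R 1 q) + κ * X.indicator 1 q := by
    intro q
    have hpos : 0 ≤ (U \ E).indicator (1 : Q → ℝ) (R 1 q) :=
      Set.indicator_nonneg (fun _ _ => zero_le_one) _
    have hGX : G q ≤ κ * X.indicator 1 q := by
      by_cases hq : q ∈ X
      · rw [Set.indicator_of_mem hq]; simpa using hGκ q
      · rw [Set.indicator_of_notMem hq, mul_zero]
        exact not_lt.1 hq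
    by_cases hq : q ∈ U
    · rw [Set.indicator_of_mem hq]
      simp only [Pi.one_apply, mul_one]
      nlinarith
    · have hqE : R 1 q ∉ E := by
        intro hc
        refine hq ⟨1, le_rfl, hT, ?_⟩
        rw [excess_one, Set.indicator_of_mem hc]
        simp [hκ.le]
      rw [Set.indicator_of_notMem hq, mul_zero, add_zero]
      by_cases hq1 : R 1 q ∈ U
      · rw [Set.indicator_of_mem (show R 1 q ∈ U \ E from ⟨hq1, hqE⟩)]
        simp only [Pi.one_apply, mul_one]
        linarith
      · have hG1 : G q = -(1 - κ) := by
          simp only [hG, hmax0 q hq, hmax0 _ hq1, excess_one, Set.indicator_of_notMem hqE]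
          ring
        have : 0 ≤ κ * X.indicator (1 : Q → ℝ) q :=
          mul_nonneg hκ.le (Set.indicator_nonneg (fun _ _ => zero_le_one) _)
        rw [hG1]
        nlinarith
  have hind : ∀ A : Set Q, MeasurableSet A → Integrable (A.indicator (1 : Q → ℝ)) μ := fun A hA =>
    (integrable_const (1 : ℝ)).indicator hA
  have hind1 : Integrable (fun q => (U \ E).indicator (1 : Q → ℝ) (R 1 q)) μ :=
    (hR.mp 1).integrable_comp_of_integrable (hind _ (hUm.diff hE))
  have hmain : μ.real E - (1 - κ) ≤ -(1 - κ) + (1 - κ) * μ.real U +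
      (1 - κ) * μ.real (U \ E) + κ * μ.real X := by
    rw [← hGint]
    have ha : Integrable (fun q => -(1 - κ) + (1 - κ) * U.indicator (1 : Q → ℝ) q) μ :=
      (integrable_const _).add ((hind U hUm).const_mul _)
    have hb := hind1.const_mul (1 - κ)
    have hab : Integrable (fun q => -(1 - κ) + (1 - κ) * U.indicator (1 : Q → ℝ) q +
      (1 - κ) * (U \ E).indicator (1 : Q → ℝ) (R 1 q)) μ := ha.add hb
    have hc := (hind X hXm).const_mul κ
    refine (integral_mono ((hi1.add himax1).sub himax) (hab.add hc) hGle).trans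
      (le_of_eq ?_)
    simp only [Pi.add_apply]
    rw [integral_add hab hc, integral_add ha hb, integral_add (integrable_const _)
      ((hind U hUm).const_mul _), integral_const_mul, integral_const_mul, integral_const_mul,
      integral_comp_flow hR 1 (measurable_one.indicator (hUm.diff hE)),
      integral_indicator_one hUm, integral_indicator_one (hUm.diff hE), integral_indicator_one hXm]
    simp
  have hUE : μ.real U ≤ μ.real E + μ.real (U \ E) := by
    refine (measureReal_mono (fun q hq => ?_)).trans (measureReal_union_le _ _)
    by_cases h : q ∈ E
    · exact Or.inl h
    · exact Or.inr ⟨hq, h⟩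
  have hkey : κ * (μ.real E - μ.real X) ≤ 2 * (1 - κ) * μ.real (U \ E) := by nlinarith
  -- shift the set of departures by one step
  have hshift : μ.real (E \ R T ⁻¹' E) ≤ (μ.real E - μ.real X) + μ.real (U \ E) := by
    have h1 : μ.real (E \ R T ⁻¹' E) = μ.real (R T ⁻¹' E \ E) := by
      have h2 := measureReal_sdiff_add_inter (μ := μ) (s := E) (t := R T ⁻¹' E)
        ((hR.mp T).measurable hE)
      have h3 := measureReal_sdiff_add_inter (μ := μ) (s := R T ⁻¹' E) (t := E) hE
      rw [measureReal_def (s := R T ⁻¹' E), (hR.mp T).measure_preimage hE.nullMeasurableSet,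
        ← measureReal_def, Set.inter_comm] at h3
      linarith
    have h2 : μ.real (R T ⁻¹' E \ E) = μ.real (R 1 ⁻¹' (R T ⁻¹' E \ E)) := by
      rw [measureReal_def, measureReal_def, (hR.mp 1).measure_preimage
        (((hR.mp T).measurable hE).diff hE).nullMeasurableSet]
    have h3 : R 1 ⁻¹' (R T ⁻¹' E \ E) ⊆ (R (T + 1) ⁻¹' E \ X) ∪ R 1 ⁻¹' (U \ E) := by
      rintro q ⟨hq1, hq2⟩
      have hq1' : R (T + 1) q ∈ E := by rw [hR.add]; exact hq1
      by_cases hq : q ∈ X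
      · exact Or.inr ⟨hXU q hq, hq2⟩
      · exact Or.inl ⟨hq1', hq⟩
    have h4 : μ.real (R (T + 1) ⁻¹' E \ X) = μ.real E - μ.real X := by
      rw [measureReal_sdiff (show X ⊆ R (T + 1) ⁻¹' E from fun q hq => hXE q hq) hXm,
        measureReal_def,
        (hR.mp _).measure_preimage hE.nullMeasurableSet, ← measureReal_def]
    have h5 : μ.real (R 1 ⁻¹' (U \ E)) = μ.real (U \ E) := by
      rw [measureReal_def, measureReal_def,
        (hR.mp 1).measure_preimage (hUm.diff hE).nullMeasurableSet]
    rw [h1, h2, ← h4, ← h5]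
    exact (measureReal_mono h3).trans (measureReal_union_le _ _)
  rw [div_mul_eq_mul_div, le_div_iff₀ hκ]
  have hnn : 0 ≤ μ.real (U \ E) := measureReal_nonneg
  nlinarith

end Flow

/-! ### Densities and arithmetic progressions in the integers -/

/-- The weak type inequality for the one-sided maximal function of a finite set `B` of integers. -/
lemma mul_card_dense_le (B : Finset ℕ) {κ : ℝ} (hκ : 0 < κ) (b : ℕ) (J : Finset ℕ)
    (hJ : ∀ a ∈ J, ∃ s, κ * s ≤ ((B ∩ Finset.Ioc a (a + s)).card : ℝ) ∧ 1 ≤ s) :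
    ∀ n a₀, n = b - a₀ →
      κ * ((J ∩ Finset.Ico a₀ b).card : ℝ) ≤ ((B.filter (a₀ < ·)).card : ℝ) := by
  intro n
  induction n using Nat.strong_induction_on with
  | _ n ih =>
    intro a₀ hn
    rcases le_or_gt b a₀ with hb | hb
    · rw [Finset.Ico_eq_empty_of_le hb]; simp
    by_cases ha : a₀ ∈ J
    · obtain ⟨s, hs, hs1⟩ := hJ a₀ ha
      have h1 := ih (b - (a₀ + s)) (by omega) (a₀ + s) rfl
      have h2 : (J ∩ Finset.Ico a₀ b).card ≤ s + (J ∩ Finset.Ico (a₀ + s) b).card := by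
        calc _ ≤ (Finset.Ico a₀ (a₀ + s) ∪ (J ∩ Finset.Ico (a₀ + s) b)).card := by
              refine Finset.card_le_card fun x hx => ?_
              simp only [Finset.mem_inter, Finset.mem_Ico, Finset.mem_union] at hx ⊢
              by_cases h : x < a₀ + s
              · exact Or.inl ⟨hx.2.1, h⟩
              · exact Or.inr ⟨hx.1, by omega, hx.2.2⟩
          _ ≤ _ := by
              refine (Finset.card_union_le _ _).trans ?_
              simp
      have h3 : (B ∩ Finset.Ioc a₀ (a₀ + s)).card + (B.filter (a₀ + s < ·)).card ≤
          (B.filter (a₀ < ·)).card := by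
        rw [← Finset.card_union_of_disjoint]
        · refine Finset.card_le_card fun x hx => ?_
          simp only [Finset.mem_inter, Finset.mem_Ioc, Finset.mem_union, Finset.mem_filter] at hx ⊢
          rcases hx with hx | hx
          · exact ⟨hx.1, hx.2.1⟩
          · exact ⟨hx.1, by omega⟩
        · rw [Finset.disjoint_left]
          intro x hx hx'
          simp only [Finset.mem_inter, Finset.mem_Ioc, Finset.mem_filter] at hx hx'
          omega
      have h2' : ((J ∩ Finset.Ico a₀ b).card : ℝ) ≤ s + (J ∩ Finset.Ico (a₀ + s) b).card := by
        exact_mod_cast h2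
      have h3' : ((B ∩ Finset.Ioc a₀ (a₀ + s)).card : ℝ) + (B.filter (a₀ + s < ·)).card ≤
          (B.filter (a₀ < ·)).card := by exact_mod_cast h3
      nlinarith
    · have h1 := ih (b - (a₀ + 1)) (by omega) (a₀ + 1) rfl
      have h2 : J ∩ Finset.Ico a₀ b ⊆ J ∩ Finset.Ico (a₀ + 1) b := by
        intro x hx
        simp only [Finset.mem_inter, Finset.mem_Ico] at hx ⊢
        have : x ≠ a₀ := fun h => ha (h ▸ hx.1)
        exact ⟨hx.1, by omega, hx.2.2⟩
      have h3 : B.filter (a₀ + 1 < ·) ⊆ B.filter (a₀ < ·) := by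
        intro x hx
        simp only [Finset.mem_filter] at hx ⊢
        exact ⟨hx.1, by omega⟩
      calc _ ≤ κ * ((J ∩ Finset.Ico (a₀ + 1) b).card : ℝ) := by
            gcongr
        _ ≤ _ := h1
        _ ≤ _ := by exact_mod_cast Finset.card_le_card h3

/-- A set of density at most `1 / (4 d²)` in an interval misses some arithmetic progression of
length `d`, started at the left end of the interval. -/
lemma exists_progression (Z : Finset ℕ) {a s d : ℕ} (hd : 1 ≤ d) (hs : d ≤ s)
    (hZ : 4 * d * d * (Z ∩ Finset.Ioc a (a + s)).card ≤ s) :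
    ∃ t, 1 ≤ t ∧ d * t ≤ s ∧ ∀ r, 1 ≤ r → r ≤ d → a + r * t ∉ Z := by
  set c := (Z ∩ Finset.Ioc a (a + s)).card with hc
  set p := s / d with hp
  have hp1 : 1 ≤ p := (Nat.one_le_div_iff (by omega)).2 hs
  have hdp : d * p ≤ s := Nat.mul_div_le s d
  have hlt : s < d * (p + 1) := Nat.lt_mul_div_succ s (by omega)
  have hcp : d * c < p := by
    by_contra hcon
    push Not at hcon
    have h1 : 4 * d * p ≤ 4 * d * (d * c) := Nat.mul_le_mul_left _ hcon
    have h2 : d * (p + 1) ≤ d * (2 * p) := Nat.mul_le_mul_left _ (by omega)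
    have h3 : 4 * d * (d * c) = 4 * d * d * c := by ring
    have h4 : 1 ≤ d * p := Nat.mul_pos hd hp1
    nlinarith
  set bad : Finset ℕ := (Finset.Icc 1 d).biUnion fun r =>
    (Finset.Icc 1 p).filter fun t => a + r * t ∈ Z with hbad
  have hcard : bad.card ≤ d * c := by
    refine (Finset.card_biUnion_le).trans ?_
    calc _ ≤ ∑ r ∈ Finset.Icc 1 d, c := Finset.sum_le_sum fun r hr => ?_
      _ = d * c := by simp
    rw [Finset.mem_Icc] at hr
    refine Finset.card_le_card_of_injOn (fun t => a + r * t) (fun t ht => ?_) ?_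
    · simp only [Finset.coe_filter, Finset.mem_Icc] at ht
      obtain ⟨⟨ht1, ht2⟩, htZ⟩ := ht
      have h1 : r * t ≤ d * p := Nat.mul_le_mul hr.2 ht2
      have h2 : 1 ≤ r * t := Nat.mul_pos hr.1 ht1
      simp only [Finset.coe_inter, Finset.coe_Ioc]
      exact ⟨htZ, by simp only [Set.mem_Ioc]; omega⟩
    · intro t _ t' _ h
      have : r * t = r * t' := Nat.add_left_cancel h
      exact Nat.eq_of_mul_eq_mul_left (by omega) this
  obtain ⟨t, ht, htb⟩ : ∃ t ∈ Finset.Icc 1 p, t ∉ bad := by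
    by_contra hall
    push Not at hall
    have := Finset.card_le_card (show Finset.Icc 1 p ⊆ bad from fun t ht => hall t ht)
    rw [Nat.card_Icc] at this
    omega
  rw [Finset.mem_Icc] at ht
  refine ⟨t, ht.1, (Nat.mul_le_mul_left d ht.2).trans hdp, fun r hr1 hr2 hmem => htb ?_⟩
  simp only [hbad, Finset.mem_biUnion, Finset.mem_filter, Finset.mem_Icc]
  exact ⟨r, ⟨hr1, hr2⟩, ⟨ht.1, ht.2⟩, hmem⟩

/-- An exponential sum with `m` unimodular bases is controlled by its values along `m` further terms
of an arithmetic progression, uniformly in the bases and in the step. -/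
lemma norm_expSum_le : ∀ (m : ℕ) (c z : Fin m → ℂ), (∀ i, ‖z i‖ = 1) → ∀ (a t : ℕ) (B : ℝ),
    (∀ r, 1 ≤ r → r ≤ m → ‖∑ i, c i * z i ^ (a + r * t)‖ ≤ B) →
    ‖∑ i, c i * z i ^ a‖ ≤ (2 ^ m - 1) * B := by
  intro m
  induction m with
  | zero => intro c z _ a t B _; simp
  | succ m ih =>
    intro c z hz a t B hB
    -- the sum `n ↦ P (n + t) - z₀ᵗ P n` no longer involves the base `z₀`
    have hdiff : ∀ n, ∑ i : Fin m, (c i.succ * (z i.succ ^ t - z 0 ^ t)) * z i.succ ^ n =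
        ∑ i, c i * z i ^ (n + t) - z 0 ^ t * ∑ i, c i * z i ^ n := by
      intro n
      rw [Finset.mul_sum, ← Finset.sum_sub_distrib, Fin.sum_univ_succ]
      have : c 0 * z 0 ^ (n + t) - z 0 ^ t * (c 0 * z 0 ^ n) = 0 := by ring
      rw [this, zero_add]
      exact Finset.sum_congr rfl fun i _ => by ring
    have hz0 : ‖z 0 ^ t‖ = 1 := by rw [norm_pow, hz, one_pow]
    have h1 := ih (fun i => c i.succ * (z i.succ ^ t - z 0 ^ t)) (fun i => z i.succ)
      (fun i => hz _) a t (2 * B) (fun r hr1 hr2 => by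
        rw [hdiff]
        refine (norm_sub_le _ _).trans ?_
        rw [norm_mul, hz0, one_mul]
        have e1 := hB r hr1 (by omega)
        have e2 := hB (r + 1) (by omega) (by omega)
        rw [show a + (r + 1) * t = a + r * t + t by ring] at e2
        linarith)
    rw [hdiff] at h1
    have e2 := hB 1 le_rfl (by omega)
    rw [one_mul] at e2
    have h2 : ‖∑ i, c i * z i ^ a‖ = ‖z 0 ^ t * ∑ i, c i * z i ^ a‖ := by
      rw [norm_mul, hz0, one_mul]
    rw [h2]
    have h3 : ‖z 0 ^ t * ∑ i, c i * z i ^ a‖ ≤ ‖∑ i, c i * z i ^ (a + t)‖ +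
        ‖∑ i, c i * z i ^ (a + t) - z 0 ^ t * ∑ i, c i * z i ^ a‖ := by
      refine le_trans (le_of_eq ?_) (norm_sub_le _ _)
      congr 1
      ring
    rw [pow_succ]
    linarith

/-! ### Spreading the smallness of `f - b` to a larger set -/

/-- Along the flow `R` the functions `ψ k` are multiplied by powers of the unimodular numbers `z k`,
and `b` does not change. -/
structure IsRotation {Q : Type*} {n : ℕ} (R : ℤ → Q → Q) (ψ : Fin n → Q → ℂ) (z : Fin n → ℂ)
    (b : Q → ℂ) : Prop where
  norm_eq_one : ∀ k, ‖z k‖ = 1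
  smul : ∀ k (i : ℕ) q, ψ k (R i q) = z k ^ i * ψ k q
  inv : ∀ i q, b (R i q) = b q

lemma measureReal_preimage_flow {Q : Type*} [MeasurableSpace Q] {μ : Measure Q} {R : ℤ → Q → Q}
    (hR : IsFlow μ R) (i : ℤ) {E : Set Q} (hE : MeasurableSet E) :
    μ.real (R i ⁻¹' E) = μ.real E := by
  rw [measureReal_def, measureReal_def, (hR.mp i).measure_preimage hE.nullMeasurableSet]

/-- A point of `denseAhead` whose time averages of exceptional times `B` are small starts an
arithmetic progression in `E` without exceptional times, unless the very next point is in `E`. -/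
lemma exists_progression_of_denseAhead {Q : Type*} [MeasurableSpace Q] {μ : Measure Q}
    {R : ℤ → Q → Q} (hR : IsFlow μ R) {E : Set Q} {D T a : ℕ} (hD : 1 ≤ D)
    (B : Finset ℕ) {q : Q} (hq : R a q ∈ denseAhead R E (1 / (8 * D ^ 2)) T)
    (hB : ∀ s : ℕ, 1 ≤ s → s ≤ T →
      ((B ∩ Finset.Ioc a (a + s)).card : ℝ) < 1 / (8 * D ^ 2) * s) :
    R (a + 1 : ℕ) q ∈ E ∨ ∃ t, 1 ≤ t ∧ D * t ≤ T ∧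
      ∀ r, 1 ≤ r → r ≤ D → R (a + r * t : ℕ) q ∈ E ∧ a + r * t ∉ B := by
  classical
  obtain ⟨s, hs1, hsT, hs⟩ := hq
  have hDpos : (0 : ℝ) < D := by exact_mod_cast hD
  set C : Finset ℕ := (Finset.Ioc a (a + s)).filter fun x => R x q ∉ E with hC
  have hCcard : (C.card : ℝ) ≤ 1 / (8 * D ^ 2) * s := by
    have h1 : C = ((Finset.range s).filter fun i : ℕ => R ((i : ℤ) + 1) (R a q) ∉ E).image
        fun i => a + (i + 1) := by
      ext x
      simp only [hC, Finset.mem_filter, Finset.mem_Ioc, Finset.mem_image, Finset.mem_range]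
      constructor
      · rintro ⟨⟨h1, h2⟩, h3⟩
        refine ⟨x - a - 1, ⟨by omega, ?_⟩, by omega⟩
        rwa [← hR.add, show ((x - a - 1 : ℕ) : ℤ) + 1 + a = x by omega]
      · rintro ⟨i, ⟨hi, h⟩, rfl⟩
        refine ⟨⟨by omega, by omega⟩, ?_⟩
        rw [← hR.add] at h
        rwa [show ((a + (i + 1) : ℕ) : ℤ) = (i : ℤ) + 1 + a by push_cast; ring]
    have h2 : C.card ≤ ((Finset.range s).filter fun i : ℕ => R ((i : ℤ) + 1) (R a q) ∉ E).card := by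
      rw [h1]; exact Finset.card_image_le
    have h3 : excess R E (1 / (8 * (D : ℝ) ^ 2)) s (R a q) = 1 / (8 * (D : ℝ) ^ 2) * s -
        ((Finset.range s).filter fun i : ℕ => R ((i : ℤ) + 1) (R a q) ∉ E).card := by
      have e1 : 1 / (8 * (D : ℝ) ^ 2) * s = ∑ i ∈ Finset.range s, 1 / (8 * (D : ℝ) ^ 2) := by
        rw [Finset.sum_const, Finset.card_range, nsmul_eq_mul, mul_comm]
      rw [excess, Finset.card_filter, Nat.cast_sum, e1, ← Finset.sum_sub_distrib]
      refine Finset.sum_congr rfl fun i _ => ?_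
      by_cases h : R ((i : ℤ) + 1) (R a q) ∈ E
      · simp [h]
      · simp [h]
    rw [h3] at hs
    have h2' : (C.card : ℝ) ≤
      ((Finset.range s).filter fun i : ℕ => R ((i : ℤ) + 1) (R a q) ∉ E).card := by
      exact_mod_cast h2
    linarith
  rcases lt_or_ge s D with hsD | hsD
  · -- at such a short scale there is no room for a single point outside `E`
    left
    by_contra hn
    have h1 : 1 ≤ C.card := Finset.card_pos.2 ⟨a + 1, by
      simp only [hC, Finset.mem_filter, Finset.mem_Ioc]
      exact ⟨⟨by omega, by omega⟩, hn⟩⟩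
    have h2 : (1 : ℝ) ≤ C.card := by exact_mod_cast h1
    have h3 : (s : ℝ) ≤ D := by exact_mod_cast hsD.le
    have h4 : (1 : ℝ) ≤ D := by exact_mod_cast hD
    have h5 : 1 / (8 * (D : ℝ) ^ 2) * s < 1 := by
      rw [div_mul_eq_mul_div, div_lt_one (by positivity)]
      nlinarith
    linarith
  · right
    have hZ : 4 * D * D * ((B ∪ C) ∩ Finset.Ioc a (a + s)).card ≤ s := by
      have h1 : ((B ∪ C) ∩ Finset.Ioc a (a + s)).card ≤
          (B ∩ Finset.Ioc a (a + s)).card + C.card := by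
        rw [Finset.union_inter_distrib_right]
        refine (Finset.card_union_le _ _).trans ?_
        gcongr
        exact Finset.inter_subset_left
      have h2 : (((B ∪ C) ∩ Finset.Ioc a (a + s)).card : ℝ) ≤
          (B ∩ Finset.Ioc a (a + s)).card + C.card := by exact_mod_cast h1
      have h3 : (((B ∪ C) ∩ Finset.Ioc a (a + s)).card : ℝ) ≤ 1 / (4 * D ^ 2) * s := by
        have := hB s hs1 hsT
        have e : 1 / (4 * (D : ℝ) ^ 2) * s = 1 / (8 * D ^ 2) * s + 1 / (8 * D ^ 2) * s := by
          field_simp; ring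
        linarith
      rw [div_mul_eq_mul_div, le_div_iff₀ (by positivity)] at h3
      have h4 : ((4 * D * D * ((B ∪ C) ∩ Finset.Ioc a (a + s)).card : ℕ) : ℝ) ≤ (s : ℕ) := by
        push_cast
        linarith
      exact_mod_cast h4
    obtain ⟨t, ht1, htD, ht⟩ := exists_progression (B ∪ C) hD hsD hZ
    refine ⟨t, ht1, htD.trans hsT, fun r hr1 hr2 => ?_⟩
    have h1 := ht r hr1 hr2
    rw [Finset.mem_union, not_or] at h1
    refine ⟨?_, h1.1⟩
    by_contra hn
    refine h1.2 ?_
    simp only [hC, Finset.mem_filter, Finset.mem_Ioc]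
    have h2 : 1 ≤ r * t := Nat.mul_pos hr1 ht1
    have h3 : r * t ≤ D * t := Nat.mul_le_mul_right t hr2
    exact ⟨⟨by omega, by omega⟩, hn⟩

section Spread

variable {Q : Type*} [MeasurableSpace Q] {μ : Measure Q} [IsProbabilityMeasure μ] {n : ℕ}
  {ψ : Fin n → Q → ℂ} {R : ℤ → Q → Q} {z : Fin n → ℂ} {b : Q → ℂ}

/-- Along orbit segments of length `W` the function `f` is an exponential sum with at most `d + 1`
frequencies, the same for all orbits, up to an error that is small in mean square. -/
lemma exists_local_approx (hψ : IsChaosSystem μ ψ) (hrot : IsRotation R ψ z b)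
    (v : EuclideanSpace ℂ (Fin n)) {E : Set Q} (hR : IsFlow μ R) (hE : MeasurableSet E) {A : ℝ}
    (hEA : ∀ q ∈ E, ‖synth ψ v q - b q‖ ≤ A) {d W : ℕ}
    (hW : ∀ s : Fin (d + 2) → Fin W, 0 < μ.real (⋂ j, R (s j : ℕ) ⁻¹' E) ∧
      32 * Real.log (1 / μ.real (⋂ j, R (s j : ℕ) ⁻¹' E)) ≤ d) :
    ∃ k ≤ d + 1, ∃ (w : Fin k → ℂ) (c : Fin k → Q → ℂ) (e : ℕ → EuclideanSpace ℂ (Fin n)),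
      (∀ i, ‖w i‖ = 1) ∧
      (∀ (s : ℕ) q, synth ψ v (R s q) = ∑ i, c i q * w i ^ s + synth ψ (e s) q) ∧
      ∑ s ∈ Finset.range W, ‖e s‖ ^ 2 ≤ 2 * (d + 2) ^ 5 * A ^ 2 * W := by
  set Φ : Matrix (Fin W) (Fin n) ℂ := fun s l => v l * z l ^ (s : ℕ) with hΦ
  have hshift : ∀ (s : ℕ) q, synth ψ (WithLp.toLp 2 fun l => v l * z l ^ s) q =
      synth ψ v (R s q) := by
    intro s q
    simp only [synth, hrot.smul]
    exact Finset.sum_congr rfl fun l _ => by ring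
  obtain ⟨k, hk, l, c, hc⟩ := exists_columns Φ (m := d + 1) (x := 2 * ((d + 2) * A) ^ 2)
    (by positivity) (fun s => by
      set E' := ⋂ j, R (s j : ℕ) ⁻¹' E with hE'
      obtain ⟨hpos, hlog⟩ := hW s
      obtain ⟨α, hα1, hαle, hα0, hg⟩ := exists_relation hψ hpos hlog
        (fun j => WithLp.toLp 2 fun l => v l * z l ^ (s j : ℕ))
      refine ⟨α, hα1, ?_⟩
      set g : EuclideanSpace ℂ (Fin n) :=
        ∑ j, α j • (WithLp.toLp 2 fun l => v l * z l ^ (s j : ℕ) :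
          EuclideanSpace ℂ (Fin n)) with hgd
      have hgn : ∑ l, ‖∑ j, α j * Φ (s j) l‖ ^ 2 = ‖g‖ ^ 2 := by
        rw [EuclideanSpace.norm_sq_eq]
        refine Finset.sum_congr rfl fun l _ => ?_
        simp [hgd, hΦ]
      have hgE : ∀ q ∈ E', ‖synth ψ g q‖ ≤ (d + 2) * A := by
        intro q hq
        have h1 : synth ψ g q = ∑ j, α j * (synth ψ v (R (s j : ℕ) q) - b (R (s j : ℕ) q)) := by
          simp only [hgd, synth_sum, synth_smul, hshift, hrot.inv, mul_sub, Finset.sum_sub_distrib,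
            ← Finset.sum_mul, hα0, zero_mul, sub_zero]
        rw [h1]
        refine (norm_sum_le _ _).trans ?_
        calc _ ≤ ∑ j : Fin (d + 2), A := Finset.sum_le_sum fun j _ => ?_
          _ = _ := by simp
        rw [norm_mul]
        have h2 := hEA _ (Set.mem_iInter.1 hq j)
        calc _ ≤ 1 * A := mul_le_mul (hαle j) h2 (norm_nonneg _) zero_le_one
          _ = A := one_mul A
      have hE'm : MeasurableSet E' := MeasurableSet.iInter fun j => (hR.mp _).measurable hE
      have hint : ∫ q in E', ‖synth ψ g q‖ ^ 2 ∂μ ≤ μ.real E' * ((d + 2) * A) ^ 2 := by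
        calc _ ≤ ∫ _ in E', ((d + 2) * A) ^ 2 ∂μ := by
              refine setIntegral_mono_on
                (integrable_norm_synth_sq hψ.measurable hψ.norm_eq_one g).integrableOn
                (integrable_const _).integrableOn hE'm fun q hq => ?_
              have := hgE q hq
              gcongr
          _ = _ := by rw [setIntegral_const, smul_eq_mul]
      rw [hgn]
      have h3 := hg.trans hint
      have h4 : μ.real E' * (‖g‖ ^ 2 / 2) ≤ μ.real E' * ((d + 2) * A) ^ 2 := by linarith
      have := le_of_mul_le_mul_left h4 hpos
      linarith)
  refine ⟨k, hk, fun i => z (l i), fun i q => v (l i) * ∑ b, c i b * ψ b q,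
    fun s => WithLp.toLp 2 fun b => v b * z b ^ s - ∑ i, v (l i) * z (l i) ^ s * c i b,
    fun i => hrot.norm_eq_one _, fun s q => ?_, ?_⟩
  · rw [← hshift]
    simp only [synth, sub_mul, Finset.sum_sub_distrib, Finset.sum_mul, Finset.mul_sum]
    rw [Finset.sum_comm (s := (Finset.univ : Finset (Fin n)))]
    have : ∀ i x, v (l i) * z (l i) ^ s * c i x * ψ x q = v (l i) * (c i x * ψ x q) * z (l i) ^ s :=
      fun i x => by ring
    simp only [this]
    ring
  · rw [Finset.sum_range]
    simp only [EuclideanSpace.norm_sq_eq]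
    refine hc.trans (le_of_eq ?_)
    rw [Fintype.card_fin]
    push_cast
    ring

end Spread

section Spread

variable {Q : Type*} [MeasurableSpace Q] {μ : Measure Q} [IsProbabilityMeasure μ] {n : ℕ}
  {ψ : Fin n → Q → ℂ} {R : ℤ → Q → Q} {z : Fin n → ℂ} {b : Q → ℂ}

/-- If `‖f - b‖ ≤ A` on `E` and the hypotheses of the local approximation hold on orbit segments of
length `2 * T`, then `f - b` is bounded, with a loss exponential in `d`, on a larger set. The orbit
is cut into segments at a starting point chosen by averaging; points with a large approximation
error are discarded with the help of the weak type inequality. -/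
lemma exists_spread (hψ : IsChaosSystem μ ψ) (hrot : IsRotation R ψ z b)
    (v : EuclideanSpace ℂ (Fin n)) {E : Set Q} (hR : IsFlow μ R) (hE : MeasurableSet E) {A β : ℝ}
    (hA : 0 ≤ A) (hβ : 0 < β) (hEA : ∀ q ∈ E, ‖synth ψ v q - b q‖ ≤ A) {d T : ℕ} (hT : 1 ≤ T)
    (hW : ∀ s : Fin (d + 2) → Fin (2 * T), 0 < μ.real (⋂ j, R (s j : ℕ) ⁻¹' E) ∧
      32 * Real.log (1 / μ.real (⋂ j, R (s j : ℕ) ⁻¹' E)) ≤ d) :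
    ∃ E', E ⊆ E' ∧ MeasurableSet E' ∧
      (∀ q ∈ E', ‖synth ψ v q - b q‖ ≤ 2 ^ (d + 3) * (A + β)) ∧
      μ.real E + μ.real (denseAhead R E (1 / (8 * (d + 2 : ℕ) ^ 2)) T \ E) -
        μ.real (E \ R 1 ⁻¹' E) -
        (1 + 8 * (d + 2) ^ 2) * (4 * (d + 2) ^ 5 * A ^ 2 / β ^ 2) ≤ μ.real E' := by
  classical
  obtain ⟨k, hk, w, c, e, hw, hfe, he⟩ := exists_local_approx hψ hrot v hR hE hEA hW
  set κ : ℝ := 1 / (8 * (d + 2 : ℕ) ^ 2) with hκ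
  have hκ0 : 0 < κ := by positivity
  set U := denseAhead R E κ T with hU
  have hUm : MeasurableSet U := measurableSet_denseAhead hR hE T
  have hRm : ∀ i, Measurable (R i) := fun i => (hR.mp i).measurable
  have hem : ∀ s, Measurable fun q => ‖synth ψ (e s) q‖ := fun s =>
    (measurable_synth hψ.measurable _).norm
  set S : ℕ → Set Q := fun s => {q | β < ‖synth ψ (e s) q‖} with hS
  have hSm : ∀ s, MeasurableSet (S s) := fun s => measurableSet_lt measurable_const (hem s)
  -- the points of the segment at position `a` which are newly controlled
  set Gd : ℕ → Set Q := fun a => {q | q ∉ R a ⁻¹' E ∧ q ∉ S a ∧ ∃ t, 1 ≤ t ∧ (d + 2) * t ≤ T ∧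
    ∀ r, 1 ≤ r → r ≤ d + 2 → q ∈ R (a + r * t : ℕ) ⁻¹' E ∧ q ∉ S (a + r * t)} with hGd
  have hGdm : ∀ a, MeasurableSet (Gd a) := by
    intro a
    have h1 : Gd a = (R a ⁻¹' E)ᶜ ∩ ((S a)ᶜ ∩ ⋃ t : {t : ℕ // 1 ≤ t ∧ (d + 2) * t ≤ T},
        ⋂ r : {r : ℕ // 1 ≤ r ∧ r ≤ d + 2},
          (R (a + r.1 * t.1 : ℕ) ⁻¹' E ∩ (S (a + r.1 * t.1))ᶜ)) := by
      ext q
      simp only [hGd, Set.mem_inter_iff, Set.mem_iUnion, Set.mem_iInter, Set.mem_compl_iff,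
        Subtype.forall, Subtype.exists, Set.mem_ofPred_eq]
      constructor
      · rintro ⟨h1, h2, t, ht1, ht2, h3⟩
        exact ⟨h1, h2, t, ⟨ht1, ht2⟩, fun r hr => h3 r hr.1 hr.2⟩
      · rintro ⟨h1, h2, t, ⟨ht1, ht2⟩, h3⟩
        exact ⟨h1, h2, t, ht1, ht2, fun r hr1 hr2 => h3 r ⟨hr1, hr2⟩⟩
    rw [h1]
    exact ((hRm _ hE).compl).inter ((hSm _).compl.inter (MeasurableSet.iUnion fun t =>
      MeasurableSet.iInter fun r => (hRm _ hE).inter (hSm _).compl))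
  have hpt : ∀ q, ∑ a ∈ Finset.range T, (U \ E).indicator (1 : Q → ℝ) (R a q) ≤
      ∑ a ∈ Finset.range T, (Gd a).indicator (1 : Q → ℝ) q +
      ∑ a ∈ Finset.range T, (R 1 ⁻¹' E \ E).indicator (1 : Q → ℝ) (R a q) +
      (1 + 1 / κ) * ∑ s ∈ Finset.range (2 * T), (S s).indicator (1 : Q → ℝ) q := by
    intro q
    set B : Finset ℕ := (Finset.range (2 * T)).filter fun s => q ∈ S s with hB
    set J : Finset ℕ := (Finset.range T).filter fun a => ∃ s : ℕ,
      κ * s ≤ ((B ∩ Finset.Ioc a (a + s)).card : ℝ) ∧ 1 ≤ s ∧ s ≤ T with hJ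
    have hJB : κ * J.card ≤ B.card := by
      have h1 := mul_card_dense_le B hκ0 T J (fun a ha => by
        obtain ⟨s, h1, h2, _⟩ := (Finset.mem_filter.1 ha).2
        exact ⟨s, h1, h2⟩) _ 0 rfl
      have h2 : J ∩ Finset.Ico 0 T = J := by
        rw [Finset.inter_eq_left]
        intro a ha
        have := Finset.mem_range.1 (Finset.mem_filter.1 ha).1
        simp [this]
      rw [h2] at h1
      refine h1.trans ?_
      exact_mod_cast Finset.card_le_card (Finset.filter_subset _ _)
    have hJ' : (J.card : ℝ) ≤ 1 / κ * B.card := by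
      rw [div_mul_eq_mul_div, one_mul, le_div_iff₀ hκ0]
      linarith
    have hBcard : (B.card : ℝ) = ∑ s ∈ Finset.range (2 * T), (S s).indicator (1 : Q → ℝ) q := by
      rw [hB, Finset.card_filter]
      push_cast
      rfl
    have hterm : ∀ a ∈ Finset.range T, (U \ E).indicator (1 : Q → ℝ) (R a q) ≤
        (Gd a).indicator (1 : Q → ℝ) q + (R 1 ⁻¹' E \ E).indicator (1 : Q → ℝ) (R a q) +
        ((if a ∈ B then 1 else 0) + if a ∈ J then 1 else 0) := by
      intro a ha
      have haT := Finset.mem_range.1 ha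
      have h0 : ∀ (A : Set Q) (x : Q), 0 ≤ A.indicator (1 : Q → ℝ) x := fun A x =>
        Set.indicator_nonneg (fun _ _ => zero_le_one) _
      have hB0 : (0 : ℝ) ≤ if a ∈ B then 1 else 0 := by split_ifs <;> norm_num
      have hJ0 : (0 : ℝ) ≤ if a ∈ J then 1 else 0 := by split_ifs <;> norm_num
      by_cases hq : R a q ∈ U \ E
      swap
      · rw [Set.indicator_of_notMem hq]
        have := h0 (Gd a) q
        have := h0 (R 1 ⁻¹' E \ E) (R a q)
        positivity
      rw [Set.indicator_of_mem hq, Pi.one_apply]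
      by_cases haB : a ∈ B
      · rw [if_pos haB]
        linarith [h0 (Gd a) q, h0 (R 1 ⁻¹' E \ E) (R a q)]
      by_cases haJ : a ∈ J
      · rw [if_pos haJ]
        linarith [h0 (Gd a) q, h0 (R 1 ⁻¹' E \ E) (R a q)]
      have hsm : ∀ s : ℕ, 1 ≤ s → s ≤ T → ((B ∩ Finset.Ioc a (a + s)).card : ℝ) < κ * s := by
        intro s hs1 hsT
        by_contra hcon
        exact haJ (Finset.mem_filter.2 ⟨ha, s, not_lt.1 hcon, hs1, hsT⟩)
      rcases exists_progression_of_denseAhead hR (D := d + 2) (by omega) B hq.1 hsm with h | h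
      · have h1 : R a q ∈ R 1 ⁻¹' E \ E := by
          refine ⟨?_, hq.2⟩
          rw [Set.mem_preimage, ← hR.add]
          rw [show (1 : ℤ) + a = ((a + 1 : ℕ) : ℤ) by push_cast; ring]
          exact h
        rw [Set.indicator_of_mem h1, Pi.one_apply]
        linarith [h0 (Gd a) q]
      · obtain ⟨t, ht1, htT, ht⟩ := h
        have h1 : q ∈ Gd a := by
          refine ⟨hq.2, fun hc => haB (Finset.mem_filter.2 ⟨Finset.mem_range.2 (by omega), hc⟩),
            t, ht1, htT, fun r hr1 hr2 => ⟨(ht r hr1 hr2).1, fun hc => (ht r hr1 hr2).2 ?_⟩⟩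
          have h2 : r * t ≤ (d + 2) * t := Nat.mul_le_mul_right t hr2
          exact Finset.mem_filter.2 ⟨Finset.mem_range.2 (by omega), hc⟩
        rw [Set.indicator_of_mem h1, Pi.one_apply]
        linarith [h0 (R 1 ⁻¹' E \ E) (R a q)]
    refine (Finset.sum_le_sum hterm).trans ?_
    rw [Finset.sum_add_distrib, Finset.sum_add_distrib, Finset.sum_add_distrib, ← hBcard]
    have hsB : ∑ a ∈ Finset.range T, (if a ∈ B then (1 : ℝ) else 0) ≤ B.card := by
      rw [Finset.sum_ite_mem, Finset.sum_const, nsmul_eq_mul, mul_one]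
      exact_mod_cast Finset.card_le_card Finset.inter_subset_right
    have hsJ : ∑ a ∈ Finset.range T, (if a ∈ J then (1 : ℝ) else 0) ≤ J.card := by
      rw [Finset.sum_ite_mem, Finset.sum_const, nsmul_eq_mul, mul_one]
      exact_mod_cast Finset.card_le_card Finset.inter_subset_right
    linarith
  have hind : ∀ A : Set Q, MeasurableSet A → Integrable (A.indicator (1 : Q → ℝ)) μ := fun A hA =>
    (integrable_const (1 : ℝ)).indicator hA
  have hindR : ∀ (A : Set Q) (i : ℤ), MeasurableSet A →
      Integrable (fun q => A.indicator (1 : Q → ℝ) (R i q)) μ := fun A i hA =>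
    (hR.mp i).integrable_comp_of_integrable (hind A hA)
  have hcomm : ∀ A : Set Q, MeasurableSet A →
      ∫ q, ∑ a ∈ Finset.range T, A.indicator (1 : Q → ℝ) (R a q) ∂μ =
        ∑ a ∈ Finset.range T, ∫ q, A.indicator (1 : Q → ℝ) (R a q) ∂μ := fun A hA =>
    integral_finsetSum (Finset.range T) (f := fun (a : ℕ) q => A.indicator (1 : Q → ℝ) (R a q))
      fun a _ => hindR A a hA
  have hUE := hUm.diff hE
  have hEE := (hRm 1 hE).diff hE
  have hint : T * μ.real (U \ E) ≤ ∑ a ∈ Finset.range T, μ.real (Gd a) +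
      T * μ.real (R 1 ⁻¹' E \ E) + (1 + 1 / κ) * ∑ s ∈ Finset.range (2 * T), μ.real (S s) := by
    have i1 := integrable_finsetSum (Finset.range T) fun a _ => hindR (U \ E) a hUE
    have i2 := integrable_finsetSum (Finset.range T) fun a _ => hind (Gd a) (hGdm a)
    have i3 := integrable_finsetSum (Finset.range T) fun a _ => hindR (R 1 ⁻¹' E \ E) a hEE
    have i4 := (integrable_finsetSum (Finset.range (2 * T)) fun s _ =>
      hind (S s) (hSm s)).const_mul (1 + 1 / κ)
    have i23 : Integrable (fun q => ∑ a ∈ Finset.range T, (Gd a).indicator (1 : Q → ℝ) q +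
      ∑ a ∈ Finset.range T, (R 1 ⁻¹' E \ E).indicator (1 : Q → ℝ) (R a q)) μ := i2.add i3
    have := integral_mono i1 (i23.add i4) hpt
    simp only [Pi.add_apply] at this
    rw [integral_add i23 i4, integral_add i2 i3, integral_const_mul,
      hcomm (U \ E) hUE, integral_finsetSum _ fun a _ => hind (Gd a) (hGdm a),
      hcomm (R 1 ⁻¹' E \ E) hEE,
      integral_finsetSum _ fun s _ => hind (S s) (hSm s)] at this
    simp only [integral_comp_flow hR _ (measurable_one.indicator hUE),
      integral_comp_flow hR _ (measurable_one.indicator hEE), integral_indicator_one hUE,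
      integral_indicator_one hEE, integral_indicator_one (hGdm _), integral_indicator_one (hSm _),
      Finset.sum_const, Finset.card_range, nsmul_eq_mul] at this
    exact this
  have hcheb : ∀ s, μ.real (S s) ≤ ‖e s‖ ^ 2 / β ^ 2 := by
    intro s
    rw [le_div_iff₀ (by positivity), mul_comm, ← hψ.integral_sq (e s)]
    have h1 := mul_meas_ge_le_integral_of_nonneg (μ := μ) (f := fun q => ‖synth ψ (e s) q‖ ^ 2)
      (Filter.Eventually.of_forall fun q => by positivity)
      (integrable_norm_synth_sq hψ.measurable hψ.norm_eq_one (e s)) (β ^ 2)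
    refine le_trans ?_ h1
    have hsub : S s ⊆ {q | β ^ 2 ≤ ‖synth ψ (e s) q‖ ^ 2} := by
      intro q hq
      have hq' : β < ‖synth ψ (e s) q‖ := hq
      change β ^ 2 ≤ ‖synth ψ (e s) q‖ ^ 2
      gcongr
    exact mul_le_mul_of_nonneg_left (measureReal_mono hsub) (sq_nonneg β)
  have hSsum : ∑ s ∈ Finset.range (2 * T), μ.real (S s) ≤
      T * (4 * (d + 2) ^ 5 * A ^ 2 / β ^ 2) := by
    refine (Finset.sum_le_sum fun s _ => hcheb s).trans ?_
    rw [← Finset.sum_div, div_le_iff₀ (by positivity)]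
    refine he.trans (le_of_eq ?_)
    push_cast
    field_simp
    ring
  have hback : μ.real (R 1 ⁻¹' E \ E) = μ.real (E \ R 1 ⁻¹' E) := by
    have h2 := measureReal_sdiff_add_inter (μ := μ) (s := E) (t := R 1 ⁻¹' E) (hRm 1 hE)
    have h3 := measureReal_sdiff_add_inter (μ := μ) (s := R 1 ⁻¹' E) (t := E) hE
    rw [measureReal_preimage_flow hR 1 hE, Set.inter_comm] at h3
    linarith
  have hTpos : (0 : ℝ) < T := by exact_mod_cast hT
  obtain ⟨a, haT, ha⟩ : ∃ a ∈ Finset.range T, μ.real (U \ E) - μ.real (E \ R 1 ⁻¹' E) -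
      (1 + 1 / κ) * (4 * (d + 2) ^ 5 * A ^ 2 / β ^ 2) ≤ μ.real (Gd a) := by
    refine Finset.exists_le_of_sum_le ⟨0, Finset.mem_range.2 hT⟩ ?_
    rw [Finset.sum_const, Finset.card_range, nsmul_eq_mul]
    rw [hback] at hint
    have : (1 + 1 / κ) * ∑ s ∈ Finset.range (2 * T), μ.real (S s) ≤
        (1 + 1 / κ) * (T * (4 * (d + 2) ^ 5 * A ^ 2 / β ^ 2)) := by gcongr
    linarith
  have hinvκ : 1 / κ = 8 * ((d : ℝ) + 2) ^ 2 := by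
    rw [hκ, one_div_one_div]; push_cast; ring
  rw [hinvκ] at ha
  refine ⟨E ∪ R (-(a : ℤ)) ⁻¹' Gd a, Set.subset_union_left, hE.union (hRm _ (hGdm a)), ?_, ?_⟩
  · have h2d : (1 : ℝ) ≤ 2 ^ (d + 3) := one_le_pow₀ (by norm_num)
    rintro y (hy | hy)
    · have h1 := hEA y hy
      nlinarith
    · obtain ⟨-, hya, t, -, -, ht⟩ := hy
      set q := R (-(a : ℤ)) y with hq
      have hyq : R a q = y := by rw [hq, ← hR.add, add_neg_cancel, hR.zero]
      have hby : b y = b q := by rw [← hyq, hrot.inv]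
      have hexp : ∀ s : ℕ, ∑ i, (Fin.cons (-b q) (fun i => c i q) : Fin (k + 1) → ℂ) i *
          (Fin.cons 1 w : Fin (k + 1) → ℂ) i ^ s =
          (synth ψ v (R s q) - b (R s q)) - synth ψ (e s) q := by
        intro s
        rw [Fin.sum_univ_succ, hfe, hrot.inv (s : ℤ) q]
        simp only [Fin.cons_zero, Fin.cons_succ, one_pow, mul_one]
        ring
      have hP := norm_expSum_le (k + 1) (Fin.cons (-b q) (fun i => c i q)) (Fin.cons 1 w)
        (fun i => by refine Fin.cases ?_ (fun i => ?_) i <;> simp [hw]) a t (A + β)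
        (fun r hr1 hr2 => by
          obtain ⟨h1, h2⟩ := ht r hr1 (by omega)
          rw [hexp]
          exact (norm_sub_le _ _).trans (add_le_add (hEA _ h1) (not_lt.1 h2)))
      rw [hexp, hyq] at hP
      have h3 : ‖synth ψ v y - b y‖ ≤ ‖synth ψ v y - b y - synth ψ (e a) q‖ +
          ‖synth ψ (e a) q‖ := by
        refine le_trans (le_of_eq ?_) (norm_add_le _ _)
        rw [sub_add_cancel]
      have h4 : ‖synth ψ (e a) q‖ ≤ β := not_lt.1 hya
      have h5 : (2 : ℝ) ^ (k + 1) ≤ 2 ^ (d + 2) := pow_le_pow_right₀ (by norm_num) (by omega)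
      have h6 : (2 : ℝ) ^ (d + 3) = 2 * 2 ^ (d + 2) := by ring
      have h7 : (1 : ℝ) ≤ 2 ^ (d + 2) := one_le_pow₀ (by norm_num)
      calc _ ≤ (2 ^ (k + 1) - 1) * (A + β) + β := by linarith
        _ ≤ 2 ^ (d + 2) * (A + β) + β := by gcongr; linarith
        _ ≤ 2 ^ (d + 3) * (A + β) := by rw [h6]; nlinarith
  · rw [measureReal_union ?_ (hRm _ (hGdm a)), measureReal_preimage_flow hR _ (hGdm a)]
    · linarith
    · rw [Set.disjoint_left]
      rintro y hyE ⟨hy, -⟩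
      refine hy ?_
      rw [Set.mem_preimage, ← hR.add, add_neg_cancel, hR.zero]
      exact hyE

end Spread

/-! ### Almost invariant sets -/

/-- Parseval's identity for the characters of a finite cyclic group. -/
lemma sum_norm_expSum_sq {n M : ℕ} {z : Fin n → ℂ} (hz : Function.Injective z)
    (hzM : ∀ k, z k ^ M = 1) (hz1 : ∀ k, ‖z k‖ = 1) (c : Fin n → ℂ) :
    ∑ j ∈ Finset.range M, ‖∑ k, c k * z k ^ j‖ ^ 2 = M * ∑ k, ‖c k‖ ^ 2 := by
  classical
  have horth : ∀ k l, ∑ j ∈ Finset.range M, (z k * (starRingEnd ℂ) (z l)) ^ j =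
      if k = l then (M : ℂ) else 0 := by
    intro k l
    have hl : z l * (starRingEnd ℂ) (z l) = 1 := by rw [Complex.mul_conj']; simp [hz1]
    split_ifs with h
    · subst h
      simp [hl]
    · have hne : z k * (starRingEnd ℂ) (z l) ≠ 1 := by
        intro hc
        refine h (hz ?_)
        calc z k = z k * (z l * (starRingEnd ℂ) (z l)) := by rw [hl, mul_one]
          _ = z l * (z k * (starRingEnd ℂ) (z l)) := by ring
          _ = z l := by rw [hc, mul_one]
      rw [geom_sum_eq hne, mul_pow, hzM, ← map_pow, hzM]
      simp
  have hC : ((∑ j ∈ Finset.range M, ‖∑ k, c k * z k ^ j‖ ^ 2 : ℝ) : ℂ) =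
      ((M * ∑ k, ‖c k‖ ^ 2 : ℝ) : ℂ) := by
    push_cast
    calc _ = ∑ j ∈ Finset.range M, ∑ k, ∑ l, (c k * (starRingEnd ℂ) (c l)) *
          (z k * (starRingEnd ℂ) (z l)) ^ j := by
          refine Finset.sum_congr rfl fun j _ => ?_
          rw [← Complex.mul_conj', map_sum, Finset.sum_mul_sum]
          refine Finset.sum_congr rfl fun k _ => Finset.sum_congr rfl fun l _ => ?_
          rw [map_mul, map_pow, mul_pow]
          ring
      _ = ∑ k, ∑ l, (c k * (starRingEnd ℂ) (c l)) *
          ∑ j ∈ Finset.range M, (z k * (starRingEnd ℂ) (z l)) ^ j := by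
          rw [Finset.sum_comm]
          refine Finset.sum_congr rfl fun k _ => ?_
          rw [Finset.sum_comm]
          simp only [Finset.mul_sum]
      _ = _ := by
          simp only [horth, mul_ite, mul_zero, Finset.sum_ite_eq, Finset.mem_univ, if_true,
            Complex.mul_conj']
          rw [← Finset.sum_mul, mul_comm]
  exact_mod_cast hC

section AlmostInvariant

variable {Q : Type*} [MeasurableSpace Q] {μ : Measure Q} [IsProbabilityMeasure μ] {n : ℕ}
  {ψ : Fin n → Q → ℂ} {R : ℤ → Q → Q} {z : Fin n → ℂ} {b : Q → ℂ}

/-- On sets which are invariant under the rotation the mean square of `f` is the same as on the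
whole space. -/
lemma setIntegral_synth_sq_of_invariant (hψ : IsChaosSystem μ ψ) (hrot : IsRotation R ψ z b)
    (hR : IsFlow μ R) {M : ℕ} (hM : 1 ≤ M) (hz : Function.Injective z) (hzM : ∀ k, z k ^ M = 1)
    (v : EuclideanSpace ℂ (Fin n)) {I : Set Q} (hI : MeasurableSet I)
    (hinv : ∀ j : ℕ, R j ⁻¹' I = I) :
    ∫ q in I, ‖synth ψ v q‖ ^ 2 ∂μ = ‖v‖ ^ 2 * μ.real I := by
  have hm : Measurable fun q => ‖synth ψ v q‖ ^ 2 :=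
    (measurable_synth hψ.measurable v).norm.pow_const 2
  have hi := integrable_norm_synth_sq (μ := μ) hψ.measurable hψ.norm_eq_one v
  have h1 : ∀ j : ℕ, ∫ q in I, ‖synth ψ v (R j q)‖ ^ 2 ∂μ = ∫ q in I, ‖synth ψ v q‖ ^ 2 ∂μ := by
    intro j
    rw [← integral_indicator hI, ← integral_indicator hI,
      ← integral_comp_flow hR j (hm.indicator hI)]
    congr 1
    ext q
    have : R j q ∈ I ↔ q ∈ I := by
      conv_rhs => rw [← hinv j]
      rfl
    by_cases hq : q ∈ I
    · rw [Set.indicator_of_mem hq, Set.indicator_of_mem (this.2 hq)]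
    · rw [Set.indicator_of_notMem hq, Set.indicator_of_notMem fun h => hq (this.1 h)]
  have hij : ∀ j : ℕ, Integrable (fun q => ‖synth ψ v (R j q)‖ ^ 2) (μ.restrict I) := fun j =>
    ((hR.mp j).integrable_comp_of_integrable hi).restrict
  have h2 : ∀ q, ∑ j ∈ Finset.range M, ‖synth ψ v (R (j : ℕ) q)‖ ^ 2 = M * ‖v‖ ^ 2 := by
    intro q
    have h3 := sum_norm_expSum_sq hz hzM hrot.norm_eq_one fun k => v k * ψ k q
    have h4 : ∑ k, ‖v k * ψ k q‖ ^ 2 = ‖v‖ ^ 2 := by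
      rw [EuclideanSpace.norm_sq_eq]
      exact Finset.sum_congr rfl fun k _ => by rw [norm_mul, hψ.norm_eq_one, mul_one]
    rw [h4] at h3
    rw [← h3]
    refine Finset.sum_congr rfl fun j _ => ?_
    rw [synth]
    congr 3
    ext k
    rw [hrot.smul]
    ring
  have h5 : ∑ j ∈ Finset.range M, ∫ q in I, ‖synth ψ v (R (j : ℕ) q)‖ ^ 2 ∂μ =
      M * (‖v‖ ^ 2 * μ.real I) := by
    rw [← integral_finsetSum (Finset.range M)
      (f := fun (j : ℕ) q => ‖synth ψ v (R j q)‖ ^ 2) fun j _ => hij j]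
    simp only [h2]
    rw [setIntegral_const, smul_eq_mul]
    ring
  simp only [h1, Finset.sum_const, Finset.card_range, nsmul_eq_mul] at h5
  have hM0 : (M : ℝ) ≠ 0 := by exact_mod_cast (by omega : M ≠ 0)
  exact mul_left_cancel₀ hM0 h5

/-- Uniform integrability of `‖f‖²`, from the exponential moment. -/
lemma setIntegral_synth_sq_le (hψ : IsChaosSystem μ ψ) (v : EuclideanSpace ℂ (Fin n)) (D : Set Q)
    (c : ℝ) :
    ∫ q in D, ‖synth ψ v q‖ ^ 2 ∂μ ≤ 4 * ‖v‖ ^ 2 * (2 * Real.exp (-c) + c * μ.real D) := by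
  rcases eq_or_ne v 0 with rfl | hv
  · simp [synth]
  have hv0 : 0 < ‖v‖ := norm_pos_iff.2 hv
  have hi := integrable_norm_synth_sq (μ := μ) hψ.measurable hψ.norm_eq_one v
  set u : Fin 1 → EuclideanSpace ℂ (Fin n) := fun _ => (((‖v‖⁻¹ : ℝ)) : ℂ) • v with hu
  have huo : Orthonormal ℂ u := by
    refine ⟨fun _ => ?_, fun i j hij => absurd (Subsingleton.elim i j) hij⟩
    rw [hu, norm_smul, Complex.norm_real, norm_inv, norm_norm, inv_mul_cancel₀ hv0.ne']
  obtain ⟨hint, hle⟩ := hψ.exp_le 1 u huo (-1 / 2) (by norm_num [abs_of_neg, abs_div])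
  have hsq : ∀ q, ∑ j, ‖synth ψ (u j) q‖ ^ 2 = ‖synth ψ v q‖ ^ 2 / ‖v‖ ^ 2 := by
    intro q
    rw [Fin.sum_univ_one, hu]
    simp only [synth_smul, norm_mul, Complex.norm_real, norm_inv, norm_norm]
    field_simp
  have heq : ∀ q, Real.exp (1 / 2 * (-1 / 2) * ((1 : ℕ) - ∑ j, ‖synth ψ (u j) q‖ ^ 2)) =
      Real.exp (c - 1 / 4) * Real.exp (‖synth ψ v q‖ ^ 2 / (4 * ‖v‖ ^ 2) - c) := by
    intro q
    rw [hsq, ← Real.exp_add]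
    congr 1
    field_simp
    push_cast
    ring
  simp only [heq] at hint hle
  have hint' : Integrable (fun q => Real.exp (‖synth ψ v q‖ ^ 2 / (4 * ‖v‖ ^ 2) - c)) μ := by
    have := hint.const_mul (Real.exp (c - 1 / 4))⁻¹
    refine this.congr (Filter.Eventually.of_forall fun q => ?_)
    simp only
    rw [inv_mul_cancel_left₀ (Real.exp_pos _).ne']
  rw [integral_const_mul] at hle
  have hexp : ∫ q, Real.exp (‖synth ψ v q‖ ^ 2 / (4 * ‖v‖ ^ 2) - c) ∂μ ≤ 2 * Real.exp (-c) := by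
    have h1 : ∫ q, Real.exp (‖synth ψ v q‖ ^ 2 / (4 * ‖v‖ ^ 2) - c) ∂μ ≤
        Real.exp (1 / 8) * Real.exp (-(c - 1 / 4)) := by
      rw [Real.exp_neg, ← div_eq_mul_inv, le_div_iff₀ (Real.exp_pos _), mul_comm]
      refine hle.trans (Real.exp_le_exp.2 (by norm_num))
    refine h1.trans ?_
    rw [← Real.exp_add, show (1 / 8 : ℝ) + -(c - 1 / 4) = 3 / 8 + -c by ring, Real.exp_add]
    gcongr
    have h2 : Real.exp (3 / 8) ^ 2 ≤ 4 := by
      rw [← Real.exp_nat_mul]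
      have h3 := Real.exp_one_lt_d9
      have h4 : Real.exp (((2 : ℕ) : ℝ) * (3 / 8)) ≤ Real.exp 1 :=
        Real.exp_le_exp.2 (by norm_num)
      linarith
    nlinarith [Real.exp_pos (3 / 8 : ℝ)]
  have hpt : ∀ q, ‖synth ψ v q‖ ^ 2 ≤
      4 * ‖v‖ ^ 2 * (Real.exp (‖synth ψ v q‖ ^ 2 / (4 * ‖v‖ ^ 2) - c) + c) := by
    intro q
    have h1 := Real.add_one_le_exp (‖synth ψ v q‖ ^ 2 / (4 * ‖v‖ ^ 2) - c)
    have h2 : ‖synth ψ v q‖ ^ 2 / (4 * ‖v‖ ^ 2) ≤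
        Real.exp (‖synth ψ v q‖ ^ 2 / (4 * ‖v‖ ^ 2) - c) + c := by linarith
    rw [div_le_iff₀ (by positivity)] at h2
    linarith
  calc ∫ q in D, ‖synth ψ v q‖ ^ 2 ∂μ
      ≤ ∫ q in D, 4 * ‖v‖ ^ 2 * (Real.exp (‖synth ψ v q‖ ^ 2 / (4 * ‖v‖ ^ 2) - c) + c) ∂μ :=
        integral_mono hi.restrict ((hint'.restrict.add (integrable_const c)).const_mul _) hpt
    _ = 4 * ‖v‖ ^ 2 * (∫ q in D, Real.exp (‖synth ψ v q‖ ^ 2 / (4 * ‖v‖ ^ 2) - c) ∂μ +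
          c * μ.real D) := by
        rw [integral_const_mul, integral_add hint'.restrict (integrable_const c),
          setIntegral_const, smul_eq_mul]
        ring
    _ ≤ _ := by
        gcongr
        exact (setIntegral_le_integral hint' (Filter.Eventually.of_forall fun q =>
          (Real.exp_pos _).le)).trans hexp

/-- If `E` is almost invariant under the rotation by all `M`-th roots of unity, then `f` is not
small on average on `E`: up to a small error `E` is the invariant set of the points whose orbit
spends more than half of the time in `E`. -/
lemma norm_sq_le_of_almost_invariant (hψ : IsChaosSystem μ ψ) (hrot : IsRotation R ψ z b)
    (hR : IsFlow μ R) {M : ℕ} (hM : 1 ≤ M) (hz : Function.Injective z) (hzM : ∀ k, z k ^ M = 1)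
    (hRM : ∀ q, R M q = q) (v : EuclideanSpace ℂ (Fin n)) (hb : ∀ q, ‖b q‖ ≤ ‖v‖ / 20) {E : Set Q}
    (hE : MeasurableSet E) (hE0 : 0 < μ.real E) {A δ : ℝ}
    (hEA : ∀ q ∈ E, ‖synth ψ v q - b q‖ ≤ A) (hφ : ∀ s : ℕ, μ.real (E \ R s ⁻¹' E) ≤ δ)
    (hδ : 100 * δ ≤ μ.real E) (hδ' : 64 * Real.log (64 / μ.real E) * δ ≤ μ.real E) :
    ‖v‖ ^ 2 ≤ 4 * A ^ 2 := by
  classical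
  have hRm : ∀ i, Measurable (R i) := fun i => (hR.mp i).measurable
  have hM0 : (0 : ℝ) < M := by exact_mod_cast hM
  set N : Q → ℝ := fun q => ∑ j ∈ Finset.range M, E.indicator (1 : Q → ℝ) (R (j : ℕ) q) with hN
  have hNm : Measurable N := Finset.measurable_fun_sum _ fun j _ =>
    (measurable_one.indicator hE).comp (hRm _)
  set I : Set Q := {q | (M : ℝ) / 2 < N q} with hI
  have hIm : MeasurableSet I := measurableSet_lt measurable_const hNm
  have hN1 : ∀ q, N (R 1 q) = N q := by
    intro q
    have h1 : ∀ j : ℕ, R j (R 1 q) = R (j + 1 : ℕ) q := fun j => by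
      rw [← hR.add]; push_cast; rfl
    simp only [hN, h1]
    have h2 := Finset.sum_range_succ (fun j : ℕ => E.indicator (1 : Q → ℝ) (R (j : ℕ) q)) M
    rw [Finset.sum_range_succ', hRM] at h2
    rw [Nat.cast_zero, hR.zero] at h2
    linarith
  have hinv : ∀ j : ℕ, R j ⁻¹' I = I := by
    intro j
    have : ∀ q, N (R j q) = N q := by
      induction j with
      | zero => intro q; rw [Nat.cast_zero, hR.zero]
      | succ j ih =>
        intro q
        rw [show ((j + 1 : ℕ) : ℤ) = 1 + j by push_cast; ring, hR.add, hN1, ih]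
    ext q
    change (M : ℝ) / 2 < N (R j q) ↔ (M : ℝ) / 2 < N q
    rw [this]
  have hind : ∀ S : Set Q, MeasurableSet S → Integrable (S.indicator (1 : Q → ℝ)) μ := fun S hS =>
    (integrable_const (1 : ℝ)).indicator hS
  -- Markov's inequality for the number of visits
  have hmarkov : ∀ (S : Set Q) (F : ℕ → Set Q), MeasurableSet S → (∀ j, MeasurableSet (F j)) →
      (∀ j, μ.real (F j) ≤ δ) →
      (∀ q ∈ S, (M : ℝ) / 2 ≤ ∑ j ∈ Finset.range M, (F j).indicator (1 : Q → ℝ) q) →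
      μ.real S ≤ 2 * δ := by
    intro S F hS hF hFδ hSF
    have h1 : ∫ q, (M : ℝ) / 2 * S.indicator (1 : Q → ℝ) q ∂μ ≤
        ∫ q, ∑ j ∈ Finset.range M, (F j).indicator (1 : Q → ℝ) q ∂μ := by
      refine integral_mono ((hind S hS).const_mul _)
        (integrable_finsetSum _ fun j _ => hind (F j) (hF j)) fun q => ?_
      by_cases hq : q ∈ S
      · simpa [Set.indicator_of_mem hq] using hSF q hq
      · simp only [Set.indicator_of_notMem hq, mul_zero]
        exact Finset.sum_nonneg fun j _ => Set.indicator_nonneg (fun _ _ => zero_le_one) _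
    rw [integral_const_mul, integral_indicator_one hS,
      integral_finsetSum _ fun j _ => hind (F j) (hF j)] at h1
    simp only [integral_indicator_one (hF _)] at h1
    have h2 : ∑ j ∈ Finset.range M, μ.real (F j) ≤ M * δ :=
      (Finset.sum_le_sum fun j _ => hFδ j).trans (by simp)
    have h3 : (M : ℝ) * (μ.real S) ≤ M * (2 * δ) := by linarith
    exact le_of_mul_le_mul_left h3 hM0
  have hEI : μ.real (E \ I) ≤ 2 * δ := by
    refine hmarkov _ (fun j => E \ R j ⁻¹' E) (hE.diff hIm) (fun j => hE.diff (hRm _ hE)) hφ ?_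
    rintro q ⟨hqE, hqI⟩
    have h1 : N q ≤ M / 2 := not_lt.1 hqI
    have h2 : ∑ j ∈ Finset.range M, (E \ R (j : ℕ) ⁻¹' E).indicator (1 : Q → ℝ) q = M - N q := by
      rw [eq_sub_iff_add_eq, hN, ← Finset.sum_add_distrib]
      rw [Finset.sum_congr rfl (g := fun _ => (1 : ℝ)), Finset.sum_const]
      · simp
      intro j _
      by_cases hj : R j q ∈ E
      · rw [Set.indicator_of_mem hj, Set.indicator_of_notMem
          (show q ∉ E \ R j ⁻¹' E from fun h => h.2 hj)]
        simp
      · rw [Set.indicator_of_notMem hj, Set.indicator_of_mem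
          (show q ∈ E \ R j ⁻¹' E from ⟨hqE, hj⟩)]
        simp
    linarith
  have hIE : μ.real (I \ E) ≤ 2 * δ := by
    refine hmarkov _ (fun j => R j ⁻¹' E \ E) (hIm.diff hE) (fun j => (hRm _ hE).diff hE) ?_ ?_
    · intro j
      refine le_trans (le_of_eq ?_) (hφ j)
      have h2 := measureReal_sdiff_add_inter (μ := μ) (s := E) (t := R j ⁻¹' E) (hRm j hE)
      have h3 := measureReal_sdiff_add_inter (μ := μ) (s := R j ⁻¹' E) (t := E) hE
      rw [measureReal_preimage_flow hR j hE, Set.inter_comm] at h3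
      linarith
    · rintro q ⟨hqI, hqE⟩
      have h1 : (M : ℝ) / 2 < N q := hqI
      refine h1.le.trans (le_of_eq (Finset.sum_congr rfl fun j _ => ?_))
      by_cases hj : R j q ∈ E
      · rw [Set.indicator_of_mem hj, Set.indicator_of_mem (show q ∈ R j ⁻¹' E \ E from ⟨hj, hqE⟩)]
        rfl
      · rw [Set.indicator_of_notMem hj, Set.indicator_of_notMem
          (show q ∉ R j ⁻¹' E \ E from fun h => hj h.1)]
  have hi := integrable_norm_synth_sq (μ := μ) hψ.measurable hψ.norm_eq_one v
  have hinter : ∫ q in I ∩ E, ‖synth ψ v q‖ ^ 2 ∂μ ≤ (2 * A ^ 2 + ‖v‖ ^ 2 / 200) * μ.real E := by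
    calc ∫ q in I ∩ E, ‖synth ψ v q‖ ^ 2 ∂μ
        ≤ ∫ q in I ∩ E, (2 * A ^ 2 + ‖v‖ ^ 2 / 200) ∂μ := by
          refine setIntegral_mono_on hi.integrableOn integrableOn_const (hIm.inter hE)
            fun q hq => ?_
          have h1 := hEA q hq.2
          have h2 := hb q
          have h3 : ‖synth ψ v q‖ ≤ A + ‖v‖ / 20 := by
            have := norm_add_le (synth ψ v q - b q) (b q)
            rw [sub_add_cancel] at this
            linarith
          have h4 := norm_nonneg (synth ψ v q)
          nlinarith [sq_nonneg (A - ‖v‖ / 20)]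
      _ = (2 * A ^ 2 + ‖v‖ ^ 2 / 200) * μ.real (I ∩ E) := by
          rw [setIntegral_const, smul_eq_mul, mul_comm]
      _ ≤ _ := by
          exact mul_le_mul_of_nonneg_left (measureReal_mono Set.inter_subset_right) (by positivity)
  have hlog : 2 * Real.exp (-Real.log (64 / μ.real E)) = μ.real E / 32 := by
    rw [Real.exp_neg, Real.exp_log (by positivity), inv_div]
    ring
  have hdiff := setIntegral_synth_sq_le hψ v (I \ E) (Real.log (64 / μ.real E))
  rw [hlog] at hdiff
  have hE1 : μ.real E ≤ 1 := measureReal_le_one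
  have hlog0 : 0 ≤ Real.log (64 / μ.real E) := by
    refine Real.log_nonneg ?_
    rw [le_div_iff₀ hE0]; linarith
  have hsmall : Real.log (64 / μ.real E) * μ.real (I \ E) ≤ μ.real E / 32 := by
    have := mul_le_mul_of_nonneg_left hIE hlog0
    linarith
  have htot := setIntegral_synth_sq_of_invariant hψ hrot hR hM hz hzM v hIm hinv
  rw [← integral_inter_add_sdiff hE hi.integrableOn] at htot
  have hmI : 98 / 100 * μ.real E ≤ μ.real I := by
    have h1 := measureReal_sdiff_add_inter (μ := μ) (s := E) (t := I) hIm
    have h2 : μ.real (E ∩ I) ≤ μ.real I := measureReal_mono Set.inter_subset_right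
    linarith
  have hv2 : 0 ≤ ‖v‖ ^ 2 := sq_nonneg _
  have hfin : ‖v‖ ^ 2 * (98 / 100 * μ.real E) ≤
      (2 * A ^ 2 + ‖v‖ ^ 2 / 200) * μ.real E + 4 * ‖v‖ ^ 2 * (μ.real E / 32 + μ.real E / 32) := by
    have h1 := mul_le_mul_of_nonneg_left hmI hv2
    have h2 : 4 * ‖v‖ ^ 2 * (μ.real E / 32 + Real.log (64 / μ.real E) * μ.real (I \ E)) ≤
        4 * ‖v‖ ^ 2 * (μ.real E / 32 + μ.real E / 32) := by gcongr
    linarith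
  have : ‖v‖ ^ 2 * μ.real E ≤ 4 * A ^ 2 * μ.real E := by nlinarith
  exact le_of_mul_le_mul_right this hE0

end AlmostInvariant

/-! ### Iteration of the spreading step -/

/-- For each measurable set there is a flow of period `M` that multiplies the functions `ψ k` by
distinct `M`-th roots of unity, fixes `b`, and in one step moves the set by as little as desired. -/
def HasSmallRotations {Q : Type*} [MeasurableSpace Q] (μ : Measure Q) {n : ℕ} (ψ : Fin n → Q → ℂ)
    (b : Q → ℂ) : Prop :=
  ∀ E, MeasurableSet E → ∀ η : ℝ, 0 < η → ∃ (M : ℕ) (R : ℤ → Q → Q) (z : Fin n → ℂ), 1 ≤ M ∧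
    IsFlow μ R ∧ IsRotation R ψ z b ∧ Function.Injective z ∧ (∀ k, z k ^ M = 1) ∧
    (∀ q, R M q = q) ∧ μ.real (E \ R 1 ⁻¹' E) ≤ η

section Iteration

variable {Q : Type*} [MeasurableSpace Q] {μ : Measure Q} [IsProbabilityMeasure μ]

lemma measureReal_diff_preimage_add_le {R : ℤ → Q → Q} (hR : IsFlow μ R) {E : Set Q}
    (hE : MeasurableSet E) (s t : ℕ) :
    μ.real (E \ R (s + t : ℕ) ⁻¹' E) ≤ μ.real (E \ R s ⁻¹' E) + μ.real (E \ R t ⁻¹' E) := by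
  have hRm : ∀ i, Measurable (R i) := fun i => (hR.mp i).measurable
  have h1 : E \ R (s + t : ℕ) ⁻¹' E ⊆ E \ R s ⁻¹' E ∪ R s ⁻¹' (E \ R t ⁻¹' E) := by
    rintro q ⟨hq, hq'⟩
    by_cases h : R s q ∈ E
    · refine Or.inr ⟨h, fun hc => hq' ?_⟩
      rw [Set.mem_preimage, ← hR.add] at hc
      rwa [Set.mem_preimage, show ((s + t : ℕ) : ℤ) = t + s by push_cast; ring]
    · exact Or.inl ⟨hq, h⟩
  rw [← measureReal_preimage_flow hR s (hE.diff (hRm t hE))]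
  exact (measureReal_mono h1).trans (measureReal_union_le _ _)

lemma measureReal_sub_le_iInter_preimage {R : ℤ → Q → Q} {E : Set Q} {N : ℕ} (s : Fin N → ℕ) {η : ℝ}
    (hs : ∀ j, μ.real (E \ R (s j) ⁻¹' E) ≤ η) :
    μ.real E - N * η ≤ μ.real (⋂ j, R (s j : ℕ) ⁻¹' E) := by
  have h1 : E ⊆ (⋂ j, R (s j : ℕ) ⁻¹' E) ∪ ⋃ j, (E \ R (s j : ℕ) ⁻¹' E) := by
    intro q hq
    by_cases h : ∀ j, q ∈ R (s j : ℕ) ⁻¹' E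
    · exact Or.inl (Set.mem_iInter.2 h)
    · push Not at h
      obtain ⟨j, hj⟩ := h
      exact Or.inr (Set.mem_iUnion.2 ⟨j, hq, hj⟩)
  have h2 : μ.real (⋃ j, (E \ R (s j : ℕ) ⁻¹' E)) ≤ N * η := by
    refine (measureReal_iUnion_fintype_le _).trans ((Finset.sum_le_sum fun j _ => hs j).trans ?_)
    simp
  have h3 := (measureReal_mono (μ := μ) h1).trans (measureReal_union_le _ _)
  linarith

/-- The growth factor of the bound in one spreading step. -/
def stepFactor (d : ℕ) (m : ℝ) : ℝ := 2 ^ (d + 3) * (1 + 544 * (d + 2) ^ 5 / m)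

lemma one_le_stepFactor (d : ℕ) {m : ℝ} (hm : 0 < m) : 1 ≤ stepFactor d m := by
  unfold stepFactor
  have h1 : (1 : ℝ) ≤ 2 ^ (d + 3) := one_le_pow₀ (by norm_num)
  have h2 : (0 : ℝ) ≤ 544 * (d + 2) ^ 5 / m := by positivity
  nlinarith

variable {n : ℕ} {ψ : Fin n → Q → ℂ} {b : Q → ℂ}

/-- Either `E` is almost invariant at the threshold `μ E / (128 * (d + 2))` and then `f` is
controlled at once, or there is a first time at which the rotated set departs from `E`, and the
bound for `f - b` spreads to a larger set. -/
lemma norm_sq_le_or_exists_larger (hψ : IsChaosSystem μ ψ) (hrot : HasSmallRotations μ ψ b)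
    (v : EuclideanSpace ℂ (Fin n)) (hb : ∀ q, ‖b q‖ ≤ ‖v‖ / 20) {d : ℕ} {m : ℝ} (hm : 0 < m)
    (hd : 32 * Real.log (2 / m) ≤ d) {E : Set Q} (hE : MeasurableSet E) (hmE : m ≤ μ.real E)
    {A : ℝ} (hA : 0 < A) (hEA : ∀ q ∈ E, ‖synth ψ v q - b q‖ ≤ A) :
    ‖v‖ ^ 2 ≤ 4 * A ^ 2 ∨ ∃ E', MeasurableSet E' ∧
      (1 + 1 / (4096 * (d + 2) ^ 3)) * μ.real E ≤ μ.real E' ∧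
      ∀ q ∈ E', ‖synth ψ v q - b q‖ ≤ A * stepFactor d m := by
  have hE0 : 0 < μ.real E := hm.trans_le hmE
  have hm1 : m ≤ 1 := hmE.trans measureReal_le_one
  set D : ℝ := d + 2 with hD
  have hD2 : 2 ≤ D := by rw [hD]; linarith [(Nat.cast_nonneg d : (0 : ℝ) ≤ d)]
  set κ : ℝ := 1 / (8 * D ^ 2) with hκ
  have hκ0 : 0 < κ := by positivity
  have hκ1 : κ ≤ 1 := by
    rw [hκ, div_le_one (by positivity)]; nlinarith
  -- with this `δ` the common part of `D` rotated copies of `E` keeps half of the measure of `E`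
  set δ : ℝ := μ.real E / (128 * D) with hδ
  have hδ0 : 0 < δ := by positivity
  have hδE : 128 * D * δ = μ.real E := by rw [hδ]; field_simp
  obtain ⟨M, R, z, hM, hR, hz, hzi, hzM, hRM, hφ1⟩ := hrot E hE (κ * δ / 8) (by positivity)
  have hRm : ∀ i, Measurable (R i) := fun i => (hR.mp i).measurable
  by_cases hall : ∀ s : ℕ, μ.real (E \ R s ⁻¹' E) ≤ δ
  · left
    refine norm_sq_le_of_almost_invariant hψ hz hR hM hzi hzM hRM v hb hE hE0 hEA hall
      (by nlinarith) ?_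
    have hlog : Real.log (64 / μ.real E) ≤ 4 + d / 32 := by
      have h1 : Real.log (64 / μ.real E) ≤ Real.log (2 ^ 5 * (2 / m)) := by
        refine Real.log_le_log (by positivity) ?_
        rw [show (2 : ℝ) ^ 5 * (2 / m) = 64 / m by ring]
        gcongr
      rw [Real.log_mul (by norm_num) (by positivity), Real.log_pow] at h1
      have h2 := Real.log_two_lt_d9
      push_cast at h1
      linarith
    have h3 : 64 * Real.log (64 / μ.real E) ≤ 128 * D := by rw [hD]; linarith
    calc _ ≤ 128 * D * δ := by gcongr
      _ = _ := hδE
  right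
  push Not at hall
  classical
  -- the first time at which the rotated set departs from `E`
  set T := Nat.find hall with hT
  have hTδ : δ < μ.real (E \ R T ⁻¹' E) := Nat.find_spec hall
  have hlt : ∀ t : ℕ, t < T → μ.real (E \ R t ⁻¹' E) ≤ δ := fun t ht =>
    not_lt.1 (Nat.find_min hall ht)
  have hφ1' : μ.real (E \ R ((1 : ℕ) : ℤ) ⁻¹' E) ≤ δ := by
    rw [Nat.cast_one]
    nlinarith
  have hT2 : 2 ≤ T := by
    by_contra hc
    have : T = 0 ∨ T = 1 := by omega
    rcases this with h | h
    · rw [h, show R ((0 : ℕ) : ℤ) = id from funext fun q => by rw [Nat.cast_zero]; exact hR.zero q]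
        at hTδ
      simp at hTδ
      linarith
    · rw [h] at hTδ
      linarith
  have h3δ : ∀ s : ℕ, s < 2 * T → μ.real (E \ R s ⁻¹' E) ≤ 3 * δ := by
    intro s hs
    obtain ⟨i, j, k, hi, hj, hk, rfl⟩ : ∃ i j k, i < T ∧ j < T ∧ k < T ∧ s = i + j + k := by
      refine ⟨min s (T - 1), min (s - min s (T - 1)) (T - 1), s - min s (T - 1) -
        min (s - min s (T - 1)) (T - 1), ?_, ?_, ?_, ?_⟩ <;> omega
    have h1 := measureReal_diff_preimage_add_le hR hE (i + j) k
    have h2 := measureReal_diff_preimage_add_le hR hE i j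
    linarith [hlt i hi, hlt j hj, hlt k hk]
  have hW : ∀ s : Fin (d + 2) → Fin (2 * T), 0 < μ.real (⋂ j, R (s j : ℕ) ⁻¹' E) ∧
      32 * Real.log (1 / μ.real (⋂ j, R (s j : ℕ) ⁻¹' E)) ≤ d := by
    intro s
    have h1 := measureReal_sub_le_iInter_preimage (μ := μ) (R := R) (E := E) (fun j => (s j : ℕ))
      (fun j => h3δ _ (s j).2)
    push_cast at h1
    rw [← hD] at h1
    have h2 : m / 2 ≤ μ.real (⋂ j, R (s j : ℕ) ⁻¹' E) := by nlinarith
    have h3 : 0 < μ.real (⋂ j, R (s j : ℕ) ⁻¹' E) := by linarith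
    refine ⟨h3, le_trans ?_ hd⟩
    have h4 : Real.log (1 / μ.real (⋂ j, R (s j : ℕ) ⁻¹' E)) ≤ Real.log (2 / m) := by
      refine Real.log_le_log (by positivity) ?_
      rw [div_le_div_iff₀ h3 hm]
      linarith
    linarith
  -- with this `β` the points with a large error cost at most a quarter of the gain `κ * δ / 2`
  set β : ℝ := 544 * D ^ 5 * A / m with hβ
  have hβ0 : 0 < β := by positivity
  obtain ⟨E', -, hE', hE'A, hE'μ⟩ := exists_spread hψ hz v hR hE hA.le hβ0 hEA
    (by omega : 1 ≤ T) hW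
  push_cast at hE'μ
  rw [← hD, ← hκ] at hE'μ
  refine ⟨E', hE', ?_, fun q hq => (hE'A q hq).trans (le_of_eq ?_)⟩
  · have h1 := measure_diff_preimage_le hR hE hκ0 (by
      rw [hκ, div_lt_one (by positivity)]; nlinarith : κ < 1) (by omega : 1 ≤ T)
    rw [div_mul_eq_mul_div, le_div_iff₀ hκ0] at h1
    have h2 : δ * κ ≤ μ.real (E \ R T ⁻¹' E) * κ := by gcongr
    have h3 : (1 + 8 * D ^ 2) * (4 * D ^ 5 * A ^ 2 / β ^ 2) ≤ κ * δ / 8 := by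
      have h4 : 4 * D ^ 5 * A ^ 2 / β ^ 2 = 4 * m ^ 2 / (295936 * D ^ 5) := by
        rw [hβ]; field_simp; norm_num
      have h5 : κ * δ / 8 = μ.real E / (8192 * D ^ 3) := by
        rw [hκ, hδ]; field_simp; norm_num
      rw [h4, h5, mul_div_assoc', div_le_div_iff₀ (by positivity) (by positivity)]
      have h6 : m ^ 2 ≤ μ.real E := by nlinarith
      have h7 : 1 + 8 * D ^ 2 ≤ 9 * D ^ 2 := by nlinarith
      calc (1 + 8 * D ^ 2) * (4 * m ^ 2) * (8192 * D ^ 3)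
          ≤ (9 * D ^ 2) * (4 * μ.real E) * (8192 * D ^ 3) := by gcongr
        _ = 294912 * (μ.real E * D ^ 5) := by ring
        _ ≤ 295936 * (μ.real E * D ^ 5) := by gcongr; norm_num
        _ = _ := by ring
    have h8 : 1 / (4096 * D ^ 3) * μ.real E = κ * δ / 4 := by
      rw [hκ, hδ]; field_simp; norm_num
    rw [add_mul, one_mul, h8]
    linarith
  · rw [hβ, stepFactor, ← hD]
    ring

/-- The spreading step can be repeated only until the measure of the set would exceed one. -/
lemma norm_sq_le_of_forall_le (hψ : IsChaosSystem μ ψ) (hrot : HasSmallRotations μ ψ b)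
    (v : EuclideanSpace ℂ (Fin n)) (hb : ∀ q, ‖b q‖ ≤ ‖v‖ / 20) {d : ℕ} {m : ℝ} (hm : 0 < m)
    (hd : 32 * Real.log (2 / m) ≤ d) (J : ℕ) {E : Set Q} (hE : MeasurableSet E)
    (hmE : m ≤ μ.real E) (hJ : 1 < (1 + 1 / (4096 * ((d : ℝ) + 2) ^ 3)) ^ J * μ.real E)
    {A : ℝ} (hA : 0 < A) (hEA : ∀ q ∈ E, ‖synth ψ v q - b q‖ ≤ A) :
    ‖v‖ ^ 2 ≤ 4 * A ^ 2 * stepFactor d m ^ (2 * J) := by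
  have hK := one_le_stepFactor d hm
  induction J generalizing E A with
  | zero =>
    rw [pow_zero, one_mul] at hJ
    exact absurd measureReal_le_one (not_le.2 hJ)
  | succ J ih =>
    rcases norm_sq_le_or_exists_larger hψ hrot v hb hm hd hE hmE hA hEA with h | ⟨E', h1, h2, h3⟩
    · refine h.trans (le_mul_of_one_le_right (by positivity) (one_le_pow₀ hK))
    · have hγ : (0 : ℝ) ≤ 1 / (4096 * ((d : ℝ) + 2) ^ 3) := by positivity
      have h4 : μ.real E ≤ μ.real E' := by
        have : 0 < μ.real E := hm.trans_le hmE
        nlinarith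
      refine (ih h1 (hmE.trans h4) ?_ (by positivity) h3).trans (le_of_eq (by ring))
      refine hJ.trans_le ?_
      rw [pow_succ, mul_assoc]
      gcongr

end Iteration

/-! ### The inequality for finite sums -/

lemma stepFactor_le_exp {d : ℕ} {m L : ℝ} (hm : m = Real.exp (-L)) (hL : 0 ≤ L) :
    stepFactor d m ≤ Real.exp (10 * (d + 2) + L) := by
  set D : ℝ := d + 2 with hD
  have hD2 : 2 ≤ D := by rw [hD]; linarith [(Nat.cast_nonneg d : (0 : ℝ) ≤ d)]
  have hDe : D ≤ Real.exp D := by linarith [Real.add_one_le_exp D]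
  have he : (2.7 : ℝ) ≤ Real.exp 1 := by linarith [Real.exp_one_gt_d9]
  have h2 : (2 : ℝ) ^ (d + 3) ≤ 2 * Real.exp D := by
    rw [show d + 3 = (d + 2) + 1 by ring, pow_succ, mul_comm]
    gcongr
    rw [hD, show ((d : ℝ) + 2) = ((d + 2 : ℕ) : ℝ) * 1 by push_cast; ring, Real.exp_nat_mul]
    gcongr
    linarith
  have hm0 : 0 < m := hm ▸ Real.exp_pos _
  have hminv : 1 / m = Real.exp L := by rw [hm, Real.exp_neg, one_div, inv_inv]
  have hL1 : 1 ≤ Real.exp L := Real.one_le_exp hL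
  have h3 : 1 + 544 * D ^ 5 / m ≤ 545 * Real.exp D ^ 5 * Real.exp L := by
    have h4 : 544 * D ^ 5 / m = 544 * D ^ 5 * Real.exp L := by rw [← hminv]; ring
    rw [h4]
    have h5 : 544 * D ^ 5 * Real.exp L ≤ 544 * Real.exp D ^ 5 * Real.exp L := by gcongr
    have h6 : (1 : ℝ) ≤ Real.exp D ^ 5 * Real.exp L :=
      one_le_mul_of_one_le_of_one_le (one_le_pow₀ (by linarith)) hL1
    linarith
  have h8 : (1090 : ℝ) ≤ Real.exp D ^ 4 := by
    have h9 : Real.exp 1 ^ 2 ≤ Real.exp D := by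
      rw [← Real.exp_nat_mul]
      exact Real.exp_le_exp.2 (by push_cast; linarith)
    have h10 : (7.29 : ℝ) ≤ Real.exp D := by nlinarith
    calc (1090 : ℝ) ≤ 7.29 ^ 4 := by norm_num
      _ ≤ _ := by gcongr
  calc stepFactor d m ≤ (2 * Real.exp D) * (545 * Real.exp D ^ 5 * Real.exp L) := by
        rw [stepFactor]
        gcongr
    _ = 1090 * (Real.exp D ^ 6 * Real.exp L) := by ring
    _ ≤ Real.exp D ^ 4 * (Real.exp D ^ 6 * Real.exp L) := by gcongr
    _ = Real.exp D ^ 10 * Real.exp L := by ring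
    _ = _ := by rw [← Real.exp_nat_mul, ← Real.exp_add]; norm_num

lemma one_lt_growth_pow {d : ℕ} {m L : ℝ} (hm : m = Real.exp (-L)) (hL : 0 < L)
    (hd : 64 * L ≤ d) :
    1 < (1 + 1 / (4096 * ((d : ℝ) + 2) ^ 3)) ^ (4096 * (d + 2) ^ 4) * m := by
  have h1 : (2 : ℝ) ≤ (1 + 1 / (4096 * ((d : ℝ) + 2) ^ 3)) ^ (4096 * (d + 2) ^ 3) := by
    have h2 := one_add_mul_le_pow (a := 1 / (4096 * ((d : ℝ) + 2) ^ 3))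
      (by have : (0 : ℝ) ≤ 1 / (4096 * ((d : ℝ) + 2) ^ 3) := by positivity
          linarith) (4096 * (d + 2) ^ 3)
    refine le_trans (le_of_eq ?_) h2
    push_cast
    field_simp
    norm_num
  rw [show 4096 * (d + 2) ^ 4 = 4096 * (d + 2) ^ 3 * (d + 2) by ring, pow_mul]
  have h3 : Real.exp L < 2 ^ (d + 2) := by
    have h4 : (2 : ℝ) ^ (d + 2) = Real.exp ((d + 2 : ℕ) * Real.log 2) := by
      rw [Real.exp_nat_mul, Real.exp_log (by norm_num)]
    rw [h4]
    refine Real.exp_lt_exp.2 ?_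
    have := Real.log_two_gt_d9
    push_cast
    nlinarith
  have h5 : (2 : ℝ) ^ (d + 2) ≤
      ((1 + 1 / (4096 * ((d : ℝ) + 2) ^ 3)) ^ (4096 * (d + 2) ^ 3)) ^ (d + 2) := by gcongr
  calc 1 = Real.exp L * m := by rw [hm, ← Real.exp_add, add_neg_cancel, Real.exp_zero]
    _ < _ := by
      have : 0 < m := by rw [hm]; exact Real.exp_pos _
      gcongr
      exact h3.trans_le h5

section Conclusion

variable {Q : Type*} [MeasurableSpace Q] {μ : Measure Q} [IsProbabilityMeasure μ] {n : ℕ}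
  {ψ : Fin n → Q → ℂ} {b : Q → ℂ}

/-- The inequality for finite sums. Chebyshev's inequality provides a set of measure at least
`μ E / 2` on which `f - b` is bounded, and the iteration is started there. -/
theorem norm_sq_le_exp_mul_setIntegral (hψ : IsChaosSystem μ ψ) (hrot : HasSmallRotations μ ψ b)
    (v : EuclideanSpace ℂ (Fin n)) (hb : ∀ q, ‖b q‖ ≤ ‖v‖ / 20) (hbm : Measurable b) {E : Set Q}
    (hE : MeasurableSet E) (hE0 : 0 < μ.real E) :
    ‖v‖ ^ 2 ≤ Real.exp (10 ^ 15 * Real.log (2 / μ.real E) ^ 6) *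
      ∫ q in E, ‖synth ψ v q - b q‖ ^ 2 ∂μ := by
  set L := Real.log (2 / μ.real E) with hLdef
  have hE1 : μ.real E ≤ 1 := measureReal_le_one
  have hlog2 := Real.log_two_gt_d9
  have hL2 : Real.log 2 ≤ L := by
    refine Real.log_le_log (by norm_num) ?_
    rw [le_div_iff₀ hE0]; linarith
  have hL : 1 / 2 ≤ L := by linarith
  have hexpL : Real.exp L = 2 / μ.real E := Real.exp_log (by positivity)
  set m := μ.real E / 2 with hmdef
  have hm0 : 0 < m := by positivity
  have hm : m = Real.exp (-L) := by rw [Real.exp_neg, hexpL, inv_div]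
  set d := ⌈64 * L⌉₊ with hd
  have hdL : 64 * L ≤ d := Nat.le_ceil _
  have hdL' : (d : ℝ) ≤ 64 * L + 1 := (Nat.ceil_lt_add_one (by linarith)).le
  have hlogm : 32 * Real.log (2 / m) ≤ d := by
    have : Real.log (2 / m) = Real.log 2 + L := by
      rw [Real.log_div (by norm_num) hm0.ne', hm, Real.log_exp]
      ring
    rw [this]
    linarith
  -- the measure doubles every `4096 * (d + 2) ^ 3` steps
  set J := 4096 * (d + 2) ^ 4 with hJ
  have hgrow := one_lt_growth_pow hm (by linarith) hdL
  rw [← hJ] at hgrow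
  clear_value J
  set G := stepFactor d m ^ (2 * J) with hG
  have hK1 := one_le_stepFactor d hm0
  have hG1 : 1 ≤ G := one_le_pow₀ hK1
  set S := ∫ q in E, ‖synth ψ v q - b q‖ ^ 2 ∂μ with hS
  have hhm : Measurable fun q => ‖synth ψ v q - b q‖ :=
    ((measurable_synth hψ.measurable v).sub hbm).norm
  have hhi : Integrable (fun q => ‖synth ψ v q - b q‖ ^ 2) μ := by
    refine ((integrable_norm_synth_sq (μ := μ) hψ.measurable hψ.norm_eq_one v).const_mul 2 |>.add
      (integrable_const (2 * (‖v‖ / 20) ^ 2))).mono' (hhm.pow_const 2).aestronglyMeasurable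
      (Filter.Eventually.of_forall fun q => ?_)
    have h1 := norm_sub_le (synth ψ v q) (b q)
    have h2 := hb q
    have h3 := norm_nonneg (b q)
    have h4 := norm_nonneg (synth ψ v q)
    have h5 := norm_nonneg (synth ψ v q - b q)
    rw [Real.norm_of_nonneg (sq_nonneg _)]
    simp only [Pi.add_apply]
    nlinarith [sq_nonneg (‖synth ψ v q‖ - ‖b q‖)]
  have hS0 : 0 ≤ S := integral_nonneg fun q => sq_nonneg _
  have hmain : ∀ A : ℝ, 0 < A → 2 * S < A ^ 2 * μ.real E → ‖v‖ ^ 2 ≤ 4 * A ^ 2 * G := by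
    intro A hA hSA
    set F := E ∩ {q | ‖synth ψ v q - b q‖ ≤ A} with hF
    have hFm : MeasurableSet F := hE.inter (measurableSet_le hhm measurable_const)
    have hEF : A ^ 2 * μ.real (E \ F) ≤ S := by
      calc A ^ 2 * μ.real (E \ F) = ∫ q in E \ F, A ^ 2 ∂μ := by
            rw [setIntegral_const, smul_eq_mul, mul_comm]
        _ ≤ ∫ q in E \ F, ‖synth ψ v q - b q‖ ^ 2 ∂μ := by
            refine setIntegral_mono_on integrableOn_const hhi.integrableOn (hE.diff hFm)
              fun q hq => ?_
            have : A < ‖synth ψ v q - b q‖ := not_le.1 fun h => hq.2 ⟨hq.1, h⟩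
            gcongr
        _ ≤ S := setIntegral_mono_set hhi.integrableOn
            (Filter.Eventually.of_forall fun q => sq_nonneg _) Set.sdiff_subset.eventuallyLE
    have hmF : m ≤ μ.real F := by
      have h1 := measureReal_sdiff_add_inter (μ := μ) (s := E) (t := F) hFm
      rw [Set.inter_eq_right.2 (Set.inter_subset_left : F ⊆ E)] at h1
      have h2 : A ^ 2 * μ.real (E \ F) < A ^ 2 * m := by rw [hmdef]; linarith
      have h3 := lt_of_mul_lt_mul_left h2 (by positivity)
      linarith
    refine norm_sq_le_of_forall_le hψ hrot v hb hm0 hlogm J hFm hmF (hgrow.trans_le ?_) hA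
      fun q hq => hq.2
    gcongr
  have hfin : ‖v‖ ^ 2 ≤ 8 * G * S / μ.real E := by
    by_contra hcon
    push Not at hcon
    set x := 2 * S / μ.real E with hx
    set y := ‖v‖ ^ 2 / (4 * G) with hy
    -- any bound `A` with `x < A ^ 2 < y` is contradictory
    have hxy : x < y := by
      rw [hx, hy, lt_div_iff₀ (by positivity)]
      refine lt_of_eq_of_lt ?_ hcon
      ring
    have hx0 : 0 ≤ x := by positivity
    have hA2 : Real.sqrt ((x + y) / 2) ^ 2 = (x + y) / 2 := Real.sq_sqrt (by linarith)
    have h1 := hmain (Real.sqrt ((x + y) / 2)) (Real.sqrt_pos.2 (by linarith)) (by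
      rw [hA2, ← div_lt_iff₀ hE0]
      linarith)
    rw [hA2] at h1
    have h2 : ‖v‖ ^ 2 = 4 * y * G := by rw [hy]; field_simp
    have h3 : 4 * ((x + y) / 2) * G < 4 * y * G := by
      gcongr
      linarith
    linarith
  refine hfin.trans ?_
  have hD : (d : ℝ) + 2 ≤ 70 * L := by linarith
  have hGle : G ≤ Real.exp ((701 * L) * (2 * (4096 * (70 * L) ^ 4))) := by
    have h1 : stepFactor d m ≤ Real.exp (701 * L) :=
      (stepFactor_le_exp hm (by linarith)).trans (Real.exp_le_exp.2 (by linarith))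
    calc G ≤ Real.exp (701 * L) ^ (2 * J) := by rw [hG]; gcongr
      _ = Real.exp (((2 * J : ℕ) : ℝ) * (701 * L)) := (Real.exp_nat_mul _ _).symm
      _ ≤ _ := by
        refine Real.exp_le_exp.2 ?_
        rw [mul_comm]
        rw [hJ]
        push_cast
        gcongr
  have h8 : 8 / μ.real E ≤ Real.exp (3 * L) := by
    have h1 : Real.exp (3 * L) = Real.exp L ^ 3 := by rw [← Real.exp_nat_mul]; norm_num
    have h2 : 2 ≤ Real.exp L := by
      rw [hexpL, le_div_iff₀ hE0]; linarith
    have h3 : 8 / μ.real E = 4 * Real.exp L := by rw [hexpL]; ring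
    rw [h1, h3]
    nlinarith [mul_self_nonneg (Real.exp L - 2)]
  have hpow : 3 * L + (701 * L) * (2 * (4096 * (70 * L) ^ 4)) ≤ 10 ^ 15 * L ^ 6 := by
    have h1 : 1 ≤ 2 * L := by linarith
    have h5 : L ≤ 32 * L ^ 6 := by
      calc L = L * 1 ^ 5 := by ring
        _ ≤ L * (2 * L) ^ 5 := by gcongr
        _ = _ := by ring
    have h6 : L ^ 5 ≤ 2 * L ^ 6 := by
      calc L ^ 5 = L ^ 5 * 1 := by ring
        _ ≤ L ^ 5 * (2 * L) := by gcongr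
        _ = _ := by ring
    have h7 : 0 ≤ L ^ 6 := by positivity
    calc 3 * L + (701 * L) * (2 * (4096 * (70 * L) ^ 4))
        = 3 * L + 701 * 8192 * 70 ^ 4 * L ^ 5 := by ring
      _ ≤ 3 * (32 * L ^ 6) + 701 * 8192 * 70 ^ 4 * (2 * L ^ 6) := by gcongr
      _ ≤ _ := by linarith
  calc 8 * G * S / μ.real E = 8 / μ.real E * G * S := by ring
    _ ≤ Real.exp (3 * L) * Real.exp ((701 * L) * (2 * (4096 * (70 * L) ^ 4))) * S := by gcongr
    _ ≤ _ := by
      rw [← Real.exp_add]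
      gcongr

end Conclusion

/-! ### Rotations of the circle -/

/-- The rotation of the second coordinate of `Ω × 𝕋` by `x`. -/
def rotate {Ω : Type*} (x : AddCircle (1 : ℝ)) (q : Ω × AddCircle (1 : ℝ)) :
    Ω × AddCircle (1 : ℝ) :=
  (q.1, q.2 + x)

section Rotate

variable {Ω : Type*} [MeasurableSpace Ω] {P : Measure Ω} [IsProbabilityMeasure P]

lemma measurePreserving_rotate (x : AddCircle (1 : ℝ)) :
    MeasurePreserving (rotate x : Ω × AddCircle (1 : ℝ) → _) (prodCircle P) (prodCircle P) :=
  (MeasurePreserving.id P).prod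
    (measurePreserving_add_right (AddCircle.haarAddCircle (T := (1 : ℝ))) x)

lemma isFlow_rotate (x : AddCircle (1 : ℝ)) :
    IsFlow (prodCircle P) fun i : ℤ => rotate (Ω := Ω) (i • x) where
  zero q := by simp [rotate]
  add i j q := by
    simp only [rotate, add_smul]
    rw [add_comm (i • x), add_assoc]
  mp i := measurePreserving_rotate _

lemma fourier_add_nsmul (k : ℤ) (x θ : AddCircle (1 : ℝ)) (i : ℕ) :
    fourier k (θ + i • x) = fourier k x ^ i * fourier k θ := by
  simp only [fourier_apply]
  rw [smul_add, AddCircle.toCircle_add, smul_comm, AddCircle.toCircle_nsmul, mul_comm]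
  push_cast
  rfl

/-- Small translations move a measurable set of `𝕋` by little. -/
lemma tendsto_haar_diff_preimage_add {S : Set (AddCircle (1 : ℝ))} (hS : MeasurableSet S) :
    Filter.Tendsto (fun x : AddCircle (1 : ℝ) =>
      AddCircle.haarAddCircle (T := (1 : ℝ)) (S \ (fun θ => θ + x) ⁻¹' S)) (nhds 0) (nhds 0) := by
  let f : AddCircle (1 : ℝ) → C(AddCircle (1 : ℝ), AddCircle (1 : ℝ)) := fun x =>
    ⟨fun θ => θ + x, by fun_prop⟩
  have hf : Continuous f := ContinuousMap.continuous_of_continuous_uncurry _ (by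
    change Continuous fun p : AddCircle (1 : ℝ) × AddCircle (1 : ℝ) => p.2 + p.1
    fun_prop)
  have hmp : ∀ x, MeasurePreserving (f x) (AddCircle.haarAddCircle (T := (1 : ℝ)))
    (AddCircle.haarAddCircle (T := (1 : ℝ))) := fun x => measurePreserving_add_right _ x
  have h := tendsto_measure_symmDiff_preimage_nhds_zero (hf.tendsto 0)
    (Filter.Eventually.of_forall hmp) (hmp 0) hS.nullMeasurableSet (measure_ne_top _ _)
  refine tendsto_of_tendsto_of_tendsto_of_le_of_le tendsto_const_nhds h (fun x => zero_le)
    fun x => measure_mono ?_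
  rintro θ ⟨h1, h2⟩
  refine Or.inr ⟨?_, h2⟩
  change θ + 0 ∈ S
  rwa [add_zero]

lemma tendsto_prodCircle_diff_preimage_rotate {E : Set (Ω × AddCircle (1 : ℝ))}
    (hE : MeasurableSet E) {x : ℕ → AddCircle (1 : ℝ)}
    (hx : Filter.Tendsto x Filter.atTop (nhds 0)) :
    Filter.Tendsto (fun M => (prodCircle P).real (E \ rotate (x M) ⁻¹' E)) Filter.atTop
      (nhds 0) := by
  have hm : ∀ M, MeasurableSet (E \ rotate (x M) ⁻¹' E) := fun M =>
    hE.diff ((measurePreserving_rotate (P := P) (x M)).measurable hE)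
  have h1 : Filter.Tendsto (fun M => prodCircle P (E \ rotate (x M) ⁻¹' E)) Filter.atTop
      (nhds 0) := by
    simp only [prodCircle, Measure.prod_apply (hm _)]
    have h2 := tendsto_lintegral_of_dominated_convergence (μ := P)
      (F := fun M ω => AddCircle.haarAddCircle (T := (1 : ℝ))
        (Prod.mk ω ⁻¹' (E \ rotate (x M) ⁻¹' E))) (f := fun _ => 0) (fun _ => 1)
      (fun M => measurable_measure_prodMk_left (hm M))
      (fun M => Filter.Eventually.of_forall fun ω => prob_le_one) (by simp)
      (Filter.Eventually.of_forall fun ω =>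
        (tendsto_haar_diff_preimage_add (measurable_prodMk_left hE)).comp hx)
    simpa using h2
  exact (ENNReal.tendsto_toReal ENNReal.zero_ne_top).comp h1

lemma hasSmallRotations_phi (ξ : ℤ → Ω → ℝ) {n : ℕ} {e : Fin n → ℤ} (he : Function.Injective e)
    (b : Ω → ℂ) :
    HasSmallRotations (prodCircle P) (fun k => phi ξ (e k)) fun q => b q.1 := by
  intro E hE η hη
  set x : ℕ → AddCircle (1 : ℝ) := fun M => ((1 / (M : ℝ) : ℝ) : AddCircle (1 : ℝ)) with hx
  have hxt : Filter.Tendsto x Filter.atTop (nhds 0) := by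
    have h1 := ((AddCircle.continuous_mk' (1 : ℝ)).tendsto 0).comp
      (tendsto_one_div_atTop_nhds_zero_nat (𝕜 := ℝ))
    exact h1
  have hsmall := (tendsto_prodCircle_diff_preimage_rotate (P := P) hE hxt).eventually_le_const hη
  obtain ⟨B, hB⟩ : ∃ B : ℤ, ∀ k l, |e k - e l| ≤ B :=
    ⟨∑ p : Fin n × Fin n, |e p.1 - e p.2|, fun k l =>
      Finset.single_le_sum (f := fun p : Fin n × Fin n => |e p.1 - e p.2|)
        (fun p _ => abs_nonneg _) (Finset.mem_univ (k, l))⟩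
  obtain ⟨M, hMη, hM1, hMB⟩ := (hsmall.and ((Filter.eventually_ge_atTop 1).and
    (Filter.eventually_ge_atTop (B.toNat + 1)))).exists
  have hM0 : (M : ℝ) ≠ 0 := by exact_mod_cast (by omega : M ≠ 0)
  have hMx : M • x M = 0 := by
    rw [hx]
    simp only
    rw [← AddCircle.coe_nsmul, nsmul_eq_mul, mul_one_div_cancel hM0]
    exact AddCircle.coe_period 1
  refine ⟨M, fun i => rotate (i • x M), fun k => fourier (e k) (x M), hM1, isFlow_rotate (x M),
    ⟨fun k => norm_fourier_apply _ _, fun k i q => ?_, fun i q => rfl⟩, fun k l hkl => ?_,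
    fun k => ?_, fun q => ?_, ?_⟩
  · simp only [phi, rotate, natCast_zsmul, fourier_add_nsmul]
    ring
  · simp only [fourier_apply] at hkl
    have h1 := AddCircle.injective_toCircle (one_ne_zero) (Subtype.ext hkl)
    have h2 : (e k - e l) • x M = 0 := by rw [sub_smul, h1, sub_self]
    rw [hx] at h2
    simp only at h2
    rw [← AddCircle.coe_zsmul, AddCircle.coe_eq_zero_iff] at h2
    obtain ⟨t, ht⟩ := h2
    have h3 : e k - e l = t * M := by
      have : ((e k - e l : ℤ) : ℝ) = t * M := by
        simp only [zsmul_eq_mul, mul_one] at ht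
        rw [ht]
        field_simp
      exact_mod_cast this
    have h4 : e k - e l = 0 := by
      refine Int.eq_zero_of_abs_lt_dvd (m := M) ⟨t, by rw [h3]; ring⟩ ?_
      have := hB k l
      omega
    exact he (by omega)
  · have h1 := fourier_add_nsmul (e k) (x M) 0 M
    rw [zero_add, hMx] at h1
    simpa using h1.symm
  · simp [rotate, hMx]
  · simpa using hMη

end Rotate

/-! ### Reduction to finite sums -/

lemma norm_sq_eq_integral {Q : Type*} [MeasurableSpace Q] {μ : Measure Q} (f : Lp ℂ 2 μ) :
    ‖f‖ ^ 2 = ∫ q, ‖f q‖ ^ 2 ∂μ := by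
  have h := inner_self_eq_norm_sq_to_K (𝕜 := ℂ) f
  rw [L2.inner_def] at h
  have h1 : ∀ q, inner ℂ (f q) (f q) = ((‖f q‖ ^ 2 : ℝ) : ℂ) := fun q => by
    rw [inner_self_eq_norm_sq_to_K]; norm_cast
  simp only [h1] at h
  rw [integral_complex_ofReal] at h
  exact Complex.ofReal_injective ((Complex.ofReal_pow _ _).trans h.symm)

lemma exists_synth_of_mem_span {Ω : Type*} [MeasurableSpace Ω] {P : Measure Ω} {ξ : ℤ → Ω → ℝ}
    {g : Lp ℂ 2 (prodCircle P)}
    (hg : g ∈ Submodule.span ℂ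
      {g : Lp ℂ 2 (prodCircle P) | ∃ k : ℤ, g =ᵐ[prodCircle P] phi ξ k}) :
    ∃ (n : ℕ) (e : Fin n → ℤ) (v : EuclideanSpace ℂ (Fin n)), Function.Injective e ∧
      g =ᵐ[prodCircle P] synth (fun k => phi ξ (e k)) v := by
  classical
  obtain ⟨c, hc⟩ : ∃ c : ℤ →₀ ℂ, g =ᵐ[prodCircle P] fun q => c.sum fun k a => a * phi ξ k q := by
    induction hg using Submodule.span_induction with
    | mem g hg =>
      obtain ⟨k, hk⟩ := hg
      refine ⟨Finsupp.single k 1, hk.trans (Filter.Eventually.of_forall fun q => ?_)⟩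
      simp
    | zero =>
      refine ⟨0, (Lp.coeFn_zero ℂ 2 (prodCircle P)).trans (Filter.Eventually.of_forall fun q => ?_)⟩
      simp
    | add g h _ _ hg hh =>
      obtain ⟨c, hc⟩ := hg
      obtain ⟨d, hd⟩ := hh
      refine ⟨c + d, ?_⟩
      filter_upwards [Lp.coeFn_add g h, hc, hd] with q h1 h2 h3
      rw [h1, Pi.add_apply, h2, h3, Finsupp.sum_add_index' (by simp) (by intros; ring)]
    | smul a g _ hg =>
      obtain ⟨c, hc⟩ := hg
      refine ⟨a • c, ?_⟩
      filter_upwards [Lp.coeFn_smul a g, hc] with q h1 h2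
      rw [h1, Pi.smul_apply, h2, Finsupp.sum_smul_index (by simp), smul_eq_mul, Finsupp.mul_sum]
      simp only [mul_assoc]
  set E := c.support.equivFin with hE
  refine ⟨c.support.card, fun i => (E.symm i : ℤ),
    WithLp.toLp 2 fun i => c (E.symm i : ℤ), fun i j h => E.symm.injective (Subtype.ext h), ?_⟩
  filter_upwards [hc] with q hq
  rw [hq, synth, Finsupp.sum, ← Finset.sum_coe_sort, ← E.symm.sum_comp]

section Reduction

variable {Ω : Type*} [MeasurableSpace Ω] {P : Measure Ω} [IsProbabilityMeasure P]
  {ξ : ℤ → Ω → ℝ}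

/-- Rademacher variables may be modified on a null set to take only the values `1` and `-1`. -/
lemma exists_rademacher_modification (hξ : IsRademacherSeq P ξ) :
    ∃ ξ' : ℤ → Ω → ℝ, IsRademacherSeq P ξ' ∧ (∀ k ω, ξ' k ω = 1 ∨ ξ' k ω = -1) ∧
      rademacherFourier P ξ' = rademacherFourier P ξ := by
  classical
  set ξ' : ℤ → Ω → ℝ := fun k ω => if ξ k ω = 1 then 1 else -1 with hξ'
  have hm1 : ∀ k, MeasurableSet {ω | ξ k ω = 1} := fun k =>
    hξ.measurable k (measurableSet_singleton 1)
  have hm2 : ∀ k, MeasurableSet {ω | ξ k ω = -1} := fun k =>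
    hξ.measurable k (measurableSet_singleton (-1))
  have hae : ∀ k, ξ k =ᵐ[P] ξ' k := by
    intro k
    have h1 : P ({ω | ξ k ω = 1} ∪ {ω | ξ k ω = -1}) = 1 := by
      rw [measure_union _ (hm2 k), hξ.prob_one, hξ.prob_neg_one, ENNReal.add_halves]
      rw [Set.disjoint_left]
      intro ω h1 h2
      have h1' : ξ k ω = 1 := h1
      have h2' : ξ k ω = -1 := h2
      linarith
    have h2 := (prob_compl_eq_zero_iff ((hm1 k).union (hm2 k))).2 h1
    filter_upwards [mem_ae_iff.2 (by rwa [compl_compl] : P (({ω | ξ k ω = 1} ∪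
      {ω | ξ k ω = -1})ᶜᶜ)ᶜ = 0)] with ω hω
    rw [compl_compl] at hω
    simp only [hξ']
    split_ifs with h
    · exact h
    · exact hω.resolve_left h
  refine ⟨ξ', ⟨fun k => Measurable.ite (hm1 k) measurable_const measurable_const,
    hξ.indep.congr hae, fun k => ?_, fun k => ?_⟩, fun k ω => ?_, ?_⟩
  · rw [← hξ.prob_one k]
    refine measure_congr ?_
    filter_upwards [hae k] with ω hω
    change (ξ' k ω = 1) = (ξ k ω = 1)
    rw [hω]
  · rw [← hξ.prob_neg_one k]
    refine measure_congr ?_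
    filter_upwards [hae k] with ω hω
    change (ξ' k ω = -1) = (ξ k ω = -1)
    rw [hω]
  · simp only [hξ']
    split_ifs <;> simp
  · have hphi : ∀ k, phi ξ' k =ᵐ[prodCircle P] phi ξ k := by
      intro k
      filter_upwards [Measure.quasiMeasurePreserving_fst.ae (hae k)] with q hq
      rw [phi, phi, hq]
    unfold rademacherFourier
    congr 2
    ext g
    constructor
    · rintro ⟨k, hk⟩
      exact ⟨k, hk.trans (hphi k)⟩
    · rintro ⟨k, hk⟩
      exact ⟨k, hk.trans (hphi k).symm⟩

/-- The inequality for elements of the span of the functions `φ_k`. -/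
lemma norm_sq_le_of_mem_span (hξ : IsRademacherSeq P ξ) (hval : ∀ k ω, ξ k ω = 1 ∨ ξ k ω = -1)
    {g : Lp ℂ 2 (prodCircle P)}
    (hg : g ∈ Submodule.span ℂ
      {g : Lp ℂ 2 (prodCircle P) | ∃ k : ℤ, g =ᵐ[prodCircle P] phi ξ k})
    {b : Ω → ℂ} (hbm : Measurable b) (hb : ∀ ω, ‖b ω‖ ≤ ‖g‖ / 20)
    {E : Set (Ω × AddCircle (1 : ℝ))} (hE : MeasurableSet E) (hE0 : 0 < (prodCircle P).real E) :
    ‖g‖ ^ 2 ≤ Real.exp (10 ^ 15 * Real.log (2 / (prodCircle P).real E) ^ 6) *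
      ∫ q in E, ‖g q - b q.1‖ ^ 2 ∂(prodCircle P) := by
  obtain ⟨n, e, v, he, hv⟩ := exists_synth_of_mem_span hg
  have hψ := isChaosSystem_phi (P := P) hξ hval he
  have hnorm : ‖g‖ = ‖v‖ := by
    have h1 : ‖g‖ ^ 2 = ‖v‖ ^ 2 := by
      rw [norm_sq_eq_integral, ← hψ.integral_sq v]
      refine integral_congr_ae ?_
      filter_upwards [hv] with q hq
      rw [hq]
    exact (sq_eq_sq₀ (norm_nonneg _) (norm_nonneg _)).1 h1
  have hint : ∫ q in E, ‖g q - b q.1‖ ^ 2 ∂(prodCircle P) =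
      ∫ q in E, ‖synth (fun k => phi ξ (e k)) v q - b q.1‖ ^ 2 ∂(prodCircle P) := by
    refine integral_congr_ae (ae_restrict_of_ae ?_)
    filter_upwards [hv] with q hq
    rw [hq]
  rw [hint, hnorm]
  exact norm_sq_le_exp_mul_setIntegral hψ (hasSmallRotations_phi ξ he b) v
    (fun q => by rw [← hnorm]; exact hb q.1) (hbm.comp measurable_fst) hE hE0

/-- Passage to the closure: both sides of the inequality are continuous in `f`. -/
lemma norm_sq_le_of_mem_rademacherFourier (hξ : IsRademacherSeq P ξ)
    {f : Lp ℂ 2 (prodCircle P)} (hf : f ∈ rademacherFourier P ξ) {b : Lp ℂ ⊤ P}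
    (hb : ‖b‖ < ‖f‖ / 20) {E : Set (Ω × AddCircle (1 : ℝ))} (hE : MeasurableSet E)
    (hE0 : 0 < (prodCircle P).real E) :
    ‖f‖ ^ 2 ≤ Real.exp (10 ^ 15 * Real.log (2 / (prodCircle P).real E) ^ 6) *
      ∫ q in E, ‖f q - b q.1‖ ^ 2 ∂(prodCircle P) := by
  classical
  obtain ⟨ξ', hξ', hval, heq⟩ := exists_rademacher_modification hξ
  rw [← heq] at hf
  -- a bounded representative of `b`
  obtain ⟨b₀, hb₀m, hb₀, hbb₀⟩ : ∃ b₀ : Ω → ℂ, Measurable b₀ ∧ (∀ ω, ‖b₀ ω‖ ≤ ‖b‖) ∧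
      b =ᵐ[P] b₀ := by
    have h1 := (Lp.aestronglyMeasurable b).stronglyMeasurable_mk.measurable
    refine ⟨fun ω => if ‖(Lp.aestronglyMeasurable b).mk b ω‖ ≤ ‖b‖ then
      (Lp.aestronglyMeasurable b).mk b ω else 0,
      Measurable.ite (measurableSet_le h1.norm measurable_const) h1 measurable_const,
      fun ω => ?_, ?_⟩
    · dsimp only
      split_ifs with h
      · exact h
      · simp
    · have h2 : ∀ᵐ ω ∂P, ‖b ω‖ ≤ ‖b‖ := by
        filter_upwards [ae_le_eLpNormEssSup (f := b) (μ := P)] with ω hω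
        rw [Lp.norm_def, eLpNorm_exponent_top]
        have h3 : eLpNormEssSup b P ≠ ⊤ := by
          rw [← eLpNorm_exponent_top]; exact Lp.eLpNorm_ne_top b
        have h4 := ENNReal.toReal_mono h3 hω
        simpa using h4
      filter_upwards [h2, (Lp.aestronglyMeasurable b).ae_eq_mk] with ω h3 h4
      rw [← h4, if_pos h3]
  have hb₂ : MemLp (fun q : Ω × AddCircle (1 : ℝ) => b₀ q.1) 2 (prodCircle P) :=
    MemLp.of_bound (hb₀m.comp measurable_fst).aestronglyMeasurable ‖b‖
      (Filter.Eventually.of_forall fun q => hb₀ q.1)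
  set c : Lp ℂ 2 (prodCircle P) := hb₂.toLp _ with hc
  set T := LpToLpRestrictCLM (Ω × AddCircle (1 : ℝ)) ℂ ℂ (prodCircle P) 2 E with hT
  have hTint : ∀ g : Lp ℂ 2 (prodCircle P), ‖T (g - c)‖ ^ 2 =
      ∫ q in E, ‖g q - b₀ q.1‖ ^ 2 ∂(prodCircle P) := by
    intro g
    rw [norm_sq_eq_integral]
    refine integral_congr_ae ?_
    filter_upwards [LpToLpRestrictCLM_coeFn ℂ E (g - c), ae_restrict_of_ae (Lp.coeFn_sub g c),
      ae_restrict_of_ae hb₂.coeFn_toLp] with q h1 h2 h3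
    rw [h1, h2, Pi.sub_apply, h3]
  have hfb : ∫ q in E, ‖f q - b q.1‖ ^ 2 ∂(prodCircle P) = ‖T (f - c)‖ ^ 2 := by
    rw [hTint]
    refine integral_congr_ae (ae_restrict_of_ae ?_)
    filter_upwards [Measure.quasiMeasurePreserving_fst.ae hbb₀] with q hq
    rw [hq]
  rw [hfb]
  set K := Real.exp (10 ^ 15 * Real.log (2 / (prodCircle P).real E) ^ 6) with hK
  by_contra hcon
  have hopen : IsOpen {g : Lp ℂ 2 (prodCircle P) | ‖b‖ < ‖g‖ / 20 ∧
      K * ‖T (g - c)‖ ^ 2 < ‖g‖ ^ 2} := by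
    refine IsOpen.and (isOpen_lt continuous_const (by fun_prop)) (isOpen_lt ?_ (by fun_prop))
    exact continuous_const.mul ((T.continuous.comp (continuous_id.sub continuous_const)).norm.pow 2)
  obtain ⟨g, ⟨hg1, hg2⟩, hg3⟩ := mem_closure_iff.1 hf _ hopen ⟨hb, not_le.1 hcon⟩
  refine absurd (norm_sq_le_of_mem_span hξ' hval hg3 hb₀m (fun ω => (hb₀ ω).trans hg1.le) hE hE0)
    (not_le.2 ?_)
  rwa [← hTint, ← hK]

end Reduction

end RademacherFourier

end

theorem theorem2p1 :
    ∃ C : ℝ, 0 < C ∧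
      ∀ (Ω : Type u) [MeasurableSpace Ω] (P : Measure Ω) [IsProbabilityMeasure P]
        (ξ : ℤ → Ω → ℝ), IsRademacherSeq P ξ →
      ∀ f ∈ rademacherFourier P ξ,
      ∀ E : Set (Ω × AddCircle (1 : ℝ)), NullMeasurableSet E (prodCircle P) →
        0 < prodCircle P E →
      (∀ b : Lp ℂ ⊤ P, ‖b‖ < ‖f‖ / 20 →
        ∫ q, ‖f q‖ ^ 2 ∂(prodCircle P) ≤
          Real.exp (C * Real.log (2 / (prodCircle P).real E) ^ 6) *
            ∫ q in E, ‖f q - b q.1‖ ^ 2 ∂(prodCircle P)) ∧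
      ∫ q, ‖f q‖ ^ 2 ∂(prodCircle P) ≤
        Real.exp (C * Real.log (2 / (prodCircle P).real E) ^ 6) *
          ∫ q in E, ‖f q‖ ^ 2 ∂(prodCircle P) := by
  refine ⟨10 ^ 15, by norm_num, fun Ω _ P _ ξ hξ f hf E hE hE0 => ?_⟩
  obtain ⟨F, -, hFm, hFE⟩ := hE.exists_measurable_subset_ae_eq
  have hF0 : 0 < (prodCircle P).real F := by
    rw [measureReal_congr hFE]
    exact ENNReal.toReal_pos hE0.ne' (measure_ne_top _ _)
  rw [← measureReal_congr hFE, ← norm_sq_eq_integral]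
  have hmain : ∀ b : Lp ℂ ⊤ P, ‖b‖ < ‖f‖ / 20 → ‖f‖ ^ 2 ≤
      Real.exp (10 ^ 15 * Real.log (2 / (prodCircle P).real F) ^ 6) *
        ∫ q in E, ‖f q - b q.1‖ ^ 2 ∂(prodCircle P) := by
    intro b hb
    rw [← setIntegral_congr_set hFE]
    exact norm_sq_le_of_mem_rademacherFourier hξ hf hb hFm hF0
  refine ⟨hmain, ?_⟩
  rcases eq_or_lt_of_le (norm_nonneg f) with h0 | h0
  · rw [← h0, zero_pow two_ne_zero]
    exact mul_nonneg (Real.exp_pos _).le (integral_nonneg fun q => sq_nonneg _)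
  · refine (hmain 0 (by rw [norm_zero]; positivity)).trans (le_of_eq ?_)
    congr 1
    refine integral_congr_ae (ae_restrict_of_ae ?_)
    filter_upwards [Measure.quasiMeasurePreserving_fst.ae (Lp.coeFn_zero ℂ ⊤ P)] with q hq
    rw [hq, Pi.zero_apply, sub_zero]
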